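/- **Notation.** Let $n\in\mathbb N$, $h_0>0$ and $C,\lambda\ge 0$. For $h>0$ put $\delta_{-h}Y(x)=(x-h)\frac{Y(x)-Y(x-h)}{h}$ and $x^{-[s]_h}=\frac1{x(x+h)\cdots(x+(s-1)h)}$, $x^{[s]_h}=1/x^{-[s]_h}$. Let $\mathcal O^{(h)}_{fact}$ be the ring of functions that are sums $\sum_{s\ge0}a_sx^{-[s]_h}$ convergent in some right half-plane; $a_0$ is called the value at $+\infty$. A matrix is non-resonant if no two of its eigenvalues differ by a nonzero integer. A matrix is in Jordan form if it is block diagonal with blocks $cI+N$, where $N$ is the upper shift. **Hypothesis (H').** Let $\widetilde A\in M_n(\mathbb C(x))$ and $A^{(h)}\in M_n(\mathbb C(x))$ for $h\in\,]0,h_0[$ be such that: 1. for every $h\in\,]0,h_0[$, $A^{(h)}(x)=\sum_{s\ge0}A^{(h)}_sx^{-[s]_h}\in M_n(\mathcal O^{(h)}_{fact})$; there is $h_0'\in\,]0,h_0[$ with $\|A^{(h)}_s\|\le C\lambda^{[s-1]_h}$ for all $s\ge1$ and $h\in\,]0,h_0'[$; the $\|A^{(h)}_0\|$, $h\in\,]0,h_0[$,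 are bounded; $A^{(h)}_s\to\widetilde A_s$ as $h\to0^+$ for every $s\ge 0$, where $\widetilde A(x)=\sum_{s\ge0}\widetilde A_sx^{-s}$ near $\infty$ (here $\|\cdot\|$ is the maximum of the moduli of the entries); 2. there are Jordan reductions $\widetilde A_0=\widetilde P\widetilde J\widetilde P^{-1}$ and $A_0^{(h)}=P^{(h)}J^{(h)}(P^{(h)})^{-1}$, $h\in\,]0,h_0[$, with $P^{(h)}\to\widetilde P$ and $J^{(h)}\to\widetilde J$ as $h\to0^+$; 3. $\widetilde A_0$ is non-resonant; 4. every $x_0\in\mathbb C$ that is not a pole of $\widetilde A$ has a neighbourhood on which $A^{(h)}$ has no pole for $h$ small enough, and $A^{(h)}\to\widetilde A$ as $h\to0^+$, uniformly on every compact subset of $\mathbb C\setminus\{\text{poles of }\widetilde A\}$. **Canonical solutions.** For $k\in\mathbb N$ and $c\in\mathbb C$ let $l^{(k,h)}_c(x)=\frac1{k!}\frac{\partial^k}{\partial c^k}\Big(h^c\frac{\Gamma(x/h)}{\Gamma(x/h-c)}\Big)$. If $A_0=PJP^{-1}$ is a Jordan reduction, put $e^{(h)+}_{A_0}=P\,e^{(h)+}_J\,P^{-1}$,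 where $e_J^{(h)+}$ is obtained from $J$ by replacing each block $cI+N$ with the upper triangular Toeplitz block having $l^{(k,h)}_c$ on its $k$-th superdiagonal. For $A=A^{(h)}$ and $A_0=A^{(h)}_0$, the canonical solution at $+\infty$ of $\delta_{-h}Y=AY$ is the meromorphic continuation to $\mathbb C$ of $e^{(h)+}_A=F\,e^{(h)+}_{A_0}$, where $F\in GL_n(\mathcal O^{(h)}_{fact})$ has value $I$ at $+\infty$ and is such that $Y=FZ$ transforms the system into $\delta_{-h}Z=A_0Z$. Let $\widetilde\Omega^+$ be $\mathbb C$ deprived of the closed horizontal half-lines directed towards $-\infty$ that start at $0$ and at the poles of $\widetilde A$. The Frobenius canonical solution $e_{\widetilde A}$ of $x\widetilde Y'(x)=\widetilde A(x)\widetilde Y(x)$ is the analytic continuation to $\widetilde\Omega^+$ of $\widetilde F(x)x^{\widetilde A_0}$, given for $\operatorname{Re}x$ large with the principal logarithm, where $\widetilde F$ is a power series in $1/x$ convergent near $\infty$, equal to $I$ at $\infty$, such that $\widetilde Y=\widetilde FZ$ transforms the system into $xZ'=\widetilde A_0Z$. **Theorem.** Assume (H'). Then there is $h_1\in\,]0,h_0[$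 such that, for every $h\in\,]0,h_1[$, $A_0^{(h)}$ is non-resonant and the canonical solution $e^{(h)+}_{A^{(h)}}$ exists and is unique. The solution $e_{\widetilde A}$ exists and is unique on $\widetilde\Omega^+$. For every $x\in\widetilde\Omega^+$, $e^{(h)+}_{A^{(h)}}$ is analytic at $x$ for all $h>0$ small enough, and $$e^{(h)+}_{A^{(h)}}(x)\longrightarrow e_{\widetilde A}(x)\qquad(h\to0^+).$$ -/

import Mathlib

open Filter Topology

noncomputable section

namespace Confluence

/-- Square complex matrices of size `n`. -/
abbrev Mat (n : ℕ) : Type := Matrix (Fin n) (Fin n) ℂ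

/-- Square matrices of size `n` with entries in `ℂ(x)`. -/
abbrev RatMat (n : ℕ) : Type := Matrix (Fin n) (Fin n) (RatFunc ℂ)

/-! ### Rational matrices -/

/-- The matrix function defined by a rational matrix (only meaningful away from its poles). -/
def evalMat {n : ℕ} (A : RatMat n) (x : ℂ) : Mat n :=
  A.map fun r => r.eval (RingHom.id ℂ) x

/-- `p` is a (finite) pole of the rational matrix `A`, i.e. a pole of one of its entries.
`RatFunc.denom` is the denominator of the reduced fraction. -/
def IsPole {n : ℕ} (A : RatMat n) (p : ℂ) : Prop :=
  ∃ i j, (A i j).denom.IsRoot p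

/-- The complex plane deprived of the horizontal half-lines, directed towards `-∞`, which start
at `0` and at the poles of `A` (the end points are removed too). -/
def cutPlane {n : ℕ} (A : RatMat n) : Set ℂ :=
  {x | ∀ p : ℂ, (p = 0 ∨ IsPole A p) → ¬ (x.im = p.im ∧ x.re ≤ p.re)}

/-! ### Series of `h`-factorials -/

/-- `x^{-[s]_h} = 1 / (x (x + h) ⋯ (x + (s - 1) h))`. -/
def factTerm (h : ℝ) (s : ℕ) (x : ℂ) : ℂ :=
  (∏ k ∈ Finset.range s, (x + k * h))⁻¹

/-- `x^{[s]_h} = x (x + h) ⋯ (x + (s - 1) h)` for real `x`. -/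
def risingFact (h : ℝ) (s : ℕ) (x : ℝ) : ℝ :=
  ∏ k ∈ Finset.range s, (x + k * h)

/-- `f(x) = ∑ₛ aₛ x^{-[s]_h}`, the series being convergent in some right half-plane.
(A series of factorials which converges in a half-plane converges absolutely in a smaller one,
so that the two possible readings of convergence give the same ring of functions.) -/
def HasFactorialExpansion {n : ℕ} (h : ℝ) (a : ℕ → Mat n) (f : ℂ → Mat n) : Prop :=
  ∃ M : ℝ, ∀ x : ℂ, M < x.re → HasSum (fun s => factTerm h s x • a s) (f x)

/-- The family of series with coefficients `a h s`, `0 < h < h₀`, is of type `(C, lam)`.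
The norm on matrices is the maximum of the moduli of the entries. -/
def IsOfType {n : ℕ} (h₀ C lam : ℝ) (a : ℝ → ℕ → Mat n) : Prop :=
  (∃ h' ∈ Set.Ioo 0 h₀, ∀ h ∈ Set.Ioo 0 h', ∀ s : ℕ, 1 ≤ s →
    ∀ i j, ‖a h s i j‖ ≤ C * risingFact h (s - 1) lam) ∧
  ∃ B : ℝ, ∀ h ∈ Set.Ioo 0 h₀, ∀ i j, ‖a h 0 i j‖ ≤ B

/-! ### Jordan reductions -/

/-- `J` is block diagonal with blocks `c I + N`, `N` the upper shift. -/
def IsJordanForm {n : ℕ} (J : Mat n) : Prop :=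
  (∀ i j : Fin n, j.val ≠ i.val → j.val ≠ i.val + 1 → J i j = 0) ∧
  (∀ i j : Fin n, j.val = i.val + 1 → J i j = 0 ∨ (J i j = 1 ∧ J i i = J j j))

/-- `A₀ = P J P⁻¹` with `P` invertible and `J` in Jordan form. -/
def IsJordanReduction {n : ℕ} (A₀ P J : Mat n) : Prop :=
  IsUnit P.det ∧ IsJordanForm J ∧ A₀ = P * J * P⁻¹

/-- A Jordan reduction of `A₀` unfolds into Jordan reductions of the `B h`, `0 < h < h₀`. -/
def JordanUnfolds {n : ℕ} (h₀ : ℝ) (A₀ : Mat n) (B : ℝ → Mat n) : Prop :=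
  ∃ (P J : Mat n) (Ph Jh : ℝ → Mat n),
    IsJordanReduction A₀ P J ∧
    (∀ h ∈ Set.Ioo 0 h₀, IsJordanReduction (B h) (Ph h) (Jh h)) ∧
    Tendsto Ph (𝓝[>] 0) (𝓝 P) ∧ Tendsto Jh (𝓝[>] 0) (𝓝 J)

/-- Two eigenvalues of `A₀` never differ by a nonzero integer. -/
def NonResonant {n : ℕ} (A₀ : Mat n) : Prop :=
  ∀ μ ∈ spectrum ℂ A₀, ∀ ν ∈ spectrum ℂ A₀, ∀ k : ℤ, μ - ν = k → k = 0

/-! ### Difference systems with constant matrix -/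

/-- The character of step `h`: `h^c Γ(x/h) / Γ(x/h - c)`. -/
def charac (h : ℝ) (c x : ℂ) : ℂ :=
  (h : ℂ) ^ c * (Complex.Gamma (x / h) / Complex.Gamma (x / h - c))

/-- The logarithms of step `h`: `(1/k!) ∂^k/∂c^k` of the character. -/
def logar (h : ℝ) (k : ℕ) (c x : ℂ) : ℂ :=
  iteratedDeriv k (fun c' => charac h c' x) c / (k.factorial : ℂ)

open Classical in
/-- For `J` in Jordan form, the block diagonal matrix whose blocks are upper triangular Toeplitz
matrices with the `logar h k c` on the `k`-th superdiagonal. The condition on `i`, `j` says that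
they are indices in the same Jordan block with `i ≤ j`. -/
def jordanSol {n : ℕ} (h : ℝ) (J : Mat n) (x : ℂ) : Mat n :=
  Matrix.of fun i j =>
    if i ≤ j ∧ ∀ k l : Fin n, i ≤ k → l ≤ j → l.val = k.val + 1 → J k l = 1
    then logar h (j.val - i.val) (J i i) x else 0

/-- `e` is the solution `P · jordanSol h J · P⁻¹` of the system of step `h` with constant matrix
`A₀`, for some Jordan reduction `A₀ = P J P⁻¹`. -/
def IsConstantSolution {n : ℕ} (h : ℝ) (A₀ : Mat n) (e : ℂ → Mat n) : Prop :=
  ∃ P J : Mat n, IsJordanReduction A₀ P J ∧ ∀ x, e x = P * jordanSol h J x * P⁻¹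

/-! ### The canonical solution of a difference system -/

/-- The matrix `A^F` of the system obtained from `δ_{-h} Y = A Y`, where
`δ_{-h} Y(x) = (x - h) (Y(x) - Y(x - h)) / h`, by the change of unknown `Y = F Z`. The first system
reads `Y(x - h) = (1 - h A(x) / (x - h)) Y(x)`. -/
def gaugeTransform {n : ℕ} (h : ℝ) (A F : ℂ → Mat n) (x : ℂ) : Mat n :=
  ((x - h) / h) • (1 - (F (x - h))⁻¹ * (1 - (h / (x - h)) • A x) * F x)

/-- `F` is an element of `GL_n` of the ring of series of `h`-factorials (it has an inverse in
`M_n` of that ring), tangent to `1` at `+∞`, and `A^F = A₀`. -/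
def IsNormalizingGauge {n : ℕ} (h : ℝ) (A : ℂ → Mat n) (A₀ : Mat n) (F : ℂ → Mat n) : Prop :=
  (∃ f : ℕ → Mat n, f 0 = 1 ∧ HasFactorialExpansion h f F) ∧
  (∃ (g : ℕ → Mat n) (G : ℂ → Mat n), HasFactorialExpansion h g G ∧
    ∃ M : ℝ, ∀ x : ℂ, M < x.re → F x * G x = 1) ∧
  ∃ M : ℝ, ∀ x : ℂ, M < x.re → gaugeTransform h A F x = A₀

/-- `Y` is the canonical solution at `+∞` of `δ_{-h} Y = A Y`, where `A₀` is the value of `A` at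
`+∞`: the meromorphic continuation to `ℂ` of `F · e`, with `F` the normalizing gauge transformation
and `e` the solution of the system with constant matrix `A₀`. Meromorphic functions are taken in
normal form (analytic off their poles, value `0` at poles), so that they are genuine functions. -/
def IsCanonicalSolution {n : ℕ} (h : ℝ) (A : ℂ → Mat n) (A₀ : Mat n) (Y : ℂ → Mat n) : Prop :=
  (∀ i j, MeromorphicNFOn (fun x => Y x i j) Set.univ) ∧
  ∃ F e : ℂ → Mat n, IsNormalizingGauge h A A₀ F ∧ IsConstantSolution h A₀ e ∧
    ∃ M : ℝ, ∀ x : ℂ, M < x.re → Y x = F x * e x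

/-! ### The canonical solution of the limit differential system -/

/-- `E` is the Frobenius canonical solution at `∞` of `x Y'(x) = A(x) Y(x)`, where `A₀ = A(∞)`,
continued to `cutPlane A`: near `+∞` one has `E(x) = F(x) x^{A₀}` for the principal logarithm, with
`F` a convergent power series in `1/x`, equal to `1` at `∞`, such that `Y = F Z` transforms the
system into `x Z' = A₀ Z`. -/
def IsFrobeniusSolution {n : ℕ} (A : RatMat n) (A₀ : Mat n) (E : ℂ → Mat n) : Prop :=
  (∀ i j, AnalyticOnNhd ℂ (fun x => E x i j) (cutPlane A)) ∧
  ∃ (f : ℕ → Mat n) (F : ℂ → Mat n) (R : ℝ), 0 < R ∧ f 0 = 1 ∧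
    (∀ x : ℂ, R < ‖x‖ → HasSum (fun s : ℕ => (x ^ s)⁻¹ • f s) (F x)) ∧
    (∀ x : ℂ, R < ‖x‖ → ∀ i j,
      HasDerivAt (fun z => F z i j) ((x⁻¹ • (evalMat A x * F x - F x * A₀)) i j) x) ∧
    ∀ x : ℂ, R < x.re → E x = F x * NormedSpace.exp (Complex.log x • A₀)

/-! ### The hypotheses -/

/-- The hypotheses on the rational family `A h`, `0 < h < h₀`, with coefficients `a h s` in its
expansions in `h`-factorials, and on the rational limit `L`, with coefficients `ℓ s` in its
expansion at infinity. -/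
structure ConfluenceHypothesis {n : ℕ} (h₀ C lam : ℝ) (A : ℝ → RatMat n) (L : RatMat n)
    (a : ℝ → ℕ → Mat n) (ℓ : ℕ → Mat n) : Prop where
  expansion : ∀ h ∈ Set.Ioo 0 h₀, HasFactorialExpansion h (a h) (evalMat (A h))
  type : IsOfType h₀ C lam a
  coeff_tendsto : ∀ s, Tendsto (fun h => a h s) (𝓝[>] 0) (𝓝 (ℓ s))
  limit_expansion : ∃ R : ℝ, ∀ x : ℂ, R < ‖x‖ →
    HasSum (fun s : ℕ => (x ^ s)⁻¹ • ℓ s) (evalMat L x)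
  unfolds : JordanUnfolds h₀ (ℓ 0) (fun h => a h 0)
  nonresonant : NonResonant (ℓ 0)
  no_poles : ∀ x₀ : ℂ, ¬ IsPole L x₀ →
    ∃ U ∈ 𝓝 x₀, ∀ᶠ h in 𝓝[>] (0 : ℝ), ∀ z ∈ U, ¬ IsPole (A h) z
  uniform : ∀ K : Set ℂ, IsCompact K → (∀ z ∈ K, ¬ IsPole L z) → ∀ i j,
    TendstoUniformlyOn (fun (h : ℝ) z => evalMat (A h) z i j) (fun z => evalMat L z i j)
      (𝓝[>] 0) K

end Confluence

end

noncomputable section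

namespace Confluence

set_option linter.unusedSectionVars false

/-! ### Factorials of step `h` -/

/-! The step `h` and the limit step `0` are treated by one theory. On `x^{-[s]_h}` the operator
`δ_{-h}` is multiplication by `-s`, exactly as `x d/dx` is on `x^{-s}`, and for `h = 0` a series of
factorials is a power series in `1/x`. Inserting `F = ∑ f_s x^{-[s]_h}` in the gauge equation gives
a recurrence `r f_r + [a_0, f_r] = (terms in f_j, j < r)` (`IsGaugeCoef`), whose instance at `h = 0`
is the Frobenius recurrence. Non-resonance makes `X ↦ r X + [a_0, X]` invertible for `r ≥ 1`, with a
lower bound `r / K` that is uniform for `a_0` near the limit (`exists_sylvesterBound`).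

The estimates use the weighted `ℓ¹` norm `∑ ξ^{-[s]_h} ‖f_s‖`. A product of two factorials expands
in factorials with nonnegative coefficients, so this norm is submultiplicative, and for `ξ` large a
discrete Gronwall argument bounds the gauge coefficients uniformly in `h` (`IsGaugeCoef.sum_le`,
`exists_uniform_wtSummable`). The coefficients converge by induction (`tendsto_gaugeCoef`) and the
sums by dominated convergence (`tendsto_factSum`).

For the constant system, the Beta integral turns the character with `Re c < 0` into an integral that
converges to a Gamma integral, whence the limit `x^c`; the recurrence in `c` removes the sign
condition (`tendsto_charac`). The convergence is locally uniform in `c`, so the `c`-derivatives,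
that is the logarithms, converge too. Both the discrete and the continuous constant solutions are
entire functions of the matrix (`IsJordanReduction.hasSum`); hence they do not depend on the Jordan
reduction, and the unfolding can be used to compute the limit.

This settles a fixed right half-plane. To reach a point `x` further left, the difference system
writes the solution at `x` as a product of about `T / h` matrices `1 - h A(y) / (y - h)` times its
value near `x + T`. This is an Euler scheme for `E' = x⁻¹ L E` along a horizontal segment, which
stays in the cut plane, and consistency with stability gives the limit (`tendsto_stepProd_mul`,
`ConfluenceHypothesis.tendsto_of_eq_right`). The same Euler products, with dyadic steps, construct
the continuation of the Frobenius solution (`exists_continuation`). Uniqueness follows from the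
uniqueness of the coefficients and from identity theorems. -/

lemma risingFact_zero (h x : ℝ) : risingFact h 0 x = 1 := by simp [risingFact]

lemma risingFact_succ (h : ℝ) (s : ℕ) (x : ℝ) :
    risingFact h (s + 1) x = risingFact h s x * (x + s * h) := by
  simp [risingFact, Finset.prod_range_succ]

lemma risingFact_nonneg {h x : ℝ} (hh : 0 ≤ h) (hx : 0 ≤ x) (s : ℕ) : 0 ≤ risingFact h s x :=
  Finset.prod_nonneg fun k _ => by positivity

lemma risingFact_pos {h x : ℝ} (hh : 0 ≤ h) (hx : 0 < x) (s : ℕ) : 0 < risingFact h s x :=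
  Finset.prod_pos fun k _ => by positivity

lemma risingFact_add (h : ℝ) (s t : ℕ) (x : ℝ) :
    risingFact h (s + t) x = risingFact h s x * risingFact h t (x + s * h) := by
  simp only [risingFact, Finset.prod_range_add]
  congr 1
  refine Finset.prod_congr rfl fun k _ => ?_
  push_cast; ring

lemma factTerm_zero (h : ℝ) (z : ℂ) : factTerm h 0 z = 1 := by simp [factTerm]

lemma factTerm_succ (h : ℝ) (s : ℕ) (z : ℂ) :
    factTerm h (s + 1) z = factTerm h s z * (z + s * h)⁻¹ := by
  simp [factTerm, Finset.prod_range_succ, mul_comm]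

lemma factTerm_step_zero (s : ℕ) (z : ℂ) : factTerm 0 s z = (z ^ s)⁻¹ := by
  simp [factTerm]

/-- The value of `x^{-[s]_h}` at the real point `ξ`. -/
def wt (h ξ : ℝ) (s : ℕ) : ℝ := (risingFact h s ξ)⁻¹

lemma wt_zero (h ξ : ℝ) : wt h ξ 0 = 1 := by simp [wt, risingFact_zero]

lemma wt_succ (h ξ : ℝ) (s : ℕ) : wt h ξ (s + 1) = wt h ξ s * (ξ + s * h)⁻¹ := by
  simp [wt, risingFact_succ, mul_comm]

lemma wt_pos {h ξ : ℝ} (hh : 0 ≤ h) (hξ : 0 < ξ) (s : ℕ) : 0 < wt h ξ s :=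
  inv_pos.2 (risingFact_pos hh hξ s)

lemma wt_add (h ξ : ℝ) (s t : ℕ) : wt h ξ (s + t) = wt h ξ s * wt h (ξ + s * h) t := by
  simp [wt, risingFact_add, mul_comm]

/-- The terms `z^{-[s]_h}` are dominated by their values at the real point `ξ`. -/
def IsFar (h ξ : ℝ) (z : ℂ) : Prop := ∀ k : ℕ, ξ + k * h ≤ ‖z + k * h‖

lemma IsFar.of_re {h ξ : ℝ} {z : ℂ} (hz : ξ ≤ z.re) : IsFar h ξ z := fun k => by
  refine le_trans ?_ (Complex.re_le_norm _)
  simpa using hz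

/-- At step `0` only the modulus matters, so the same results then hold on a full neighbourhood of
infinity instead of a half-plane. -/
lemma IsFar.of_norm {ξ : ℝ} {z : ℂ} (hz : ξ ≤ ‖z‖) : IsFar 0 ξ z := fun k => by
  simpa using hz

lemma IsFar.ne_zero {h ξ : ℝ} {z : ℂ} (hz : IsFar h ξ z) (hh : 0 ≤ h) (hξ : 0 < ξ) (k : ℕ) :
    z + k * h ≠ 0 := by
  have := hz k
  have h2 : 0 < ξ + k * h := by positivity
  exact norm_pos_iff.1 (h2.trans_le this)

lemma IsFar.norm_factTerm_le {h ξ : ℝ} {z : ℂ} (hz : IsFar h ξ z) (hh : 0 ≤ h) (hξ : 0 < ξ)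
    (s : ℕ) : ‖factTerm h s z‖ ≤ wt h ξ s := by
  rw [factTerm, wt, risingFact, norm_inv, norm_prod]
  refine inv_anti₀ (Finset.prod_pos fun k _ => by positivity) ?_
  exact Finset.prod_le_prod (fun k _ => by positivity) fun k _ => hz k

lemma factTerm_ofReal (h ξ : ℝ) (s : ℕ) : factTerm h s (ξ : ℂ) = (wt h ξ s : ℂ) := by
  simp [factTerm, wt, risingFact]

lemma wt_le_wt {h ξ ξ' : ℝ} (hh : 0 ≤ h) (hξ : 0 < ξ) (hle : ξ ≤ ξ') (s : ℕ) :
    wt h ξ' s ≤ wt h ξ s := by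
  refine inv_anti₀ (risingFact_pos hh hξ s) ?_
  exact Finset.prod_le_prod (fun k _ => by positivity) fun k _ => by gcongr

/-- The first factor alone supplies the gain `ξ / ξ'`. It makes the non-constant part of a series
small far to the right. -/
lemma wt_le_mul_wt {h ξ ξ' : ℝ} (hh : 0 ≤ h) (hξ : 0 < ξ) (hle : ξ ≤ ξ') {s : ℕ} (hs : 1 ≤ s) :
    wt h ξ' s ≤ ξ / ξ' * wt h ξ s := by
  obtain ⟨t, rfl⟩ := Nat.exists_eq_add_of_le hs
  rw [wt_add, wt_add]
  have h1 : wt h (ξ' + (1 : ℕ) * h) t ≤ wt h (ξ + (1 : ℕ) * h) t :=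
    wt_le_wt hh (by positivity) (by linarith) t
  have hw : ∀ x, wt h x 1 = x⁻¹ := fun x => by simp [wt, risingFact]
  rw [hw, hw]
  have : 0 < ξ' := hξ.trans_le hle
  calc ξ'⁻¹ * wt h (ξ' + (1 : ℕ) * h) t ≤ ξ'⁻¹ * wt h (ξ + (1 : ℕ) * h) t := by gcongr
    _ = _ := by field_simp

/-- The quantity is a product of factors `1 - e_k` with `e_k = (β - α) / (β + k h)`, and `∑ e_k`
diverges by comparison with the harmonic series. -/
lemma tendsto_risingFact_mul_wt {h α β : ℝ} (hh : 0 ≤ h) (hα : 0 ≤ α) (hαβ : α < β) :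
    Tendsto (fun K => risingFact h K α * wt h β K) atTop (𝓝 0) := by
  have hβ : 0 < β := hα.trans_lt hαβ
  set S : ℕ → ℝ := fun K => ∑ k ∈ Finset.range K, (β - α) / (β + k * h) with hS
  have hS0 : ∀ K, 0 ≤ S K := fun K => Finset.sum_nonneg fun k _ => by
    have : 0 ≤ β - α := by linarith
    positivity
  -- Induction from `(1 - e)(1 + S + e) ≤ 1 + S`, valid for `e, S ≥ 0`.
  have key : ∀ K, risingFact h K α * wt h β K * (1 + S K) ≤ 1 := by
    intro K
    induction K with
    | zero => simp [risingFact_zero, wt_zero, hS]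
    | succ K ih =>
      have hp : 0 < β + K * h := by positivity
      have hr : 0 ≤ risingFact h K α * wt h β K :=
        mul_nonneg (risingFact_nonneg hh hα K) (wt_pos hh hβ K).le
      set e := (β - α) / (β + K * h) with he
      have he0 : 0 ≤ e := div_nonneg (by linarith) hp.le
      have h1 : (α + K * h) * (β + K * h)⁻¹ = 1 - e := by
        rw [he]; field_simp; ring
      have h2 : S (K + 1) = S K + e := by simp [hS, Finset.sum_range_succ, he]
      rw [risingFact_succ, wt_succ, h2]
      calc _ = risingFact h K α * wt h β K * ((α + K * h) * (β + K * h)⁻¹) * (1 + (S K + e)) := by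
            ring
        _ = risingFact h K α * wt h β K * (1 + S K - e * S K - e * e) := by rw [h1]; ring
        _ ≤ risingFact h K α * wt h β K * (1 + S K) := by
            refine mul_le_mul_of_nonneg_left ?_ hr
            have := mul_nonneg he0 (hS0 K)
            nlinarith
        _ ≤ 1 := ih
  have hSt : Tendsto (fun K => 1 + S K) atTop atTop := by
    refine tendsto_atTop_add_const_left _ _ ?_
    have hc : 0 < (β - α) / (β + h) := div_pos (by linarith) (by linarith)
    refine tendsto_atTop_mono (fun K => ?_)
      ((Real.tendsto_sum_range_one_div_nat_succ_atTop).const_mul_atTop hc)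
    rw [Finset.mul_sum]
    refine Finset.sum_le_sum fun k _ => ?_
    rw [div_mul_div_comm, mul_one]
    have : 0 ≤ β - α := by linarith
    refine div_le_div_of_nonneg_left this (by positivity) ?_
    have : 0 ≤ (k : ℝ) * β := by positivity
    nlinarith
  refine squeeze_zero (fun K => mul_nonneg (risingFact_nonneg hh hα K) (wt_pos hh hβ K).le)
    (fun K => ?_) hSt.inv_tendsto_atTop
  have : 0 < 1 + S K := by linarith [hS0 K]
  exact (le_div_iff₀ this).2 (key K) |>.trans_eq (one_div _)

/-- The sum telescopes, because `z + s h - α` is the difference of `z + (s + k) h` and `α + k h` for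
every `k`. -/
lemma sum_mul_factTerm {h ξ : ℝ} {z : ℂ} (hz : IsFar h ξ z) (hh : 0 ≤ h) (hξ : 0 < ξ) (s : ℕ)
    (α : ℝ) (K : ℕ) :
    (z + s * h - α) * ∑ k ∈ Finset.range K, (risingFact h k α : ℂ) * factTerm h (s + k + 1) z
      = factTerm h s z - risingFact h K α * factTerm h (s + K) z := by
  induction K with
  | zero => simp [risingFact_zero]
  | succ K ih =>
    have hne := hz.ne_zero hh hξ (s + K)
    have e : ((s : ℂ) + K) = ((s + K : ℕ) : ℂ) := by push_cast; ring
    rw [Finset.sum_range_succ, mul_add, ih, ← add_assoc s K 1, factTerm_succ, risingFact_succ]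
    push_cast at hne ⊢
    have hw := mul_inv_cancel₀ hne
    linear_combination (risingFact h K α : ℂ) * factTerm h (s + K) z * hw

lemma summable_risingFact_mul_wt {h ξ : ℝ} (hh : 0 ≤ h) (hξ : 0 < ξ) (s : ℕ) {α : ℝ}
    (hα : 0 ≤ α) (hα' : α < ξ + s * h) :
    Summable fun k => risingFact h k α * wt h ξ (s + k + 1) := by
  have hpos : 0 < ξ + s * h - α := by linarith
  have nn : ∀ k t, 0 ≤ risingFact h k α * wt h ξ t := fun k t =>
    mul_nonneg (risingFact_nonneg hh hα k) (wt_pos hh hξ _).le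
  refine summable_of_sum_range_le (c := wt h ξ s / (ξ + s * h - α)) (fun k => nn _ _) fun K => ?_
  have := sum_mul_factTerm (z := (ξ : ℂ)) (IsFar.of_re (h := h) (ξ := ξ) (by simp)) hh hξ s α K
  simp only [factTerm_ofReal] at this
  rw [le_div_iff₀ hpos, mul_comm]
  have h2 : (ξ + s * h - α) * ∑ k ∈ Finset.range K, risingFact h k α * wt h ξ (s + k + 1)
      = wt h ξ s - risingFact h K α * wt h ξ (s + K) := by exact_mod_cast this
  rw [h2]
  linarith [nn K (s + K)]

/-- Multiplication of `z^{-[s]_h}` by `1 / (z + s h - α)`. -/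
lemma hasSum_risingFact_mul_factTerm {h ξ : ℝ} {z : ℂ} (hz : IsFar h ξ z) (hh : 0 ≤ h)
    (hξ : 0 < ξ) (s : ℕ) {α : ℝ} (hα : 0 ≤ α) (hα' : α < ξ + s * h) :
    HasSum (fun k => (risingFact h k α : ℂ) * factTerm h (s + k + 1) z)
      (factTerm h s z * (z + s * h - α)⁻¹) := by
  have hne : z + s * h - α ≠ 0 := by
    intro h0
    have h1 : z + s * h = α := by linear_combination h0
    have := hz s
    rw [h1, Complex.norm_real, Real.norm_of_nonneg hα] at this
    linarith
  have hn : ∀ k t, ‖(risingFact h k α : ℂ) * factTerm h t z‖ ≤ risingFact h k α * wt h ξ t := by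
    intro k t
    rw [norm_mul, Complex.norm_real, Real.norm_of_nonneg (risingFact_nonneg hh hα k)]
    exact mul_le_mul_of_nonneg_left (hz.norm_factTerm_le hh hξ t) (risingFact_nonneg hh hα k)
  have hs : Summable fun k => (risingFact h k α : ℂ) * factTerm h (s + k + 1) z :=
    Summable.of_norm_bounded (summable_risingFact_mul_wt hh hξ s hα hα') fun k => hn _ _
  have hrem : Tendsto (fun K => (risingFact h K α : ℂ) * factTerm h (s + K) z) atTop (𝓝 0) := by
    refine squeeze_zero_norm (fun K => hn K _) ?_
    have := (tendsto_risingFact_mul_wt hh hα hα').const_mul (wt h ξ s)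
    rw [mul_zero] at this
    refine this.congr fun K => ?_
    rw [wt_add]; ring
  have h1 : Tendsto (fun K => ∑ k ∈ Finset.range K,
      (risingFact h k α : ℂ) * factTerm h (s + k + 1) z) atTop
      (𝓝 (factTerm h s z * (z + s * h - α)⁻¹)) := by
    have h2 := (tendsto_const_nhds (x := factTerm h s z)).sub hrem |>.mul_const (z + s * h - α)⁻¹
    rw [sub_zero] at h2
    refine h2.congr fun K => ?_
    rw [← sum_mul_factTerm hz hh hξ s α K]
    field_simp
  exact (tendsto_nhds_unique hs.hasSum.tendsto_sum_nat h1) ▸ hs.hasSum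

/-! ### Division and multiplication of factorials, with nonnegative coefficients -/

/-- The coefficients of `x^{-[m]_h} / (x + t h)`. -/
def divKer (h t : ℝ) (m r : ℕ) : ℝ :=
  if m < r then risingFact h (r - m - 1) ((m - t) * h) else 0

lemma divKer_of_le {h t : ℝ} {m r : ℕ} (hr : r ≤ m) : divKer h t m r = 0 := by
  simp [divKer, hr]

lemma divKer_nonneg {h t : ℝ} (hh : 0 ≤ h) {m : ℕ} (ht : t ≤ m) (r : ℕ) : 0 ≤ divKer h t m r := by
  rw [divKer]
  split_ifs
  · exact risingFact_nonneg hh (mul_nonneg (by linarith) hh) _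
  · rfl

lemma hasSum_divKer {h ξ : ℝ} {z : ℂ} (hz : IsFar h ξ z) (hh : 0 ≤ h) (hξ : 0 < ξ) {t : ℝ} {m : ℕ}
    (ht : t ≤ m) (htξ : 0 < ξ + t * h) :
    HasSum (fun r => (divKer h t m r : ℂ) * factTerm h r z)
      (factTerm h m z * (z + t * h)⁻¹) := by
  -- With this `α` the factor `z + m h - α` is `z + t h`; the condition `t ≤ m` makes `α`
  -- nonnegative.
  have h1 := hasSum_risingFact_mul_factTerm hz hh hξ m (α := (m - t) * h)
    (mul_nonneg (by linarith) hh) (by linarith)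
  have inj : Function.Injective fun k : ℕ => m + k + 1 := fun a b hab => by
    simp only at hab; omega
  have e : z + m * h - (((m - t) * h : ℝ) : ℂ) = z + t * h := by push_cast; ring
  rw [e] at h1
  refine (inj.hasSum_iff ?_).1 ?_
  · intro r hr
    have : r ≤ m := by
      by_contra hlt
      exact hr ⟨r - m - 1, by simp only; omega⟩
    simp [divKer_of_le this]
  · convert h1 using 2 with k
    simp only [Function.comp, divKer]
    rw [if_pos (by omega)]
    congr 4
    omega

lemma hasSum_divKer_wt {h ξ : ℝ} (hh : 0 ≤ h) (hξ : 0 < ξ) {t : ℝ} {m : ℕ}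
    (ht : t ≤ m) (htξ : 0 < ξ + t * h) :
    HasSum (fun r => divKer h t m r * wt h ξ r) (wt h ξ m * (ξ + t * h)⁻¹) := by
  have := hasSum_divKer (z := (ξ : ℂ)) (IsFar.of_re (h := h) (ξ := ξ) (by simp)) hh hξ ht htξ
  simp only [factTerm_ofReal] at this
  exact_mod_cast this

section transfer

variable {ι 𝔸 : Type*} [NormedAddCommGroup 𝔸] [NormedSpace ℂ 𝔸] [CompleteSpace 𝔸]

/-- Expansion of a sum of functions which have themselves expansions with nonnegative
coefficients. -/
lemma hasSum_transfer {q : ι → ℕ → ℝ} (hq : ∀ m r, 0 ≤ q m r) {S : ℕ → Finset ι}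
    (hS : ∀ m r, m ∉ S r → q m r = 0) {w : ℕ → ℝ} (hw : ∀ r, 0 ≤ w r) {v : ι → ℝ}
    (hv : ∀ m, HasSum (fun r => q m r * w r) (v m)) {f : ι → 𝔸}
    (hf : Summable fun m => v m * ‖f m‖) {φ : ℕ → ℂ} (hφ : ∀ r, ‖φ r‖ ≤ w r) {ψ : ι → ℂ}
    (hψ : ∀ m, HasSum (fun r => (q m r : ℂ) * φ r) (ψ m)) :
    HasSum (fun r => φ r • ∑ m ∈ S r, (q m r : ℂ) • f m) (∑' m, ψ m • f m) ∧
      Summable fun r => w r * ‖∑ m ∈ S r, (q m r : ℂ) • f m‖ := by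
  have hs : Summable fun p : ι × ℕ => q p.1 p.2 * w p.2 * ‖f p.1‖ := by
    have h0 : 0 ≤ fun p : ι × ℕ => q p.1 p.2 * w p.2 * ‖f p.1‖ := fun p =>
      mul_nonneg (mul_nonneg (hq _ _) (hw _)) (norm_nonneg _)
    rw [summable_prod_of_nonneg h0]
    have h1 : ∀ m, HasSum (fun r => q m r * w r * ‖f m‖) (v m * ‖f m‖) := fun m =>
      (hv m).mul_right ‖f m‖
    refine ⟨fun m => (h1 m).summable, ?_⟩
    have h2 : (fun m => ∑' r, q m r * w r * ‖f m‖) = fun m => v m * ‖f m‖ :=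
      funext fun m => (h1 m).tsum_eq
    change Summable fun m => ∑' r, q m r * w r * ‖f m‖
    rw [h2]
    exact hf
  have hs2 : Summable fun p : ι × ℕ => ((q p.1 p.2 : ℂ) * φ p.2) • f p.1 := by
    refine Summable.of_norm_bounded hs ?_
    rintro ⟨m, r⟩
    have h1 : ‖(q m r : ℂ)‖ = q m r := by
      rw [Complex.norm_real, Real.norm_of_nonneg (hq m r)]
    change ‖((q m r : ℂ) * φ r) • f m‖ ≤ q m r * w r * ‖f m‖
    rw [norm_smul, norm_mul, h1]
    exact mul_le_mul_of_nonneg_right (mul_le_mul_of_nonneg_left (hφ r) (hq m r)) (norm_nonneg _)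
  have hrow : ∀ r, HasSum (fun m => ((q m r : ℂ) * φ r) • f m)
      (φ r • ∑ m ∈ S r, (q m r : ℂ) • f m) := by
    intro r
    have : φ r • ∑ m ∈ S r, (q m r : ℂ) • f m = ∑ m ∈ S r, ((q m r : ℂ) * φ r) • f m := by
      rw [Finset.smul_sum]
      exact Finset.sum_congr rfl fun m _ => by rw [smul_smul, mul_comm]
    rw [this]
    exact hasSum_sum_of_ne_finset_zero fun m hm => by simp [hS m r hm]
  constructor
  · have h1 : HasSum (fun m => ψ m • f m) (∑' p : ι × ℕ, ((q p.1 p.2 : ℂ) * φ p.2) • f p.1) :=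
      hs2.hasSum.prod_fiberwise fun m => (hψ m).smul_const (f m)
    have h0 : HasSum (fun p : ℕ × ι => ((q p.2 p.1 : ℂ) * φ p.1) • f p.2)
        (∑' p : ι × ℕ, ((q p.1 p.2 : ℂ) * φ p.2) • f p.1) :=
      (Equiv.prodComm ℕ ι).hasSum_iff (f := fun p : ι × ℕ => ((q p.1 p.2 : ℂ) * φ p.2) • f p.1)
        |>.2 hs2.hasSum
    rw [h1.tsum_eq]
    exact h0.prod_fiberwise hrow
  · have h3 : Summable fun p : ℕ × ι => q p.2 p.1 * w p.1 * ‖f p.2‖ :=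
      (Equiv.prodComm ℕ ι).summable_iff (f := fun p : ι × ℕ => q p.1 p.2 * w p.2 * ‖f p.1‖) |>.2 hs
    refine Summable.of_nonneg_of_le (fun r => mul_nonneg (hw r) (norm_nonneg _)) (fun r => ?_)
      h3.prod
    have h4 : (∑' m, q m r * w r * ‖f m‖) = ∑ m ∈ S r, q m r * w r * ‖f m‖ :=
      tsum_eq_sum fun m hm => by simp [hS m r hm]
    rw [h4]
    calc w r * ‖∑ m ∈ S r, (q m r : ℂ) • f m‖ ≤ w r * ∑ m ∈ S r, ‖(q m r : ℂ) • f m‖ :=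
          mul_le_mul_of_nonneg_left (norm_sum_le _ _) (hw r)
      _ = _ := by
          rw [Finset.mul_sum]
          refine Finset.sum_congr rfl fun m _ => ?_
          rw [norm_smul, Complex.norm_real, Real.norm_of_nonneg (hq _ _)]
          ring

end transfer

/-- The coefficient of `x^{-[r]_h}` in the product `x^{-[s]_h} x^{-[t]_h}`. -/
def prodCoef (h : ℝ) (s : ℕ) : ℕ → ℕ → ℝ
  | 0, r => if r = s then 1 else 0
  | t + 1, r => ∑ m ∈ Finset.range r, divKer h t m r * prodCoef h s t m

lemma prodCoef_eq_zero (h : ℝ) (s t r : ℕ) (hr : r < s + t) : prodCoef h s t r = 0 := by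
  induction t generalizing r with
  | zero => rw [prodCoef, if_neg (by omega)]
  | succ t ih =>
    rw [prodCoef]
    refine Finset.sum_eq_zero fun m hm => ?_
    rw [ih m (by have := Finset.mem_range.1 hm; omega), mul_zero]

lemma prodCoef_nonneg {h : ℝ} (hh : 0 ≤ h) (s t r : ℕ) : 0 ≤ prodCoef h s t r := by
  induction t generalizing r with
  | zero => rw [prodCoef]; split_ifs <;> norm_num
  | succ t ih =>
    rw [prodCoef]
    refine Finset.sum_nonneg fun m _ => ?_
    by_cases hm : m < s + t
    · simp [prodCoef_eq_zero h s t m hm]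
    · exact mul_nonneg (divKer_nonneg hh (by exact_mod_cast (by omega : t ≤ m)) r) (ih m)

/-- Induction on `t`: passing from `z^{-[t]_h}` to `z^{-[t+1]_h}` divides by `z + t h`, and `divKer`
re-expands every term. Positivity of the kernel justifies the exchange of sums. -/
lemma hasSum_prodCoef {h ξ : ℝ} {z : ℂ} (hz : IsFar h ξ z) (hh : 0 ≤ h) (hξ : 0 < ξ) (s t : ℕ) :
    HasSum (fun r => (prodCoef h s t r : ℂ) * factTerm h r z)
      (factTerm h s z * factTerm h t z) := by
  induction t generalizing z with
  | zero =>
    convert hasSum_single (f := fun r => (prodCoef h s 0 r : ℂ) * factTerm h r z) s ?_ using 1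
    · simp [prodCoef, factTerm_zero]
    · intro r hr; simp [prodCoef, hr]
  | succ t ih =>
    have hξ' : IsFar h ξ (ξ : ℂ) := IsFar.of_re (by simp)
    have hpos : 0 < ξ + t * h := by positivity
    -- the kernel vanishes on the indices `m < t`, where `divKer` may have no sign
    set q : ℕ → ℕ → ℝ := fun m r => if t ≤ m then divKer h t m r else 0 with hq
    have e : ∀ r, prodCoef h s (t + 1) r = ∑ m ∈ Finset.range r, q m r * prodCoef h s t m := by
      intro r
      rw [prodCoef]
      refine Finset.sum_congr rfl fun m _ => ?_
      by_cases hm : t ≤ m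
      · simp [hq, hm]
      · simp [prodCoef_eq_zero h s t m (by omega)]
    set ψ : ℕ → ℂ := fun m => if t ≤ m then factTerm h m z * (z + t * h)⁻¹ else 0 with hψ
    have h1 := hasSum_transfer (𝔸 := ℂ) (q := q) (S := Finset.range) (w := wt h ξ)
      (v := fun m => if t ≤ m then wt h ξ m * (ξ + t * h)⁻¹ else 0)
      (f := fun m => (prodCoef h s t m : ℂ)) (φ := fun r => factTerm h r z) (ψ := ψ)
      (fun m r => ?_) (fun m r hm => ?_) (fun r => (wt_pos hh hξ r).le) (fun m => ?_) ?_
      (hz.norm_factTerm_le hh hξ) (fun m => ?_)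
    · have h2 : ∑' m, ψ m • (prodCoef h s t m : ℂ) = factTerm h s z * factTerm h (t + 1) z := by
        have h3 := (ih hz).mul_right (z + t * h)⁻¹
        rw [factTerm_succ, ← mul_assoc, ← h3.tsum_eq]
        refine tsum_congr fun m => ?_
        by_cases hm : t ≤ m
        · simp only [hψ, hm, if_true, smul_eq_mul]; ring
        · simp [prodCoef_eq_zero h s t m (by omega)]
      rw [h2] at h1
      have h5 := h1.1
      have h6 : (fun r => (prodCoef h s (t + 1) r : ℂ) * factTerm h r z) =
          fun r => factTerm h r z • ∑ m ∈ Finset.range r, (q m r : ℂ) • (prodCoef h s t m : ℂ) := by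
        funext r
        rw [e, smul_eq_mul, mul_comm]
        push_cast
        simp
      rw [h6]
      exact h5
    · simp only [hq]
      split_ifs with hm
      · exact divKer_nonneg hh (by exact_mod_cast hm) r
      · rfl
    · simp only [hq]
      rw [divKer_of_le (by simpa using hm)]; simp
    · by_cases hm : t ≤ m
      · simpa only [hq, hm, if_true] using
          hasSum_divKer_wt hh hξ (t := t) (by exact_mod_cast hm) hpos
      · simp only [hq, hm, if_false, zero_mul]; exact hasSum_zero
    · have h4 := ((ih hξ').summable.norm).mul_left (ξ + t * h)⁻¹
      refine Summable.of_nonneg_of_le (fun m => ?_) (fun m => ?_) h4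
      · split_ifs
        · exact mul_nonneg (mul_nonneg (wt_pos hh hξ m).le (by positivity)) (norm_nonneg _)
        · simp
      · rw [factTerm_ofReal, norm_mul, Complex.norm_real (wt h ξ m),
          Real.norm_of_nonneg (wt_pos hh hξ m).le]
        split_ifs
        · exact le_of_eq (by ring)
        · rw [zero_mul]
          have := (wt_pos hh hξ m).le
          positivity
    · by_cases hm : t ≤ m
      · have := hasSum_divKer hz hh hξ (t := t) (m := m) (by exact_mod_cast hm) hpos
        simpa only [hq, hψ, hm, if_true, Complex.ofReal_natCast] using this
      · simp only [hq, hψ, hm, if_false]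
        simp

/-- Evaluation at the real point `ξ`. Since the coefficients are nonnegative, this identity is the
submultiplicativity of the weighted `ℓ¹` norm, with constant `1` for every `h`. -/
lemma hasSum_prodCoef_wt {h ξ : ℝ} (hh : 0 ≤ h) (hξ : 0 < ξ) (s t : ℕ) :
    HasSum (fun r => prodCoef h s t r * wt h ξ r) (wt h ξ s * wt h ξ t) := by
  have := hasSum_prodCoef (z := (ξ : ℂ)) (IsFar.of_re (h := h) (ξ := ξ) (by simp)) hh hξ s t
  simp only [factTerm_ofReal] at this
  exact_mod_cast this

lemma continuous_risingFact_comp {f g : ℝ → ℝ} (hf : Continuous f) (hg : Continuous g) (s : ℕ) :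
    Continuous fun h => risingFact (f h) s (g h) := by
  unfold risingFact
  fun_prop

lemma continuous_divKer (t : ℝ) (m r : ℕ) : Continuous fun h => divKer h t m r := by
  unfold divKer
  split_ifs
  · exact continuous_risingFact_comp continuous_id (by fun_prop) _
  · exact continuous_const

lemma continuous_prodCoef (s t r : ℕ) : Continuous fun h => prodCoef h s t r := by
  induction t generalizing r with
  | zero => simp only [prodCoef]; exact continuous_const
  | succ t ih =>
    simp only [prodCoef]
    exact continuous_finsetSum _ fun m _ => (continuous_divKer _ m r).mul (ih m)

/-! ### Series of factorials with coefficients in a Banach algebra -/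

lemma exists_forall_eq_of_causal {α : Type*} [Zero α] (G : ℕ → (ℕ → α) → α)
    (hG : ∀ r u v, (∀ j < r, u j = v j) → G r u = G r v) : ∃ f : ℕ → α, ∀ r, f r = G r f := by
  let f : ℕ → α := fun r => Nat.strongRecOn (motive := fun _ => α) r fun m ih =>
    G m fun j => if hj : j < m then ih j hj else 0
  refine ⟨f, fun r => ?_⟩
  have h1 : f r = G r fun j => if j < r then f j else 0 := by
    change Nat.strongRecOn (motive := fun _ => α) r _ = _
    rw [Nat.strongRecOn_eq]
    simp only [dite_eq_ite]
    rfl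
  rw [h1]
  exact hG _ _ _ fun j hj => if_pos hj

/-- A discrete Gronwall inequality in a weighted `ℓ¹` norm. -/
lemma sum_le_of_le_sum_mul {g w : ℕ → ℝ} {q : ℕ → ℕ → ℝ} (hg : ∀ r, 0 ≤ g r) (hw : ∀ r, 0 ≤ w r)
    (hq : ∀ j r, 0 ≤ q j r)
    (hrec : ∀ r, 1 ≤ r → g r ≤ ∑ j ∈ Finset.range r, q j r * g j)
    (hθ : ∀ j N, ∑ r ∈ Finset.range N, q j r * w r ≤ 1 / 2 * w j) (N : ℕ) :
    ∑ r ∈ Finset.range N, g r * w r ≤ 2 * (g 0 * w 0) := by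
  have h0 : 0 ≤ g 0 * w 0 := mul_nonneg (hg 0) (hw 0)
  have h1 : ∑ r ∈ Finset.range N, g r * w r
      ≤ g 0 * w 0 + ∑ r ∈ Finset.range N, ∑ j ∈ Finset.range N, q j r * g j * w r := by
    rcases N with _ | N
    · simpa using h0
    rw [Finset.sum_range_succ' (fun r => g r * w r), Finset.sum_range_succ' (fun r =>
      ∑ j ∈ Finset.range (N + 1), q j r * g j * w r), add_comm]
    have h2 : 0 ≤ ∑ j ∈ Finset.range (N + 1), q j 0 * g j * w 0 :=
      Finset.sum_nonneg fun j _ => mul_nonneg (mul_nonneg (hq _ _) (hg _)) (hw _)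
    have h3 : ∑ r ∈ Finset.range N, g (r + 1) * w (r + 1) ≤
        ∑ r ∈ Finset.range N, ∑ j ∈ Finset.range (N + 1), q j (r + 1) * g j * w (r + 1) := by
      refine Finset.sum_le_sum fun r hr => ?_
      rw [← Finset.sum_mul]
      refine mul_le_mul_of_nonneg_right ((hrec (r + 1) (by omega)).trans ?_) (hw _)
      refine Finset.sum_le_sum_of_subset_of_nonneg (Finset.range_subset_range.2 ?_) fun j _ _ =>
        mul_nonneg (hq _ _) (hg _)
      have := Finset.mem_range.1 hr
      omega
    linarith
  have h4 : ∑ r ∈ Finset.range N, ∑ j ∈ Finset.range N, q j r * g j * w r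
      ≤ 1 / 2 * ∑ j ∈ Finset.range N, g j * w j := by
    rw [Finset.sum_comm, Finset.mul_sum]
    refine Finset.sum_le_sum fun j _ => ?_
    have : ∑ r ∈ Finset.range N, q j r * g j * w r
        = g j * ∑ r ∈ Finset.range N, q j r * w r := by
      rw [Finset.mul_sum]
      exact Finset.sum_congr rfl fun r _ => by ring
    rw [this]
    calc _ ≤ g j * (1 / 2 * w j) := mul_le_mul_of_nonneg_left (hθ j N) (hg j)
      _ = _ := by ring
  -- The total is at most the initial term plus half of itself.
  linarith

/-- A shift of `ξ` pays for a factor `s`. The part `+ h` serves `h > 0`, where the ratio of the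
weights is exactly `ξ / (ξ + s h)`; the part `+ 1` serves `h = 0`, through Bernoulli's inequality.
The constant may depend on `h`: it is used only at a fixed step. -/
lemma exists_natCast_mul_wt_le {h ξ : ℝ} (hh : 0 ≤ h) (hξ : 0 < ξ) :
    ∃ c : ℝ, ∀ s : ℕ, s * wt h (ξ + h + 1) s ≤ c * wt h ξ s := by
  rcases hh.eq_or_lt with rfl | hpos
  · refine ⟨ξ, fun s => ?_⟩
    have h1 : ∀ x : ℝ, wt 0 x s = (x ^ s)⁻¹ := fun x => by simp [wt, risingFact]
    rw [h1, h1, add_zero]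
    have h2 := one_add_mul_le_pow (a := 1 / ξ) (by have : 0 < 1 / ξ := by positivity
                                                   linarith) s
    have h3 : (1 + 1 / ξ) ^ s = (ξ + 1) ^ s / ξ ^ s := by
      rw [← div_pow]; congr 1; field_simp
    rw [h3, le_div_iff₀ (by positivity)] at h2
    rw [← div_eq_mul_inv, ← div_eq_mul_inv, div_le_div_iff₀ (by positivity) (by positivity)]
    have h4 : ξ * ((1 + s * (1 / ξ)) * ξ ^ s) = (ξ + s) * ξ ^ s := by field_simp
    have h5 : 0 < ξ ^ s := by positivity
    nlinarith [mul_le_mul_of_nonneg_left h2 hξ.le]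
  · refine ⟨ξ / h, fun s => ?_⟩
    have h1 : wt h (ξ + h + 1) s ≤ wt h (ξ + h) s := wt_le_wt hh (by positivity) (by linarith) s
    have h2 : wt h (ξ + h) s = wt h ξ s * (ξ * (ξ + s * h)⁻¹) := by
      have h3 : wt h ξ (s + 1) = wt h ξ 1 * wt h (ξ + h) s := by
        rw [add_comm, wt_add]; simp
      rw [wt_succ] at h3
      have h4 : wt h ξ 1 = ξ⁻¹ := by simp [wt, risingFact]
      rw [h4] at h3
      have h5 : 0 < ξ + s * h := by positivity
      field_simp at h3 ⊢
      linarith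
    have h6 : (s : ℝ) * (ξ * (ξ + s * h)⁻¹) ≤ ξ / h := by
      rw [← mul_assoc, ← div_eq_mul_inv, div_le_div_iff₀ (by positivity) hpos]
      nlinarith
    calc (s : ℝ) * wt h (ξ + h + 1) s ≤ s * wt h (ξ + h) s := by gcongr
      _ = wt h ξ s * (s * (ξ * (ξ + s * h)⁻¹)) := by rw [h2]; ring
      _ ≤ wt h ξ s * (ξ / h) := mul_le_mul_of_nonneg_left h6 (wt_pos hh hξ s).le
      _ = _ := mul_comm _ _


variable {𝔸 : Type*} [NormedRing 𝔸] [NormedAlgebra ℂ 𝔸]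

/-- Absolute convergence of the series of factorials at the real point `ξ`. -/
def WtSummable (h ξ : ℝ) (f : ℕ → 𝔸) : Prop := Summable fun s => wt h ξ s * ‖f s‖

/-- The sum of a series of factorials. -/
def factSum (h : ℝ) (f : ℕ → 𝔸) (z : ℂ) : 𝔸 := ∑' s, factTerm h s z • f s

lemma WtSummable.mono {h ξ ξ' : ℝ} {f : ℕ → 𝔸} (hf : WtSummable h ξ f) (hh : 0 ≤ h) (hξ : 0 < ξ)
    (hle : ξ ≤ ξ') : WtSummable h ξ' f :=
  Summable.of_nonneg_of_le (fun s => mul_nonneg (wt_pos hh (hξ.trans_le hle) s).le (norm_nonneg _))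
    (fun s => mul_le_mul_of_nonneg_right (wt_le_wt hh hξ hle s) (norm_nonneg _)) hf

lemma WtSummable.natCast_smul {h ξ : ℝ} {f : ℕ → 𝔸} (hf : WtSummable h ξ f) (hh : 0 ≤ h)
    (hξ : 0 < ξ) : WtSummable h (ξ + h + 1) fun s => (s : ℂ) • f s := by
  obtain ⟨c, hc⟩ := exists_natCast_mul_wt_le hh hξ
  have hpos : 0 < ξ + h + 1 := by linarith
  refine Summable.of_nonneg_of_le (fun s => mul_nonneg (wt_pos hh hpos s).le (norm_nonneg _))
    (fun s => ?_) (Summable.mul_left c hf)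
  rw [norm_smul, Complex.norm_natCast, ← mul_assoc, mul_comm _ (s : ℝ), ← mul_assoc]
  exact mul_le_mul_of_nonneg_right (hc s) (norm_nonneg _)

lemma WtSummable.summable_norm {h ξ : ℝ} {f : ℕ → 𝔸} (hf : WtSummable h ξ f) {z : ℂ}
    (hz : IsFar h ξ z) (hh : 0 ≤ h) (hξ : 0 < ξ) : Summable fun s => ‖factTerm h s z • f s‖ := by
  refine Summable.of_nonneg_of_le (fun s => norm_nonneg _) (fun s => ?_) hf
  rw [norm_smul]
  exact mul_le_mul_of_nonneg_right (hz.norm_factTerm_le hh hξ s) (norm_nonneg _)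

lemma WtSummable.hasSum [CompleteSpace 𝔸] {h ξ : ℝ} {f : ℕ → 𝔸} (hf : WtSummable h ξ f) {z : ℂ}
    (hz : IsFar h ξ z) (hh : 0 ≤ h) (hξ : 0 < ξ) :
    HasSum (fun s => factTerm h s z • f s) (factSum h f z) :=
  (hf.summable_norm hz hh hξ).of_norm.hasSum

/-- A series of factorials which vanishes near `+∞` has zero coefficients. -/
lemma WtSummable.eq_zero [CompleteSpace 𝔸] {h ξ X : ℝ} {e : ℕ → 𝔸} (he : WtSummable h ξ e)
    (hh : 0 ≤ h) (hξ : 0 < ξ) (h0 : ∀ x : ℝ, X < x → factSum h e x = 0) (r : ℕ) : e r = 0 := by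
  induction r using Nat.strong_induction_on with
  | _ r ih =>
    set c := ∑' t, wt h (ξ + r * h) (t + 1) * ‖e (r + (t + 1))‖ with hc
    have hpos : 0 < ξ + r * h := by positivity
    have hsum : Summable fun t => wt h (ξ + r * h) (t + 1) * ‖e (r + (t + 1))‖ := by
      have h1 := ((summable_nat_add_iff (r + 1)).2 he).mul_left (wt h ξ r)⁻¹
      refine h1.congr fun t => ?_
      have h2 : t + (r + 1) = r + (t + 1) := by ring
      rw [h2, wt_add]
      have := (wt_pos hh hξ r).ne'
      field_simp
    -- Once the lower coefficients vanish, `e r` is minus the tail divided by `x^{-[r]_h}`, and the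
    -- first extra factor makes this quotient `O(1/x)`.
    have key : ∀ x : ℝ, max X ξ < x → ‖e r‖ ≤ (ξ + r * h) / (x + r * h) * c := by
      intro x hx
      have hxX : X < x := (le_max_left _ _).trans_lt hx
      have hxξ : ξ < x := (le_max_right _ _).trans_lt hx
      have hx0 : 0 < x := hξ.trans hxξ
      have hfar : IsFar h ξ (x : ℂ) := IsFar.of_re (by simpa using hxξ.le)
      have hS := he.hasSum hfar hh hξ
      rw [h0 x hxX] at hS
      have h3 := (hasSum_nat_add_iff' (r + 1)).2 hS
      rw [Finset.sum_range_succ, Finset.sum_eq_zero (fun i hi => by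
        rw [ih i (Finset.mem_range.1 hi), smul_zero]), zero_add, zero_sub] at h3
      have hb : ∀ t, ‖factTerm h (t + (r + 1)) x • e (t + (r + 1))‖ ≤
          wt h x r * ((ξ + r * h) / (x + r * h)) *
            (wt h (ξ + r * h) (t + 1) * ‖e (r + (t + 1))‖) := by
        intro t
        have h2 : t + (r + 1) = r + (t + 1) := by ring
        have h4 := wt_le_mul_wt hh hpos (by linarith : ξ + r * h ≤ x + r * h)
          (by omega : 1 ≤ t + 1)
        rw [h2, factTerm_ofReal, norm_smul, Complex.norm_real,
          Real.norm_of_nonneg (wt_pos hh hx0 _).le, wt_add]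
        calc _ ≤ wt h x r * ((ξ + r * h) / (x + r * h) * wt h (ξ + r * h) (t + 1))
                * ‖e (r + (t + 1))‖ := by
              have := (wt_pos hh hx0 r).le
              gcongr
          _ = _ := by ring
      have h5 := tsum_of_norm_bounded (hsum.hasSum.mul_left _) hb
      rw [h3.tsum_eq, norm_neg, norm_smul, factTerm_ofReal, Complex.norm_real,
        Real.norm_of_nonneg (wt_pos hh hx0 _).le, mul_assoc] at h5
      exact le_of_mul_le_mul_left h5 (wt_pos hh hx0 r)
    have hlim : Tendsto (fun x : ℝ => (ξ + r * h) / (x + r * h) * c) atTop (𝓝 0) := by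
      have := ((tendsto_atTop_add_const_right atTop (r * h) tendsto_id).const_div_atTop
        (ξ + r * h)).mul_const c
      simpa using this
    have : ‖e r‖ ≤ 0 := ge_of_tendsto hlim ((eventually_gt_atTop (max X ξ)).mono key)
    exact norm_le_zero_iff.1 this

/-- The coefficients of a product of series of factorials. -/
def mulCoef (h : ℝ) (a b : ℕ → 𝔸) (r : ℕ) : 𝔸 :=
  ∑ p ∈ Finset.range (r + 1) ×ˢ Finset.range (r + 1), (prodCoef h p.1 p.2 r : ℂ) • (a p.1 * b p.2)

/-- The part of `mulCoef` which does not involve the constant term of the left factor. -/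
def lowCoef (h : ℝ) (a b : ℕ → 𝔸) (r : ℕ) : 𝔸 :=
  ∑ j ∈ Finset.range r, ∑ i ∈ Finset.Icc 1 r, (prodCoef h i j r : ℂ) • (a i * b j)

lemma prodCoef_zero_left (h : ℝ) (t r : ℕ) : prodCoef h 0 t r = if r = t then 1 else 0 := by
  induction t generalizing r with
  | zero => rfl
  | succ t ih =>
    rw [prodCoef]
    simp only [ih]
    by_cases ht : t < r
    · rw [Finset.sum_eq_single t (by intro b _ hb; simp [hb]) (by simp [ht])]
      rw [divKer, if_pos ht, if_pos rfl, mul_one, sub_self, zero_mul]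
      by_cases hr : r = t + 1
      · subst hr; simp [risingFact]
      · rw [if_neg hr, risingFact]
        exact Finset.prod_eq_zero (i := 0) (Finset.mem_range.2 (by omega)) (by simp)
    · rw [if_neg (by omega)]
      refine Finset.sum_eq_zero fun m hm => ?_
      have := Finset.mem_range.1 hm
      rw [if_neg (by omega), mul_zero]

/-- The system is triangular: `b r` enters the `r`-th coefficient through the constant term of `a`
only. This turns equations between series into recurrences. -/
lemma mulCoef_eq (h : ℝ) (a b : ℕ → 𝔸) (r : ℕ) :
    mulCoef h a b r = a 0 * b r + lowCoef h a b r := by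
  rw [mulCoef, Finset.sum_product_right, lowCoef]
  have h1 : ∀ j, ∑ i ∈ Finset.range (r + 1), (prodCoef h i j r : ℂ) • (a i * b j)
      = (if r = j then a 0 * b j else 0) +
        ∑ i ∈ Finset.Icc 1 r, (prodCoef h i j r : ℂ) • (a i * b j) := by
    intro j
    rw [Finset.range_eq_Ico, Finset.sum_eq_sum_Ico_succ_bot (by omega), prodCoef_zero_left]
    congr 1
    by_cases hj : r = j <;> simp [hj]
  simp only [h1, Finset.sum_add_distrib]
  congr 1
  · simp
  · rw [Finset.sum_range_succ, add_eq_left]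
    refine Finset.sum_eq_zero fun i hi => ?_
    rw [prodCoef_eq_zero h i r r (by have := Finset.mem_Icc.1 hi; omega)]
    simp

/-- `hasSum_transfer` over pairs of indices; the square `range (r + 1) ×ˢ range (r + 1)` contains
every pair that contributes to the index `r`, since `prodCoef` vanishes when `s + t > r`. -/
lemma hasSum_mulCoef [CompleteSpace 𝔸] {h ξ : ℝ} (hh : 0 ≤ h) (hξ : 0 < ξ) {a b : ℕ → 𝔸}
    (ha : WtSummable h ξ a) (hb : WtSummable h ξ b) {z : ℂ} (hz : IsFar h ξ z) :
    HasSum (fun r => factTerm h r z • mulCoef h a b r) (factSum h a z * factSum h b z) ∧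
      WtSummable h ξ (mulCoef h a b) := by
  have h1 := hasSum_transfer (ι := ℕ × ℕ) (q := fun p r => prodCoef h p.1 p.2 r)
    (S := fun r => Finset.range (r + 1) ×ˢ Finset.range (r + 1)) (w := wt h ξ)
    (v := fun p => wt h ξ p.1 * wt h ξ p.2) (f := fun p => a p.1 * b p.2)
    (φ := fun r => factTerm h r z) (ψ := fun p => factTerm h p.1 z * factTerm h p.2 z)
    (fun p r => prodCoef_nonneg hh _ _ _) (fun p r hp => ?_) (fun r => (wt_pos hh hξ r).le)
    (fun p => hasSum_prodCoef_wt hh hξ _ _) ?_ (hz.norm_factTerm_le hh hξ)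
    (fun p => hasSum_prodCoef hz hh hξ _ _)
  · refine ⟨?_, h1.2⟩
    have h2 : factSum h a z * factSum h b z
        = ∑' p : ℕ × ℕ, (factTerm h p.1 z * factTerm h p.2 z) • (a p.1 * b p.2) := by
      rw [factSum, factSum, tsum_mul_tsum_of_summable_norm (ha.summable_norm hz hh hξ)
        (hb.summable_norm hz hh hξ)]
      exact tsum_congr fun p => by rw [smul_mul_smul_comm]
    rw [h2]
    exact h1.1
  · refine prodCoef_eq_zero h _ _ _ ?_
    simp only [Finset.mem_product, Finset.mem_range, not_and_or] at hp
    omega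
  · have hab : Summable fun p : ℕ × ℕ => (wt h ξ p.1 * ‖a p.1‖) * (wt h ξ p.2 * ‖b p.2‖) :=
      Summable.mul_of_nonneg ha hb (fun s => mul_nonneg (wt_pos hh hξ s).le (norm_nonneg _))
        (fun s => mul_nonneg (wt_pos hh hξ s).le (norm_nonneg _))
    refine Summable.of_nonneg_of_le (fun p => ?_) (fun p => ?_) hab
    · exact mul_nonneg (mul_nonneg (wt_pos hh hξ _).le (wt_pos hh hξ _).le) (norm_nonneg _)
    · have := (wt_pos hh hξ p.1).le
      have := (wt_pos hh hξ p.2).le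
      calc _ ≤ wt h ξ p.1 * wt h ξ p.2 * (‖a p.1‖ * ‖b p.2‖) := by
            gcongr
            exact norm_mul_le _ _
        _ = _ := by ring

/-- The coefficients of `(x - h)⁻¹ F(x)`, for a series `F` without constant term. -/
def shiftCoef (h : ℝ) (f : ℕ → 𝔸) (r : ℕ) : 𝔸 :=
  ∑ j ∈ Finset.range r, (divKer h (-1) j r : ℂ) • f j

lemma neg_one_le_natCast (m : ℕ) : (-1 : ℝ) ≤ m := by
  have : (0 : ℝ) ≤ m := m.cast_nonneg
  linarith

lemma hasSum_shiftCoef [CompleteSpace 𝔸] {h ξ : ℝ} (hh : 0 ≤ h) (hξ : h < ξ) {f : ℕ → 𝔸}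
    (hf : WtSummable h ξ f) {z : ℂ} (hz : IsFar h ξ z) :
    HasSum (fun r => factTerm h r z • shiftCoef h f r) ((z - h)⁻¹ • factSum h f z) ∧
      WtSummable h ξ (shiftCoef h f) := by
  have hξ0 : 0 < ξ := hh.trans_lt hξ
  have hpos : 0 < ξ + (-1) * h := by linarith
  have h1 := hasSum_transfer (ι := ℕ) (q := divKer h (-1)) (S := Finset.range) (w := wt h ξ)
    (v := fun m => wt h ξ m * (ξ + (-1) * h)⁻¹) (f := f)
    (φ := fun r => factTerm h r z) (ψ := fun m => factTerm h m z * (z + ((-1 : ℝ) : ℂ) * h)⁻¹)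
    (fun m r => divKer_nonneg hh (neg_one_le_natCast m) r)
    (fun m r hm => divKer_of_le (by simpa using hm))
    (fun r => (wt_pos hh hξ0 r).le)
    (fun m => hasSum_divKer_wt hh hξ0 (neg_one_le_natCast m) hpos)
    ?_ (hz.norm_factTerm_le hh hξ0)
    (fun m => hasSum_divKer hz hh hξ0 (neg_one_le_natCast m) hpos)
  · refine ⟨?_, h1.2⟩
    have h2 : (z - h)⁻¹ • factSum h f z
        = ∑' m, (factTerm h m z * (z + ((-1 : ℝ) : ℂ) * h)⁻¹) • f m := by
      rw [factSum, ← Summable.tsum_const_smul _ (hf.summable_norm hz hh hξ0).of_norm]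
      refine tsum_congr fun m => ?_
      rw [smul_smul, mul_comm]
      congr 3
      push_cast; ring
    rw [h2]
    exact h1.1
  · refine (Summable.mul_left (ξ + (-1) * h)⁻¹ hf).congr fun m => ?_
    ring

/-! ### The recurrence of the gauge coefficients: solution and majorants -/

/-- The right-hand side of the recurrence for the coefficients of the gauge transformation. -/
def gaugeRhs (h : ℝ) (a f : ℕ → 𝔸) (r : ℕ) : 𝔸 :=
  (h : ℂ) • (shiftCoef h (fun j => (j : ℂ) • f j) r * a 0) - lowCoef h a f r

/-- The recurrence for the coefficients of the normalizing gauge transformation. -/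
def IsGaugeCoef (h : ℝ) (a f : ℕ → 𝔸) : Prop :=
  f 0 = 1 ∧ ∀ r : ℕ, 1 ≤ r → (r : ℂ) • f r + a 0 * f r - f r * a 0 = gaugeRhs h a f r

/-- The Sylvester operator `X ↦ r X + [a, X]` is bounded below by `r / K`. -/
def SylvesterBound (K : ℝ) (a : 𝔸) : Prop :=
  ∀ r : ℕ, 1 ≤ r → ∀ X : 𝔸, r * ‖X‖ ≤ K * ‖(r : ℂ) • X + a * X - X * a‖

/-- The defects of the recurrence are the coefficients of the defect of the functional equation.
Both implications between the recurrence and the equation are read off from this expansion. -/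
lemma hasSum_gaugeRhs [CompleteSpace 𝔸] {h ξ : ℝ} (hh : 0 ≤ h) (hξ : h < ξ) {a f : ℕ → 𝔸}
    (ha : WtSummable h ξ a) (hf : WtSummable h ξ f)
    (hf' : WtSummable h ξ fun s => (s : ℂ) • f s) {z : ℂ} (hz : IsFar h ξ z) :
    HasSum (fun r => factTerm h r z •
        (gaugeRhs h a f r - ((r : ℂ) • f r + a 0 * f r - f r * a 0)))
      (((h : ℂ) / (z - h)) • (factSum h (fun s => (s : ℂ) • f s) z * a 0)
        - factSum h (fun s => (s : ℂ) • f s) z - factSum h a z * factSum h f z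
        + factSum h f z * a 0) ∧
    WtSummable h ξ (fun r => gaugeRhs h a f r - ((r : ℂ) • f r + a 0 * f r - f r * a 0)) := by
  have hξ0 : 0 < ξ := hh.trans_lt hξ
  have h1 := hasSum_shiftCoef hh hξ hf' hz
  have h2 := hasSum_mulCoef hh hξ0 ha hf hz
  have h3 := hf.hasSum hz hh hξ0
  have h4 := hf'.hasSum hz hh hξ0
  have e : ∀ r, gaugeRhs h a f r - ((r : ℂ) • f r + a 0 * f r - f r * a 0)
      = (h : ℂ) • (shiftCoef h (fun j => (j : ℂ) • f j) r * a 0) - (r : ℂ) • f r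
        - mulCoef h a f r + f r * a 0 := by
    intro r
    rw [gaugeRhs, mulCoef_eq]
    abel
  constructor
  · have h5 := (((h1.1.mul_right (a 0)).const_smul (h : ℂ)).sub h4).sub h2.1 |>.add
      (h3.mul_right (a 0))
    rw [smul_mul_assoc, smul_smul, ← div_eq_mul_inv] at h5
    have h6 : (fun r => factTerm h r z •
        (gaugeRhs h a f r - ((r : ℂ) • f r + a 0 * f r - f r * a 0))) = fun r =>
        (h : ℂ) • (factTerm h r z • shiftCoef h (fun j => (j : ℂ) • f j) r * a 0)
          - factTerm h r z • (r : ℂ) • f r - factTerm h r z • mulCoef h a f r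
          + factTerm h r z • f r * a 0 := by
      funext r
      rw [e]
      simp only [smul_add, smul_sub, smul_mul_assoc]
      rw [smul_comm]
    rw [h6]
    exact h5
  · have h5 := (((h1.2.mul_right (‖a 0‖ * h)).add hf').add h2.2).add (hf.mul_right ‖a 0‖)
    refine Summable.of_nonneg_of_le
      (fun s => mul_nonneg (wt_pos hh hξ0 s).le (norm_nonneg _)) (fun s => ?_) h5
    beta_reduce
    rw [e]
    have hw := (wt_pos hh hξ0 s).le
    have h6 : ‖(h : ℂ) • (shiftCoef h (fun j => (j : ℂ) • f j) s * a 0) - (s : ℂ) • f s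
        - mulCoef h a f s + f s * a 0‖ ≤ ‖shiftCoef h (fun j => (j : ℂ) • f j) s‖ * (‖a 0‖ * h)
        + ‖(s : ℂ) • f s‖ + ‖mulCoef h a f s‖ + ‖f s‖ * ‖a 0‖ := by
      refine (norm_add_le _ _).trans (add_le_add ((norm_sub_le _ _).trans (add_le_add
        ((norm_sub_le _ _).trans (add_le_add ?_ le_rfl)) le_rfl)) (norm_mul_le _ _))
      rw [norm_smul, Complex.norm_real, Real.norm_of_nonneg hh]
      calc _ ≤ h * (‖shiftCoef h (fun j => (j : ℂ) • f j) s‖ * ‖a 0‖) := by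
            gcongr; exact norm_mul_le _ _
        _ = _ := by ring
    calc _ ≤ wt h ξ s * _ := mul_le_mul_of_nonneg_left h6 hw
      _ = _ := by ring

variable {𝔸 : Type*} [NormedRing 𝔸] [NormedAlgebra ℂ 𝔸]

lemma shiftCoef_congr {h : ℝ} {u v : ℕ → 𝔸} {r : ℕ} (huv : ∀ j < r, u j = v j) :
    shiftCoef h u r = shiftCoef h v r :=
  Finset.sum_congr rfl fun j hj => by rw [huv j (Finset.mem_range.1 hj)]

lemma lowCoef_congr {h : ℝ} {a u v : ℕ → 𝔸} {r : ℕ} (huv : ∀ j < r, u j = v j) :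
    lowCoef h a u r = lowCoef h a v r :=
  Finset.sum_congr rfl fun j hj => by rw [huv j (Finset.mem_range.1 hj)]

lemma gaugeRhs_congr {h : ℝ} {a u v : ℕ → 𝔸} {r : ℕ} (huv : ∀ j < r, u j = v j) :
    gaugeRhs h a u r = gaugeRhs h a v r := by
  rw [gaugeRhs, gaugeRhs, lowCoef_congr huv, shiftCoef_congr (u := fun j => (j : ℂ) • u j)
    (v := fun j => (j : ℂ) • v j) fun j hj => by rw [huv j hj]]

/-- The Sylvester operator `X ↦ r X + [a, X]`. -/
def sylvester (a : 𝔸) (r : ℕ) : 𝔸 →ₗ[ℂ] 𝔸 :=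
  (r : ℂ) • LinearMap.id + LinearMap.mulLeft ℂ a - LinearMap.mulRight ℂ a

lemma sylvester_apply (a : 𝔸) (r : ℕ) (X : 𝔸) :
    sylvester a r X = (r : ℂ) • X + a * X - X * a := by
  simp [sylvester]

lemma SylvesterBound.injective {K : ℝ} {a : 𝔸} (ha : SylvesterBound K a) {r : ℕ} (hr : 1 ≤ r) :
    Function.Injective (sylvester a r) := by
  rw [injective_iff_map_eq_zero]
  intro X hX
  have := ha r hr X
  rw [← sylvester_apply, hX, norm_zero, mul_zero] at this
  have hr' : (0 : ℝ) < r := by exact_mod_cast hr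
  exact norm_le_zero_iff.1 (by nlinarith [norm_nonneg X])

lemma exists_isGaugeCoef [FiniteDimensional ℂ 𝔸] {K h : ℝ} {a : ℕ → 𝔸}
    (hK : SylvesterBound K (a 0)) : ∃ f, IsGaugeCoef h a f := by
  -- In finite dimension injectivity gives a right inverse. At `r = 0` the operator is a mere
  -- commutator, and `id` is a dummy value.
  have hsurj : ∀ r : ℕ, ∃ L : 𝔸 → 𝔸, 1 ≤ r → ∀ X, sylvester (a 0) r (L X) = X := by
    intro r
    by_cases hr : 1 ≤ r
    · have := LinearMap.injective_iff_surjective.1 (hK.injective hr)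
      exact ⟨Function.surjInv this, fun _ X => Function.surjInv_eq this X⟩
    · exact ⟨id, fun h => absurd h hr⟩
  choose L hL using hsurj
  obtain ⟨f, hf⟩ := exists_forall_eq_of_causal
    (fun r u => if r = 0 then (1 : 𝔸) else L r (gaugeRhs h a u r)) (fun r u v huv => by
      simp only [gaugeRhs_congr huv])
  refine ⟨f, by rw [hf 0, if_pos rfl], fun r hr => ?_⟩
  rw [← sylvester_apply, hf r, if_neg (by omega), hL r hr]

lemma IsGaugeCoef.unique {K h : ℝ} {a f g : ℕ → 𝔸} (hK : SylvesterBound K (a 0))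
    (hf : IsGaugeCoef h a f) (hg : IsGaugeCoef h a g) : f = g := by
  funext r
  induction r using Nat.strong_induction_on with
  | _ r ih =>
    rcases Nat.eq_zero_or_pos r with rfl | hr
    · rw [hf.1, hg.1]
    · refine hK.injective hr ?_
      rw [sylvester_apply, sylvester_apply, hf.2 r hr, hg.2 r hr, gaugeRhs_congr ih]

lemma norm_lowCoef_le {h : ℝ} (hh : 0 ≤ h) (a f : ℕ → 𝔸) (r : ℕ) :
    ‖lowCoef h a f r‖ ≤
      ∑ j ∈ Finset.range r, (∑ i ∈ Finset.Icc 1 r, prodCoef h i j r * ‖a i‖) * ‖f j‖ := by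
  refine (norm_sum_le _ _).trans (Finset.sum_le_sum fun j _ => ?_)
  rw [Finset.sum_mul]
  refine (norm_sum_le _ _).trans (Finset.sum_le_sum fun i _ => ?_)
  rw [norm_smul, Complex.norm_real, Real.norm_of_nonneg (prodCoef_nonneg hh _ _ _), mul_assoc]
  exact mul_le_mul_of_nonneg_left (norm_mul_le _ _) (prodCoef_nonneg hh _ _ _)

lemma norm_shiftCoef_le {h : ℝ} (hh : 0 ≤ h) (f : ℕ → 𝔸) (r : ℕ) :
    ‖shiftCoef h f r‖ ≤ ∑ j ∈ Finset.range r, divKer h (-1) j r * ‖f j‖ := by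
  refine (norm_sum_le _ _).trans (Finset.sum_le_sum fun j _ => ?_)
  rw [norm_smul, Complex.norm_real,
    Real.norm_of_nonneg (divKer_nonneg hh (neg_one_le_natCast j) r)]

/-- The column sums of the kernel of `lowCoef`: after exchanging the sums, `prodCoef h i j` has
total weight `wt h ξ i * wt h ξ j`. -/
lemma sum_prodCoef_mul_wt_le {h ξ Θ : ℝ} (hh : 0 ≤ h) (hξ : 0 < ξ) {a : ℕ → 𝔸}
    (hΘ : ∀ N, ∑ i ∈ Finset.Icc 1 N, wt h ξ i * ‖a i‖ ≤ Θ) (j N : ℕ) :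
    ∑ r ∈ Finset.range N, (∑ i ∈ Finset.Icc 1 r, prodCoef h i j r * ‖a i‖) * wt h ξ r
      ≤ Θ * wt h ξ j := by
  have hw := fun r => (wt_pos hh hξ r).le
  calc _ ≤ ∑ r ∈ Finset.range N, ∑ i ∈ Finset.Icc 1 N, prodCoef h i j r * ‖a i‖ * wt h ξ r := by
        refine Finset.sum_le_sum fun r hr => ?_
        rw [Finset.sum_mul]
        refine Finset.sum_le_sum_of_subset_of_nonneg
          (Finset.Icc_subset_Icc_right (Finset.mem_range.1 hr).le) fun i _ _ => ?_
        exact mul_nonneg (mul_nonneg (prodCoef_nonneg hh _ _ _) (norm_nonneg _)) (hw _)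
    _ = ∑ i ∈ Finset.Icc 1 N, ‖a i‖ * ∑ r ∈ Finset.range N, prodCoef h i j r * wt h ξ r := by
        rw [Finset.sum_comm]
        refine Finset.sum_congr rfl fun i _ => ?_
        rw [Finset.mul_sum]
        exact Finset.sum_congr rfl fun r _ => by ring
    _ ≤ ∑ i ∈ Finset.Icc 1 N, ‖a i‖ * (wt h ξ i * wt h ξ j) := by
        refine Finset.sum_le_sum fun i _ => mul_le_mul_of_nonneg_left ?_ (norm_nonneg _)
        exact sum_le_hasSum _ (fun r _ => mul_nonneg (prodCoef_nonneg hh _ _ _) (hw r))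
          (hasSum_prodCoef_wt hh hξ i j)
    _ = (∑ i ∈ Finset.Icc 1 N, wt h ξ i * ‖a i‖) * wt h ξ j := by
        rw [Finset.sum_mul]
        exact Finset.sum_congr rfl fun i _ => by ring
    _ ≤ _ := mul_le_mul_of_nonneg_right (hΘ N) (hw j)

/-- Bound for the coefficients of the gauge transformation, uniform in the step. -/
lemma IsGaugeCoef.sum_le {K h ξ Θ : ℝ} (hh : 0 ≤ h) (hξ : h < ξ) {a f : ℕ → 𝔸} (hK0 : 0 ≤ K)
    (hK : SylvesterBound K (a 0)) (hf : IsGaugeCoef h a f)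
    (hΘ : ∀ N, ∑ i ∈ Finset.Icc 1 N, wt h ξ i * ‖a i‖ ≤ Θ)
    (hsmall : K * (Θ + h * ‖a 0‖ * (ξ - h)⁻¹) ≤ 1 / 2) (N : ℕ) :
    ∑ r ∈ Finset.range N, max (r : ℝ) 1 * ‖f r‖ * wt h ξ r ≤ 2 * ‖(1 : 𝔸)‖ := by
  have hξ0 : 0 < ξ := hh.trans_lt hξ
  -- The Gronwall lemma is applied to `max r 1 * ‖f r‖`. The factor `r` gained from `SylvesterBound`
  -- is needed to absorb the `j` of the terms `j • f j` on the right; the maximum with `1` keeps the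
  -- initial coefficient.
  set q : ℕ → ℕ → ℝ := fun j r => K * ((∑ i ∈ Finset.Icc 1 r, prodCoef h i j r * ‖a i‖)
    + h * ‖a 0‖ * divKer h (-1) j r) with hq
  have hd := fun j r => divKer_nonneg hh (neg_one_le_natCast j) r
  have hs : ∀ j r, 0 ≤ ∑ i ∈ Finset.Icc 1 r, prodCoef h i j r * ‖a i‖ := fun j r =>
    Finset.sum_nonneg fun i _ => mul_nonneg (prodCoef_nonneg hh _ _ _) (norm_nonneg _)
  have hq0 : ∀ j r, 0 ≤ q j r := fun j r => by
    have := hd j r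
    have := hs j r
    positivity
  have h1 := sum_le_of_le_sum_mul (g := fun r => max (r : ℝ) 1 * ‖f r‖) (w := wt h ξ) (q := q)
    (fun r => by positivity) (fun r => (wt_pos hh hξ0 r).le) hq0 ?_ ?_ N
  · simpa [hf.1, wt_zero] using h1
  · intro r hr
    have hr1 : max (r : ℝ) 1 = r := max_eq_left (by exact_mod_cast hr)
    rw [hr1]
    refine (hK r hr (f r)).trans ?_
    rw [hf.2 r hr]
    have h2 : ‖gaugeRhs h a f r‖ ≤ ∑ j ∈ Finset.range r,
        (h * ‖a 0‖ * divKer h (-1) j r * (j * ‖f j‖)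
          + (∑ i ∈ Finset.Icc 1 r, prodCoef h i j r * ‖a i‖) * ‖f j‖) := by
      rw [Finset.sum_add_distrib]
      refine (norm_sub_le _ _).trans (add_le_add ?_ (norm_lowCoef_le hh a f r))
      rw [norm_smul, Complex.norm_real, Real.norm_of_nonneg hh]
      calc _ ≤ h * (‖shiftCoef h (fun j => (j : ℂ) • f j) r‖ * ‖a 0‖) := by
            gcongr; exact norm_mul_le _ _
        _ ≤ h * ((∑ j ∈ Finset.range r, divKer h (-1) j r * ‖(j : ℂ) • f j‖) * ‖a 0‖) := by
            gcongr; exact norm_shiftCoef_le hh _ r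
        _ = _ := by
            rw [Finset.sum_mul, Finset.mul_sum]
            refine Finset.sum_congr rfl fun j _ => ?_
            rw [norm_smul, Complex.norm_natCast]
            ring
    refine (mul_le_mul_of_nonneg_left h2 hK0).trans ?_
    rw [Finset.mul_sum]
    refine Finset.sum_le_sum fun j _ => ?_
    rw [hq]
    beta_reduce
    rw [mul_assoc K]
    refine mul_le_mul_of_nonneg_left ?_ hK0
    rw [add_mul, add_comm]
    have h3 : ‖f j‖ ≤ max (j : ℝ) 1 * ‖f j‖ :=
      le_mul_of_one_le_left (norm_nonneg _) (le_max_right _ _)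
    have h4 : (j : ℝ) * ‖f j‖ ≤ max (j : ℝ) 1 * ‖f j‖ :=
      mul_le_mul_of_nonneg_right (le_max_left _ _) (norm_nonneg _)
    have := hd j r
    have := hs j r
    gcongr
  · intro j N
    have hw := (wt_pos hh hξ0 j).le
    have h2 : ∑ r ∈ Finset.range N, q j r * wt h ξ r
        = K * (∑ r ∈ Finset.range N, (∑ i ∈ Finset.Icc 1 r, prodCoef h i j r * ‖a i‖) * wt h ξ r
          + h * ‖a 0‖ * ∑ r ∈ Finset.range N, divKer h (-1) j r * wt h ξ r) := by
      rw [Finset.mul_sum, ← Finset.sum_add_distrib, Finset.mul_sum]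
      exact Finset.sum_congr rfl fun r _ => by rw [hq]; ring
    rw [h2]
    have h3 := sum_prodCoef_mul_wt_le hh hξ0 hΘ j N
    have h4 : ∑ r ∈ Finset.range N, divKer h (-1) j r * wt h ξ r ≤ wt h ξ j * (ξ - h)⁻¹ := by
      have h5 := hasSum_divKer_wt hh hξ0 (neg_one_le_natCast j)
        (by linarith : 0 < ξ + (-1) * h)
      rw [neg_one_mul, ← sub_eq_add_neg] at h5
      exact sum_le_hasSum _ (fun r _ => mul_nonneg (hd j r) (wt_pos hh hξ0 r).le) h5
    calc _ ≤ K * (Θ * wt h ξ j + h * ‖a 0‖ * (wt h ξ j * (ξ - h)⁻¹)) := by gcongr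
      _ = K * (Θ + h * ‖a 0‖ * (ξ - h)⁻¹) * wt h ξ j := by ring
      _ ≤ _ := mul_le_mul_of_nonneg_right hsmall hw

lemma wtSummable_of_sum_le {h ξ c : ℝ} (hh : 0 ≤ h) (hξ : 0 < ξ) {f : ℕ → 𝔸}
    (hc : ∀ N, ∑ r ∈ Finset.range N, max (r : ℝ) 1 * ‖f r‖ * wt h ξ r ≤ c) :
    WtSummable h ξ f ∧ (WtSummable h ξ fun s => (s : ℂ) • f s) ∧ ∀ r, wt h ξ r * ‖f r‖ ≤ c := by
  have hw := fun r => (wt_pos hh hξ r).le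
  have hs : Summable fun r : ℕ => max (r : ℝ) 1 * ‖f r‖ * wt h ξ r :=
    summable_of_sum_range_le (fun r => mul_nonneg (by positivity) (hw r)) hc
  have h1 : ∀ r : ℕ, wt h ξ r * ‖f r‖ ≤ max (r : ℝ) 1 * ‖f r‖ * wt h ξ r := fun r => by
    rw [mul_comm (wt h ξ r)]
    exact mul_le_mul_of_nonneg_right
      (le_mul_of_one_le_left (norm_nonneg _) (le_max_right _ _)) (hw r)
  refine ⟨Summable.of_nonneg_of_le (fun s => mul_nonneg (hw s) (norm_nonneg _)) h1 hs,
    Summable.of_nonneg_of_le (fun s => mul_nonneg (hw s) (norm_nonneg _)) (fun r => ?_) hs,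
    fun r => ?_⟩
  · rw [norm_smul, Complex.norm_natCast, mul_comm (wt h ξ r)]
    exact mul_le_mul_of_nonneg_right
      (mul_le_mul_of_nonneg_right (le_max_left _ _) (norm_nonneg _)) (hw r)
  · refine (h1 r).trans (le_trans ?_ (hc (r + 1)))
    exact Finset.single_le_sum (f := fun r : ℕ => max (r : ℝ) 1 * ‖f r‖ * wt h ξ r)
      (fun i _ => mul_nonneg (by positivity) (hw i)) (Finset.self_mem_range_succ r)

/-- A series of factorials with constant term `1` is invertible. -/
lemma exists_factSum_inverse [CompleteSpace 𝔸] {h ξ : ℝ} (hh : 0 ≤ h) (hξ : 0 < ξ) {f : ℕ → 𝔸}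
    (hf0 : f 0 = 1) (hf : WtSummable h ξ f) :
    ∃ (g : ℕ → 𝔸) (ξ' : ℝ), ξ ≤ ξ' ∧ WtSummable h ξ' g ∧
      ∀ z, IsFar h ξ' z → factSum h f z * factSum h g z = 1 := by
  set c := ∑' s, wt h ξ s * ‖f s‖ with hc
  have hc0 : 0 ≤ c := tsum_nonneg fun s => mul_nonneg (wt_pos hh hξ s).le (norm_nonneg _)
  -- Moving from `ξ` to `ξ'` multiplies the non-constant part, of weight at most `c`, by `1 / (1 + 2
  -- c)`, hence makes it at most `1 / 2`.
  set ξ' := ξ * (1 + 2 * c) with hξ'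
  have hle : ξ ≤ ξ' := by rw [hξ']; nlinarith
  have hpos : 0 < ξ' := hξ.trans_le hle
  have hw := fun r => (wt_pos hh hpos r).le
  -- As `f 0 = 1`, the product with `g` has coefficient `g r + lowCoef h f g r`, which this choice
  -- cancels for `r ≥ 1`.
  obtain ⟨g, hg⟩ := exists_forall_eq_of_causal
    (fun r u => if r = 0 then (1 : 𝔸) else - lowCoef h f u r) (fun r u v huv => by
      simp only [lowCoef_congr huv])
  have hΘ : ∀ N, ∑ i ∈ Finset.Icc 1 N, wt h ξ' i * ‖f i‖ ≤ 1 / 2 := by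
    intro N
    calc _ ≤ ∑ i ∈ Finset.Icc 1 N, ξ / ξ' * (wt h ξ i * ‖f i‖) := by
          refine Finset.sum_le_sum fun i hi => ?_
          rw [← mul_assoc]
          exact mul_le_mul_of_nonneg_right
            (wt_le_mul_wt hh hξ hle (Finset.mem_Icc.1 hi).1) (norm_nonneg _)
      _ ≤ ξ / ξ' * c := by
          rw [← Finset.mul_sum]
          refine mul_le_mul_of_nonneg_left ?_ (by positivity)
          exact hf.sum_le_tsum _ fun i _ => mul_nonneg (wt_pos hh hξ i).le (norm_nonneg _)
      _ ≤ 1 / 2 := by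
          rw [div_mul_eq_mul_div, div_le_div_iff₀ hpos two_pos, hξ']
          nlinarith
  have h1 := sum_le_of_le_sum_mul (g := fun r => ‖g r‖) (w := wt h ξ')
    (q := fun j r => ∑ i ∈ Finset.Icc 1 r, prodCoef h i j r * ‖f i‖)
    (fun r => norm_nonneg _) hw
    (fun j r => Finset.sum_nonneg fun i _ => mul_nonneg (prodCoef_nonneg hh _ _ _)
      (norm_nonneg _))
    (fun r hr => by
      rw [hg r, if_neg (by omega), norm_neg]
      exact norm_lowCoef_le hh f g r)
    (fun j N => sum_prodCoef_mul_wt_le hh hpos hΘ j N)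
  have hgs : WtSummable h ξ' g :=
    summable_of_sum_range_le (fun r => mul_nonneg (hw r) (norm_nonneg _)) fun N => by
      simpa only [mul_comm] using h1 N
  refine ⟨g, ξ', hle, hgs, fun z hz => ?_⟩
  have h2 := (hasSum_mulCoef hh hpos (hf.mono hh hξ hle) hgs hz).1
  have h3 : ∀ r, mulCoef h f g r = if r = 0 then 1 else 0 := by
    intro r
    rw [mulCoef_eq, hf0, one_mul, hg r]
    by_cases hr : r = 0
    · subst hr; simp [lowCoef]
    · simp [hr]
  have h4 := hasSum_single (f := fun r => factTerm h r z • mulCoef h f g r) 0 fun r hr => by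
    rw [h3, if_neg hr, smul_zero]
  rw [h2.unique h4, h3, factTerm_zero]
  simp

/-! ### Shifts and derivatives of series of factorials, and the gauge equation -/

/-- The analogue of `x (x^{-s})' = -s x^{-s}`: the operator `δ_{-h}` is diagonal on the factorials.
It rests on `(z - h)^{-[s+1]_h} = (z - h)⁻¹ z^{-[s]_h}`. -/
lemma factTerm_sub_factTerm {h : ℝ} {z : ℂ} (hz : ∀ k : ℕ, z - h + k * h ≠ 0) (s : ℕ) :
    factTerm h s z - factTerm h s (z - h) = -((h : ℂ) / (z - h)) * (s * factTerm h s z) := by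
  have h1 : factTerm h (s + 1) (z - h) = (z - h)⁻¹ * factTerm h s z := by
    rw [factTerm, Finset.prod_range_succ', mul_inv, mul_comm, factTerm]
    congr 2
    · simp
    · refine Finset.prod_congr rfl fun k _ => ?_
      push_cast; ring
  rw [factTerm_succ] at h1
  have h2 : factTerm h s (z - h) = (z - h + s * h) * ((z - h)⁻¹ * factTerm h s z) := by
    rw [← h1, mul_comm, mul_assoc, inv_mul_cancel₀ (hz s), mul_one]
  have h3 : z - h ≠ 0 := by simpa using hz 0
  rw [h2]
  field_simp
  ring

lemma factSum_sub_factSum [CompleteSpace 𝔸] {h ξ : ℝ} (hh : 0 ≤ h) (hξ : 0 < ξ) {f : ℕ → 𝔸}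
    (hf : WtSummable h ξ f) {z : ℂ} (hz : IsFar h ξ z) (hz' : IsFar h ξ (z - h)) :
    factSum h f (z - h)
      = factSum h f z + ((h : ℂ) / (z - h)) • factSum h (fun s => (s : ℂ) • f s) z := by
  have h1 := (hf.hasSum hz hh hξ).sub (hf.hasSum hz' hh hξ)
  simp only [← sub_smul, factTerm_sub_factTerm (hz'.ne_zero hh hξ)] at h1
  -- This is the case of step `0`, where the statement is trivial; otherwise the factor can be
  -- divided out.
  by_cases hc : (h : ℂ) / (z - h) = 0
  · have h2 : (fun s : ℕ => (-((h : ℂ) / (z - h)) * (s * factTerm h s z)) • f s) = fun _ => 0 := by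
      funext s; simp [hc]
    rw [h2] at h1
    rw [hc, zero_smul, add_zero]
    exact (sub_eq_zero.1 (h1.unique hasSum_zero)).symm
  · have h2 := h1.const_smul (-((h : ℂ) / (z - h))⁻¹)
    have h3 : (fun s : ℕ => (-((h : ℂ) / (z - h))⁻¹) •
        (-((h : ℂ) / (z - h)) * (s * factTerm h s z)) • f s) =
        fun s => factTerm h s z • (s : ℂ) • f s := by
      funext s
      rw [smul_smul, smul_smul]
      congr 1
      rw [← mul_assoc, neg_mul_neg, inv_mul_cancel₀ hc]
      ring
    rw [h3] at h2
    rw [factSum, factSum, factSum, h2.tsum_eq]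
    rw [smul_smul, mul_neg, mul_inv_cancel₀ hc]
    simp only [factSum]
    module

lemma hasDerivAt_factSum_zero [CompleteSpace 𝔸] {ξ : ℝ} (hξ : 0 < ξ) {f : ℕ → 𝔸}
    (hf : WtSummable 0 ξ f) {z : ℂ} (hz : ξ < ‖z‖) :
    HasDerivAt (factSum 0 f) (-(z⁻¹ • factSum 0 (fun s => (s : ℂ) • f s) z)) z := by
  have hU : IsOpen {z : ℂ | ξ < ‖z‖} := isOpen_lt continuous_const continuous_norm
  have hd : ∀ s : ℕ, ∀ z : ℂ, ξ < ‖z‖ →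
      HasDerivAt (fun z => factTerm 0 s z • f s) (-(z⁻¹ • factTerm 0 s z • (s : ℂ) • f s)) z := by
    intro s z hz
    have hz0 : z ≠ 0 := norm_pos_iff.1 (hξ.trans hz)
    simp only [factTerm_step_zero]
    have h1 := ((hasDerivAt_pow s z).inv (pow_ne_zero s hz0)).smul_const (f s)
    have h2 : -(z⁻¹ • (z ^ s)⁻¹ • (s : ℂ) • f s) = (-(↑s * z ^ (s - 1)) / (z ^ s) ^ 2) • f s := by
      rw [smul_smul, smul_smul, ← neg_smul]
      congr 1
      rcases s with _ | s
      · simp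
      · simp only [Nat.add_sub_cancel]
        field_simp
        ring
    rw [h2]
    exact h1
  have hdiff : ∀ s, DifferentiableOn ℂ (fun z => factTerm 0 s z • f s) {z : ℂ | ξ < ‖z‖} :=
    fun s z hz => (hd s z hz).differentiableAt.differentiableWithinAt
  have hb : ∀ s, ∀ z ∈ {z : ℂ | ξ < ‖z‖}, ‖factTerm 0 s z • f s‖ ≤ wt 0 ξ s * ‖f s‖ := by
    intro s z hz
    rw [norm_smul]
    exact mul_le_mul_of_nonneg_right
      ((IsFar.of_norm (le_of_lt hz)).norm_factTerm_le le_rfl hξ s) (norm_nonneg _)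
  have h1 := Complex.hasSum_deriv_of_summable_norm hf hdiff hU hb hz
  have h2 : (fun s => deriv (fun z => factTerm 0 s z • f s) z)
      = fun s => -z⁻¹ • factTerm 0 s z • (s : ℂ) • f s := by
    funext s
    rw [(hd s z hz).deriv, neg_smul]
  rw [h2] at h1
  have hz0 : z ≠ 0 := norm_pos_iff.1 (hξ.trans hz)
  have h3 : deriv (factSum 0 f) z = -(z⁻¹ • factSum 0 (fun s => (s : ℂ) • f s) z) := by
    have h4 := h1.const_smul (-z)
    have h7 : (fun s : ℕ => -z • -z⁻¹ • factTerm 0 s z • (s : ℂ) • f s) =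
        fun s => factTerm 0 s z • (s : ℂ) • f s := by
      funext s
      rw [smul_smul (-z), neg_mul_neg, mul_inv_cancel₀ hz0, one_smul]
    rw [h7] at h4
    have h5 : factSum 0 (fun s => (s : ℂ) • f s) z = -z • deriv (factSum 0 f) z := by
      rw [factSum, h4.tsum_eq]; rfl
    rw [h5, smul_smul, mul_neg, inv_mul_cancel₀ hz0, neg_smul, neg_neg, one_smul]
  rw [← h3]
  have h6 := Complex.differentiableOn_tsum_of_summable_norm hf hdiff hU hb
  exact (h6.differentiableAt (hU.mem_nhds hz)).hasDerivAt

lemma differentiableOn_factSum [CompleteSpace 𝔸] {h ξ : ℝ} (hh : 0 ≤ h) (hξ : 0 < ξ) {f : ℕ → 𝔸}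
    (hf : WtSummable h ξ f) : DifferentiableOn ℂ (factSum h f) {z : ℂ | ξ < z.re} := by
  refine Complex.differentiableOn_tsum_of_summable_norm hf (fun s z hz => ?_)
    (isOpen_lt continuous_const Complex.continuous_re) fun s z hz => ?_
  · have hfar : IsFar h ξ z := IsFar.of_re (le_of_lt hz)
    refine (DifferentiableAt.smul_const ?_ _).differentiableWithinAt
    unfold factTerm
    refine DifferentiableAt.inv (by fun_prop) ?_
    exact Finset.prod_ne_zero_iff.2 fun k _ => hfar.ne_zero hh hξ k
  · rw [norm_smul]
    exact mul_le_mul_of_nonneg_right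
      ((IsFar.of_re (le_of_lt hz)).norm_factTerm_le hh hξ s) (norm_nonneg _)

/-- The equation of the gauge transformation in terms of the series. -/
lemma IsGaugeCoef.factSum_eq [CompleteSpace 𝔸] {h ξ : ℝ} (hh : 0 ≤ h) (hξ : h < ξ) {a f : ℕ → 𝔸}
    (hg : IsGaugeCoef h a f) (ha : WtSummable h ξ a) (hf : WtSummable h ξ f)
    (hf' : WtSummable h ξ fun s => (s : ℂ) • f s) {z : ℂ} (hz : IsFar h ξ z) :
    ((h : ℂ) / (z - h)) • (factSum h (fun s => (s : ℂ) • f s) z * a 0)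
        - factSum h (fun s => (s : ℂ) • f s) z - factSum h a z * factSum h f z
        + factSum h f z * a 0 = 0 := by
  refine (hasSum_gaugeRhs hh hξ ha hf hf' hz).1.unique ?_
  have : (fun r => factTerm h r z •
      (gaugeRhs h a f r - ((r : ℂ) • f r + a 0 * f r - f r * a 0))) = fun _ => 0 := by
    funext r
    rcases Nat.eq_zero_or_pos r with rfl | hr
    -- The index `0` imposes nothing: `f 0 = 1` commutes with `a 0`.
    · simp [gaugeRhs, shiftCoef, lowCoef, hg.1]
    · rw [hg.2 r hr, sub_self, smul_zero]
  rw [this]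
  exact hasSum_zero

/-- The defect has a summable expansion with sum zero, so its coefficients vanish by
`WtSummable.eq_zero`; real points near `+∞` suffice for that. -/
lemma isGaugeCoef_of_factSum_eq [CompleteSpace 𝔸] {h ξ X : ℝ} (hh : 0 ≤ h) (hξ : h < ξ)
    {a f : ℕ → 𝔸} (hf0 : f 0 = 1) (ha : WtSummable h ξ a) (hf : WtSummable h ξ f)
    (hf' : WtSummable h ξ fun s => (s : ℂ) • f s)
    (heq : ∀ x : ℝ, X < x → ((h : ℂ) / (x - h)) • (factSum h (fun s => (s : ℂ) • f s) x * a 0)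
        - factSum h (fun s => (s : ℂ) • f s) x - factSum h a x * factSum h f x
        + factSum h f x * a 0 = 0) : IsGaugeCoef h a f := by
  have hξ0 : 0 < ξ := hh.trans_lt hξ
  have h1 : WtSummable h ξ fun r => gaugeRhs h a f r - ((r : ℂ) • f r + a 0 * f r - f r * a 0) :=
    (hasSum_gaugeRhs hh hξ ha hf hf' (z := ξ) (IsFar.of_re (by simp))).2
  refine ⟨hf0, fun r _ => ?_⟩
  refine (sub_eq_zero.1 (h1.eq_zero (X := max X ξ) hh hξ0 (fun x hx => ?_) r)).symm
  have hfar : IsFar h ξ (x : ℂ) :=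
    IsFar.of_re (by simpa using ((le_max_right _ _).trans_lt hx).le)
  have h2 := (hasSum_gaugeRhs hh hξ ha hf hf' hfar).1
  rw [heq x ((le_max_left _ _).trans_lt hx)] at h2
  exact h2.tsum_eq

/-! ### Limits of coefficients and sums as the step tends to `0` -/

section limits

variable {𝔸 : Type*} [NormedRing 𝔸] [NormedAlgebra ℂ 𝔸]

lemma tendsto_ofReal_nhdsGT_zero : Tendsto (fun h : ℝ => (h : ℂ)) (𝓝[>] 0) (𝓝 0) :=
  (Complex.continuous_ofReal.tendsto' 0 0 (by simp)).mono_left nhdsWithin_le_nhds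

lemma tendsto_gaugeRhs {a f : ℝ → ℕ → 𝔸} {ℓ f₀ : ℕ → 𝔸} {r : ℕ}
    (ha : ∀ s, Tendsto (fun h => a h s) (𝓝[>] 0) (𝓝 (ℓ s)))
    (hf : ∀ s < r, Tendsto (fun h => f h s) (𝓝[>] 0) (𝓝 (f₀ s))) :
    Tendsto (fun h => gaugeRhs h (a h) (f h) r) (𝓝[>] 0) (𝓝 (gaugeRhs 0 ℓ f₀ r)) := by
  have hc : ∀ {g : ℝ → ℝ}, Continuous g →
      Tendsto (fun h => (g h : ℂ)) (𝓝[>] 0) (𝓝 (g 0 : ℂ)) := fun {g} hg =>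
    ((Complex.continuous_ofReal.comp hg).tendsto 0).mono_left nhdsWithin_le_nhds
  refine ((hc continuous_id).smul ((tendsto_finsetSum _ fun j hj => ?_).mul (ha 0))).sub
    (tendsto_finsetSum _ fun j hj => tendsto_finsetSum _ fun i _ => ?_)
  · exact (hc (continuous_divKer _ _ _)).smul
      ((hf j (Finset.mem_range.1 hj)).const_smul (j : ℂ))
  · exact (hc (continuous_prodCoef _ _ _)).smul ((ha i).mul (hf j (Finset.mem_range.1 hj)))

/-- The coefficients of the gauge transformation converge when the step tends to `0`. -/
lemma tendsto_gaugeCoef {K : ℝ} {a f : ℝ → ℕ → 𝔸} {ℓ f₀ : ℕ → 𝔸}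
    (ha : ∀ s, Tendsto (fun h => a h s) (𝓝[>] 0) (𝓝 (ℓ s)))
    (hK : ∀ᶠ h in 𝓝[>] (0 : ℝ), SylvesterBound K (a h 0))
    (hf : ∀ᶠ h in 𝓝[>] (0 : ℝ), IsGaugeCoef h (a h) (f h)) (hf₀ : IsGaugeCoef 0 ℓ f₀) (r : ℕ) :
    Tendsto (fun h => f h r) (𝓝[>] 0) (𝓝 (f₀ r)) := by
  induction r using Nat.strong_induction_on with
  | _ r ih =>
    rcases Nat.eq_zero_or_pos r with rfl | hr
    · rw [hf₀.1]
      exact tendsto_const_nhds.congr' (hf.mono fun h hh => hh.1.symm)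
    have h1 := tendsto_gaugeRhs ha ih
    -- The limit coefficient `f₀ r` is inserted in the recurrence of step `h`: the defect tends to
    -- `0`, and the Sylvester bound, uniform in `h`, converts this into convergence of `f h r - f₀
    -- r`.
    have h2 : Tendsto (fun h => gaugeRhs h (a h) (f h) r
        - ((r : ℂ) • f₀ r + a h 0 * f₀ r - f₀ r * a h 0)) (𝓝[>] 0) (𝓝 0) := by
      have h3 := h1.sub (((tendsto_const_nhds (x := (r : ℂ) • f₀ r)).add
        ((ha 0).mul_const (f₀ r))).sub ((ha 0).const_mul (f₀ r)))
      rwa [← hf₀.2 r hr, sub_self] at h3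
    rw [tendsto_iff_norm_sub_tendsto_zero]
    have h4 := (h2.norm.const_mul K)
    rw [norm_zero, mul_zero] at h4
    refine squeeze_zero' (Eventually.of_forall fun h => norm_nonneg _) ?_ h4
    filter_upwards [hK, hf] with h hKh hfh
    have h5 := hKh r hr (f h r - f₀ r)
    have h6 : (r : ℂ) • (f h r - f₀ r) + a h 0 * (f h r - f₀ r) - (f h r - f₀ r) * a h 0
        = gaugeRhs h (a h) (f h) r - ((r : ℂ) • f₀ r + a h 0 * f₀ r - f₀ r * a h 0) := by
      rw [← hfh.2 r hr, smul_sub, mul_sub, sub_mul]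
      abel
    rw [h6] at h5
    refine le_trans ?_ h5
    exact le_mul_of_one_le_left (norm_nonneg _) (by exact_mod_cast hr)

/-- A gain of order `r⁻²`, uniform in `h ≤ 1`, which turns bounded weighted coefficients into a
summable majorant. The case `h = 1` is an equality, by telescoping. -/
lemma wt_add_two_le {h ξ : ℝ} (hh : 0 ≤ h) (h1 : h ≤ 1) (hξ : 0 < ξ) (r : ℕ) :
    wt h (ξ + 2) r ≤ ξ * (ξ + 1) / ((ξ + r) * (ξ + r + 1)) * wt h ξ r := by
  induction r with
  | zero => simp [wt_zero]; field_simp; rfl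
  | succ r ih =>
    have hw := (wt_pos hh hξ r).le
    rw [wt_succ, wt_succ]
    have h2 : (ξ + r * h) * (ξ + 2 + r * h)⁻¹ ≤ (ξ + r) * (ξ + r + 2)⁻¹ := by
      rw [← div_eq_mul_inv, ← div_eq_mul_inv, div_le_div_iff₀ (by positivity) (by positivity)]
      have : (r : ℝ) * h ≤ r := mul_le_of_le_one_right r.cast_nonneg h1
      nlinarith
    calc wt h (ξ + 2) r * (ξ + 2 + r * h)⁻¹
        ≤ ξ * (ξ + 1) / ((ξ + r) * (ξ + r + 1)) * wt h ξ r * (ξ + 2 + r * h)⁻¹ := by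
          gcongr
      _ = ξ * (ξ + 1) / ((ξ + r) * (ξ + r + 1)) * (wt h ξ r * (ξ + r * h)⁻¹) *
            ((ξ + r * h) * (ξ + 2 + r * h)⁻¹) := by
          have : 0 < ξ + r * h := by positivity
          field_simp
      _ ≤ ξ * (ξ + 1) / ((ξ + r) * (ξ + r + 1)) * (wt h ξ r * (ξ + r * h)⁻¹) *
            ((ξ + r) * (ξ + r + 2)⁻¹) := by gcongr
      _ = _ := by
          push_cast
          have : 0 < ξ + r * h := by positivity
          field_simp
          ring

lemma tendsto_factTerm {z : ℝ → ℂ} {z₀ : ℂ} (hz : Tendsto z (𝓝[>] 0) (𝓝 z₀)) (hz₀ : z₀ ≠ 0)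
    (s : ℕ) : Tendsto (fun h => factTerm h s (z h)) (𝓝[>] 0) (𝓝 (factTerm 0 s z₀)) := by
  unfold factTerm
  refine Tendsto.inv₀ (tendsto_finsetProd _ fun k _ => hz.add (tendsto_const_nhds.mul ?_)) ?_
  · simpa using tendsto_ofReal_nhdsGT_zero
  · exact Finset.prod_ne_zero_iff.2 fun k _ => by simpa using hz₀

/-- Convergence of the sums of the series when the step tends to `0`. -/
lemma tendsto_factSum [CompleteSpace 𝔸] {ξ c : ℝ} (hξ : 1 ≤ ξ) {f : ℝ → ℕ → 𝔸} {f₀ : ℕ → 𝔸}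
    (hf : ∀ s, Tendsto (fun h => f h s) (𝓝[>] 0) (𝓝 (f₀ s)))
    (hc : ∀ᶠ h in 𝓝[>] (0 : ℝ), ∀ r, wt h ξ r * ‖f h r‖ ≤ c) {z : ℝ → ℂ} {z₀ : ℂ}
    (hz : Tendsto z (𝓝[>] 0) (𝓝 z₀)) (hz₀ : ξ + 2 < z₀.re) :
    Tendsto (fun h => factSum h (f h) (z h)) (𝓝[>] 0) (𝓝 (factSum 0 f₀ z₀)) := by
  have hz₀' : z₀ ≠ 0 := by
    rintro rfl
    simp at hz₀
    linarith
  have hsum : Summable fun r : ℕ => ξ * (ξ + 1) / ((ξ + r) * (ξ + r + 1)) * c := by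
    refine Summable.mul_right c ?_
    have h1 : Summable fun r : ℕ => ξ * (ξ + 1) * (1 / ((r + 1 : ℕ) : ℝ) ^ 2) :=
      ((summable_nat_add_iff 1).2 (Real.summable_one_div_nat_pow.2 one_lt_two)).mul_left _
    refine Summable.of_nonneg_of_le (fun r => by positivity) (fun r => ?_) h1
    rw [div_eq_mul_one_div]
    refine mul_le_mul_of_nonneg_left (one_div_le_one_div_of_le (by positivity) ?_) (by positivity)
    have : (0 : ℝ) ≤ r := r.cast_nonneg
    push_cast
    nlinarith
  refine tendsto_tsum_of_dominated_convergence hsum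
    (fun s => (tendsto_factTerm hz hz₀' s).smul (hf s)) ?_
  have hre : ∀ᶠ h in 𝓝[>] (0 : ℝ), ξ + 2 < (z h).re :=
    ((Complex.continuous_re.tendsto z₀).comp hz).eventually (lt_mem_nhds hz₀)
  filter_upwards [hc, hre, Ioo_mem_nhdsGT one_pos] with h hch hzh hh r
  have h0 : 0 < ξ := by linarith
  rw [norm_smul]
  calc ‖factTerm h r (z h)‖ * ‖f h r‖ ≤ wt h (ξ + 2) r * ‖f h r‖ :=
        mul_le_mul_of_nonneg_right
          ((IsFar.of_re hzh.le).norm_factTerm_le hh.1.le (by linarith) r) (norm_nonneg _)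
    _ ≤ ξ * (ξ + 1) / ((ξ + r) * (ξ + r + 1)) * wt h ξ r * ‖f h r‖ :=
        mul_le_mul_of_nonneg_right (wt_add_two_le hh.1.le hh.2.le h0 r) (norm_nonneg _)
    _ = ξ * (ξ + 1) / ((ξ + r) * (ξ + r + 1)) * (wt h ξ r * ‖f h r‖) := by ring
    _ ≤ _ := mul_le_mul_of_nonneg_left (hch r) (by positivity)

/-- Uniform invertibility of the Sylvester operators near a point where they are injective. -/
lemma exists_sylvesterBound [FiniteDimensional ℂ 𝔸] {ℓ : 𝔸}
    (hinj : ∀ r : ℕ, 1 ≤ r → Function.Injective (sylvester ℓ r)) :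
    ∃ K > 0, ∃ ε > 0, ∀ a : 𝔸, ‖a - ℓ‖ < ε → SylvesterBound K a := by
  have h1 : ∀ r : ℕ, ∃ c : ℝ, 0 ≤ c ∧ (1 ≤ r → ∀ X, ‖X‖ ≤ c * ‖sylvester ℓ r X‖) := by
    intro r
    by_cases hr : 1 ≤ r
    · obtain ⟨c, -, hc⟩ := LinearMap.exists_antilipschitzWith (sylvester ℓ r)
        (LinearMap.ker_eq_bot.2 (hinj r hr))
      exact ⟨c, c.2, fun _ X => hc.le_mul_norm (map_zero _) X⟩
    · exact ⟨0, le_rfl, fun h => absurd h hr⟩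
  choose c hc0 hc using h1
  set B := ‖ℓ‖ + 1 with hB
  have hB0 : 0 < B := by positivity
  -- For `r ≥ R` the multiple `r X` dominates the commutator, since `2 ‖a‖ ≤ r / 2`. The finitely
  -- many `r < R` are perturbations of invertible operators with inverses bounded by `κ`; the radius
  -- `1 / (4 κ)` costs a factor `2`.
  obtain ⟨R, hR⟩ := exists_nat_gt (4 * B)
  set κ := ∑ r ∈ Finset.range R, c r + 1 with hκ
  have hκ0 : 0 < κ := by
    have := Finset.sum_nonneg fun r (_ : r ∈ Finset.range R) => hc0 r
    linarith
  have hε : 0 < min 1 (1 / (4 * κ)) := lt_min one_pos (by positivity)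
  refine ⟨2 + 2 * R * κ, by positivity, min 1 (1 / (4 * κ)), hε, fun a ha r hr X => ?_⟩
  have ha1 : ‖a - ℓ‖ < 1 := ha.trans_le (min_le_left _ _)
  have ha2 : ‖a - ℓ‖ ≤ 1 / (4 * κ) := (ha.trans_le (min_le_right _ _)).le
  have hX := norm_nonneg X
  have hr0 : (0 : ℝ) ≤ r := r.cast_nonneg
  rcases lt_or_ge r R with hrR | hrR
  · have h2 : ‖X‖ ≤ κ * ‖sylvester ℓ r X‖ := by
      refine (hc r hr X).trans (mul_le_mul_of_nonneg_right ?_ (norm_nonneg _))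
      have := Finset.single_le_sum (f := c) (fun i _ => hc0 i) (Finset.mem_range.2 hrR)
      linarith
    have h3 : ‖sylvester ℓ r X‖ ≤ ‖(r : ℂ) • X + a * X - X * a‖ + 2 * ‖a - ℓ‖ * ‖X‖ := by
      have e : sylvester ℓ r X = ((r : ℂ) • X + a * X - X * a)
          - ((a - ℓ) * X - X * (a - ℓ)) := by
        rw [sylvester_apply, sub_mul, mul_sub]; abel
      rw [e]
      refine (norm_sub_le _ _).trans (add_le_add le_rfl ((norm_sub_le _ _).trans ?_))
      have := norm_mul_le (a - ℓ) X
      have := norm_mul_le X (a - ℓ)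
      linarith
    have h4 : κ * (2 * ‖a - ℓ‖ * ‖X‖) ≤ 1 / 2 * ‖X‖ := by
      calc _ ≤ κ * (2 * (1 / (4 * κ)) * ‖X‖) := by gcongr
        _ = _ := by field_simp; ring
    have h5 : ‖X‖ ≤ 2 * κ * ‖(r : ℂ) • X + a * X - X * a‖ := by
      have := mul_le_mul_of_nonneg_left h3 hκ0.le
      linarith
    have hrR' : (r : ℝ) ≤ R := by exact_mod_cast hrR.le
    calc r * ‖X‖ ≤ R * (2 * κ * ‖(r : ℂ) • X + a * X - X * a‖) := by gcongr
      _ ≤ _ := by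
        have := norm_nonneg ((r : ℂ) • X + a * X - X * a)
        nlinarith
  · have hrR' : (R : ℝ) ≤ r := by exact_mod_cast hrR
    have haB : ‖a‖ ≤ B := by
      have := norm_le_norm_add_norm_sub' a ℓ
      linarith
    have h2 : r * ‖X‖ ≤ ‖(r : ℂ) • X + a * X - X * a‖ + 2 * ‖a‖ * ‖X‖ := by
      have e : (r : ℂ) • X = ((r : ℂ) • X + a * X - X * a) - (a * X - X * a) := by abel
      have h3 : r * ‖X‖ = ‖(r : ℂ) • X‖ := by rw [norm_smul, Complex.norm_natCast]
      rw [h3]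
      conv_lhs => rw [e]
      refine (norm_sub_le _ _).trans (add_le_add le_rfl ((norm_sub_le _ _).trans ?_))
      have := norm_mul_le a X
      have := norm_mul_le X a
      linarith
    have h4 : 2 * ‖a‖ * ‖X‖ ≤ r / 2 * ‖X‖ := by
      refine mul_le_mul_of_nonneg_right ?_ hX
      linarith
    have h5 : r * ‖X‖ ≤ 2 * ‖(r : ℂ) • X + a * X - X * a‖ := by linarith
    refine h5.trans (mul_le_mul_of_nonneg_right ?_ (norm_nonneg _))
    have : 0 ≤ 2 * (R : ℝ) * κ := by positivity
    linarith

end limits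

/-! ### Non-resonance and invertibility of the Sylvester operators -/

section matrices

attribute [local instance] Matrix.linftyOpNormedRing Matrix.linftyOpNormedAlgebra

/-- An element `X` of the kernel satisfies `a X = X (a - r)`, hence `p(a) X = X p(a - r)` for every
polynomial `p`. For the characteristic polynomial of `a` the left side vanishes by Cayley–Hamilton,
while `p(a - r)` is invertible because the spectra of `a` and `a - r` are disjoint. -/
lemma NonResonant.sylvester_injective {n : ℕ} {a : Mat n} (ha : NonResonant a) {r : ℕ}
    (hr : 1 ≤ r) : Function.Injective (sylvester a r) := by
  rw [injective_iff_map_eq_zero]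
  intro X hX
  rw [sylvester_apply] at hX
  rcases Nat.eq_zero_or_pos n with rfl | hn
  · exact Subsingleton.elim _ _
  have : Nonempty (Fin n) := ⟨⟨0, hn⟩⟩
  set b : Mat n := a - algebraMap ℂ (Mat n) r with hb
  have h1 : SemiconjBy X b a := by
    rw [SemiconjBy, hb, mul_sub, ← Algebra.commutes, ← Algebra.smul_def, ← sub_eq_zero]
    rw [← neg_eq_zero, ← hX]
    abel
  have h2 : ∀ p : Polynomial ℂ, SemiconjBy X (Polynomial.aeval b p) (Polynomial.aeval a p) := by
    intro p
    induction p using Polynomial.induction_on with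
    | C c => simp only [Polynomial.aeval_C]; exact (Algebra.commutes c X).symm
    | add p q hp hq => simp only [map_add]; exact hp.add_right hq
    | monomial k c ih =>
      simp only [map_mul, map_pow, Polynomial.aeval_C, Polynomial.aeval_X]
      exact SemiconjBy.mul_right (Algebra.commutes c X).symm (h1.pow_right _)
  have h3 := h2 a.charpoly
  rw [Matrix.aeval_self_charpoly, SemiconjBy, zero_mul] at h3
  have h4 : IsUnit (Polynomial.aeval b a.charpoly) := by
    rw [← spectrum.zero_notMem_iff ℂ]
    intro h0
    rw [spectrum.map_polynomial_aeval_of_nonempty b _ (spectrum.nonempty_of_isAlgClosed_of_finiteDimensional ℂ b)] at h0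
    obtain ⟨μ, hμ, hμ0⟩ := h0
    have h5 : μ ∈ spectrum ℂ a := Matrix.mem_spectrum_iff_isRoot_charpoly.2 hμ0
    have h6 : μ + r ∈ spectrum ℂ a := by
      have := spectrum.add_mem_add_iff (r := μ) (s := (r : ℂ)) (a := b)
      rw [hb, add_sub_cancel] at this
      exact this.2 hμ
    have h7 := ha _ h6 _ h5 r (by push_cast; ring)
    omega
  exact h4.mul_left_eq_zero.1 h3

/-- A right eigenvector `v` for `ν` and a left eigenvector `w` for `μ = ν + k` would give the
nonzero kernel element `v wᵀ`. This transmits non-resonance from the limit to small steps. -/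
lemma SylvesterBound.nonResonant {n : ℕ} {K : ℝ} {a : Mat n} (ha : SylvesterBound K a) :
    NonResonant a := by
  have key : ∀ μ ∈ spectrum ℂ a, ∀ ν ∈ spectrum ℂ a, ∀ k : ℕ, 1 ≤ k → μ - ν ≠ k := by
    intro μ hμ ν hν k hk hμν
    have hdet : ∀ μ ∈ spectrum ℂ a, (algebraMap ℂ (Mat n) μ - a).det = 0 := by
      intro μ hμ
      rw [spectrum.mem_iff, Matrix.isUnit_iff_isUnit_det, isUnit_iff_ne_zero, not_not] at hμ
      exact hμ
    obtain ⟨v, hv0, hv⟩ := Matrix.exists_mulVec_eq_zero_iff.2 (hdet ν hν)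
    obtain ⟨w, hw0, hw⟩ := Matrix.exists_vecMul_eq_zero_iff.2 (hdet μ hμ)
    have hv' : a.mulVec v = ν • v := by
      rw [Matrix.sub_mulVec, sub_eq_zero, Algebra.algebraMap_eq_smul_one, Matrix.smul_mulVec,
        Matrix.one_mulVec] at hv
      exact hv.symm
    have hw' : Matrix.vecMul w a = μ • w := by
      rw [Matrix.vecMul_sub, sub_eq_zero, Algebra.algebraMap_eq_smul_one, Matrix.vecMul_smul,
        Matrix.vecMul_one] at hw
      exact hw.symm
    have hX : sylvester a k (Matrix.vecMulVec v w) = 0 := by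
      rw [sylvester_apply, Matrix.mul_vecMulVec, Matrix.vecMulVec_mul, hv', hw',
        Matrix.smul_vecMulVec, Matrix.vecMulVec_smul, ← add_smul, ← sub_smul, ← hμν]
      simp
    have h0 : Matrix.vecMulVec v w = 0 := ha.injective hk (by rw [hX, map_zero])
    rcases Matrix.vecMulVec_eq_zero.1 h0 with h | h
    · exact hv0 h
    · exact hw0 h
  intro μ hμ ν hν k hk
  rcases lt_trichotomy k 0 with h | h | h
  · obtain ⟨m, rfl⟩ : ∃ m : ℕ, k = -(m : ℤ) := ⟨k.natAbs, by omega⟩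
    refine absurd ?_ (key ν hν μ hμ m (by omega))
    push_cast at hk
    linear_combination -hk
  · exact h
  · obtain ⟨m, rfl⟩ : ∃ m : ℕ, k = (m : ℤ) := ⟨k.natAbs, by omega⟩
    refine absurd ?_ (key μ hμ ν hν m (by omega))
    exact_mod_cast hk

end matrices

/-! ### Entire functions of matrices in Jordan form -/

/-- `i` and `j` are indices in the same Jordan block of `J`, with `i ≤ j`. -/
def SameBlock {n : ℕ} (J : Mat n) (i j : Fin n) : Prop :=
  i ≤ j ∧ ∀ k l : Fin n, i ≤ k → l ≤ j → l.val = k.val + 1 → J k l = 1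

lemma SameBlock.refl {n : ℕ} (J : Mat n) (i : Fin n) : SameBlock J i i :=
  ⟨le_rfl, fun k l hk hl hkl => by
    have h1 : i.val ≤ k.val := hk
    have h2 : l.val ≤ i.val := hl
    omega⟩

lemma sameBlock_succ_iff {n : ℕ} {J : Mat n} {i j j' : Fin n} (hj : j.val = j'.val + 1)
    (hij : i ≠ j) : SameBlock J i j ↔ SameBlock J i j' ∧ J j' j = 1 := by
  have hij' : i.val ≠ j.val := fun h => hij (Fin.ext h)
  constructor
  · rintro ⟨h1, h2⟩
    have h1' : i.val ≤ j.val := h1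
    have h3 : i ≤ j' := by rw [Fin.le_def]; omega
    refine ⟨⟨h3, fun k l hk hl hkl => h2 k l hk ?_ hkl⟩, h2 j' j h3 le_rfl hj⟩
    rw [Fin.le_def] at hl ⊢
    omega
  · rintro ⟨⟨h1, h2⟩, h3⟩
    refine ⟨by rw [Fin.le_def] at h1 ⊢; omega, fun k l hk hl hkl => ?_⟩
    by_cases hlj : l = j
    · have : k = j' := Fin.ext (by rw [hlj] at hkl; omega)
      rw [this, hlj, h3]
    · have : l.val ≠ j.val := fun h => hlj (Fin.ext h)
      exact h2 k l hk (by rw [Fin.le_def] at hl ⊢; omega) hkl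

lemma SameBlock.diag_eq {n : ℕ} {J : Mat n} (hJ : IsJordanForm J) {i j : Fin n}
    (hij : SameBlock J i j) : J j j = J i i := by
  obtain ⟨d, hd⟩ : ∃ d, j.val = i.val + d := ⟨j.val - i.val, by
    have : i.val ≤ j.val := hij.1
    omega⟩
  induction d generalizing j with
  | zero => rw [show j = i from Fin.ext (by omega)]
  | succ d ih =>
    have hlt : i.val + d < n := by have := j.2; omega
    have h1 := (sameBlock_succ_iff (J := J) (i := i) (j := j) (j' := ⟨i.val + d, hlt⟩)
      (by simp only; omega) (fun h => by rw [h] at hd; omega)).1 hij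
    have h2 := ih h1.1 rfl
    rcases hJ.2 ⟨i.val + d, hlt⟩ j (by simp only; omega) with h3 | h3
    · rw [h1.2] at h3; exact absurd h3 one_ne_zero
    · rw [← h3.2, h2]

open Classical in
/-- The value at `J`, in Jordan form, of the entire function `φ`. -/
def jordanFun {n : ℕ} (φ : ℂ → ℂ) (J : Mat n) : Mat n :=
  Matrix.of fun i j =>
    if SameBlock J i j then iteratedDeriv (j.val - i.val) φ (J i i) / ((j.val - i.val).factorial : ℂ)
    else 0

lemma jordanSol_eq_jordanFun {n : ℕ} (h : ℝ) (J : Mat n) (x : ℂ) :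
    jordanSol h J x = jordanFun (fun c => charac h c x) J := by
  ext i j
  simp only [jordanSol, jordanFun, Matrix.of_apply, logar]
  by_cases hb : SameBlock J i j
  · rw [if_pos hb]
    exact if_pos hb
  · rw [if_neg hb]
    exact if_neg hb

open Classical in
-- The binomial expansion of `(c I + N)^m`, by induction on `m`: column `j` of `J` meets only the
-- rows `j` and `j - 1`.
lemma IsJordanForm.pow_apply {n : ℕ} {J : Mat n} (hJ : IsJordanForm J) (m : ℕ) (i j : Fin n) :
    (J ^ m) i j = if SameBlock J i j then
      ((m.choose (j.val - i.val) : ℕ) : ℂ) * J i i ^ (m - (j.val - i.val)) else 0 := by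
  induction m generalizing j with
  | zero =>
    by_cases hij : i = j
    · subst hij; simp [SameBlock.refl]
    · rw [pow_zero, Matrix.one_apply_ne hij]
      split_ifs with h
      · have h1 : i.val ≤ j.val := h.1
        have h2 : i.val ≠ j.val := fun h => hij (Fin.ext h)
        rw [Nat.choose_eq_zero_of_lt (by omega)]; simp
      · rfl
  | succ m ih =>
    rw [pow_succ, Matrix.mul_apply]
    have hzero : ∀ k : Fin n, k.val ≠ j.val → k.val + 1 ≠ j.val → (J ^ m) i k * J k j = 0 :=
      fun k h1 h2 => by rw [hJ.1 k j (fun h => h1 h.symm) (fun h => h2 h.symm), mul_zero]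
    rcases Nat.eq_zero_or_pos j.val with hj0 | hjpos
    · rw [Fintype.sum_eq_single j fun k hk => hzero k (fun h => hk (Fin.ext h)) (by omega), ih]
      by_cases hij : SameBlock J i j
      · have : i = j := Fin.ext (by have : i.val ≤ j.val := hij.1; omega)
        subst this
        simp [SameBlock.refl, pow_succ]
      · simp [hij]
    · have hlt : j.val - 1 < n := by have := j.2; omega
      set j' : Fin n := ⟨j.val - 1, hlt⟩ with hj'
      have hjj : j.val = j'.val + 1 := by simp only [hj']; omega
      have hne : j ≠ j' := fun h => by rw [h] at hjj; omega
      rw [Fintype.sum_eq_add j j' hne fun k hk => hzero k (fun h => hk.1 (Fin.ext h))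
        (fun h => hk.2 (Fin.ext (by omega))), ih, ih]
      by_cases hij : i = j
      · have h1 : ¬ SameBlock J i j' := fun h => by
          have : i.val ≤ j'.val := h.1
          rw [hij] at this; omega
        rw [if_neg h1, ← hij, if_pos (SameBlock.refl J i), if_pos (SameBlock.refl J i)]
        simp [pow_succ]
      · rcases hJ.2 j' j hjj with h0 | ⟨h1, -⟩
        · have h2 : ¬ SameBlock J i j := fun h => by
            have := ((sameBlock_succ_iff hjj hij).1 h).2
            rw [h0] at this
            exact zero_ne_one this
          simp [h0, h2]
        · by_cases hb : SameBlock J i j'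
          · have hb2 : SameBlock J i j := (sameBlock_succ_iff hjj hij).2 ⟨hb, h1⟩
            have hle : i.val ≤ j'.val := hb.1
            obtain ⟨d, hd⟩ : ∃ d, j'.val - i.val = d := ⟨_, rfl⟩
            have hd2 : j.val - i.val = d + 1 := by omega
            rw [if_pos hb, if_pos hb2, if_pos hb2, h1, hd, hd2, hb2.diag_eq hJ,
              Nat.choose_succ_succ]
            push_cast
            -- When `m < d + 1` the subtraction in the exponent is truncated, but the binomial
            -- coefficient in front of it is `0`.
            rcases Nat.lt_or_ge m (d + 1) with hm | hm
            · rw [Nat.choose_eq_zero_of_lt hm]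
              simp
            · have e2 : m - d = m - (d + 1) + 1 := by omega
              rw [e2, pow_succ]
              ring
          · have hb2 : ¬ SameBlock J i j := fun h => hb ((sameBlock_succ_iff hjj hij).1 h).1
            simp [hb, hb2]

lemma iteratedDeriv_iteratedDeriv (m d : ℕ) (φ : ℂ → ℂ) :
    iteratedDeriv m (iteratedDeriv d φ) = iteratedDeriv (m + d) φ := by
  rw [iteratedDeriv_eq_iterate, iteratedDeriv_eq_iterate, iteratedDeriv_eq_iterate,
    Function.iterate_add_apply]

lemma differentiable_iteratedDeriv_of_entire {φ : ℂ → ℂ} (hφ : Differentiable ℂ φ) (d : ℕ) :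
    Differentiable ℂ (iteratedDeriv d φ) := by
  have h1 : ContDiff ℂ (d + 1 : ℕ) φ := hφ.contDiff
  exact h1.differentiable_iteratedDeriv d (by exact_mod_cast Nat.lt_succ_self d)

/-- Entire functions of a matrix in Jordan form are given by the Taylor series. -/
lemma hasSum_jordanFun {n : ℕ} {φ : ℂ → ℂ} (hφ : Differentiable ℂ φ) {J : Mat n}
    (hJ : IsJordanForm J) :
    HasSum (fun m : ℕ => (iteratedDeriv m φ 0 / (m.factorial : ℂ)) • J ^ m) (jordanFun φ J) := by
  refine Pi.hasSum.2 fun i => Pi.hasSum.2 fun j => ?_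
  have e : (fun m : ℕ => ((iteratedDeriv m φ 0 / (m.factorial : ℂ)) • J ^ m) i j) = fun m : ℕ =>
      iteratedDeriv m φ 0 / (m.factorial : ℂ) * (J ^ m) i j := rfl
  rw [e]
  simp only [hJ.pow_apply]
  rw [jordanFun, Matrix.of_apply]
  split_ifs with hb
  · set d := j.val - i.val
    set c := J i i
    -- The powers `J ^ m` with `m < d` do not contribute on the `d`-th superdiagonal; after a shift
    -- of the index by `d`, what remains is the Taylor series of the `d`-th derivative of `φ`,
    -- divided by `d!`.
    have h1 := Complex.hasSum_taylorSeries_of_entire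
      (differentiable_iteratedDeriv_of_entire hφ d) 0 c
    have h2 := h1.div_const (d.factorial : ℂ)
    refine (hasSum_nat_add_iff' d).1 ?_
    rw [Finset.sum_eq_zero fun m hm => by
      rw [Nat.choose_eq_zero_of_lt (Finset.mem_range.1 hm)]; simp, sub_zero]
    refine (congrArg (HasSum · _) (funext fun m => ?_)).mpr h2
    rw [iteratedDeriv_iteratedDeriv, sub_zero, smul_eq_mul, smul_eq_mul, Nat.add_sub_cancel]
    have h3 := Nat.add_choose_mul_factorial_mul_factorial m d
    have h4 : (((m + d).choose d : ℕ) : ℂ) * m.factorial * d.factorial = (m + d).factorial := by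
      exact_mod_cast h3
    have f1 : ((m + d).factorial : ℂ) ≠ 0 := by exact_mod_cast (m + d).factorial_ne_zero
    have f2 : (m.factorial : ℂ) ≠ 0 := by exact_mod_cast m.factorial_ne_zero
    have f3 : (d.factorial : ℂ) ≠ 0 := by exact_mod_cast d.factorial_ne_zero
    field_simp
    rw [← h4]
    ring
  · simp only [mul_zero]
    exact hasSum_zero

/-- The series involves `A₀` alone, so the sum does not depend on the Jordan reduction. The
uniqueness of constant solutions and the freedom to use the unfolding both come from here. -/
lemma IsJordanReduction.hasSum {n : ℕ} {φ : ℂ → ℂ} (hφ : Differentiable ℂ φ) {A₀ P J : Mat n}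
    (hr : IsJordanReduction A₀ P J) :
    HasSum (fun m : ℕ => (iteratedDeriv m φ 0 / (m.factorial : ℂ)) • A₀ ^ m)
      (P * jordanFun φ J * P⁻¹) := by
  obtain ⟨hP, hJ, rfl⟩ := hr
  have h1 := ((hasSum_jordanFun hφ hJ).mul_left P).mul_right P⁻¹
  have hPP : P⁻¹ * P = 1 := Matrix.nonsing_inv_mul P hP
  have h2 : ∀ m : ℕ, (P * J * P⁻¹) ^ m = P * J ^ m * P⁻¹ := by
    intro m
    induction m with
    | zero => rw [pow_zero, pow_zero, mul_one, Matrix.mul_nonsing_inv P hP]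
    | succ m ih =>
      calc _ = P * J ^ m * (P⁻¹ * P) * J * P⁻¹ := by rw [pow_succ, ih]; simp only [mul_assoc]
        _ = _ := by rw [hPP, mul_one, pow_succ]; simp only [mul_assoc]
  simpa only [h2, mul_smul_comm, smul_mul_assoc] using h1

lemma iteratedDeriv_id_mul {φ : ℂ → ℂ} (hφ : Differentiable ℂ φ) (m : ℕ) :
    iteratedDeriv (m + 1) (fun c => c * φ c)
      = fun c => c * iteratedDeriv (m + 1) φ c + (m + 1) * iteratedDeriv m φ c := by
  induction m with
  | zero =>
    funext c
    have h := (hasDerivAt_id c).mul (hφ c).hasDerivAt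
    simp only [zero_add, iteratedDeriv_one, iteratedDeriv_zero]
    have h2 : deriv (fun c => c * φ c) c = 1 * φ c + id c * deriv φ c := h.deriv
    rw [h2, id]
    push_cast
    ring
  | succ m ih =>
    rw [iteratedDeriv_succ, ih]
    funext c
    have d1 := (differentiable_iteratedDeriv_of_entire hφ (m + 1) c).hasDerivAt
    have d2 := (differentiable_iteratedDeriv_of_entire hφ m c).hasDerivAt
    have h := ((hasDerivAt_id c).mul d1).add (d2.const_mul ((m : ℂ) + 1))
    have h2 := h.deriv
    rw [← iteratedDeriv_succ, ← iteratedDeriv_succ] at h2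
    refine h2.trans ?_
    simp only [id]
    push_cast
    ring

/-- Multiplication of an entire function by an affine function. -/
lemma IsJordanReduction.affine_mul {n : ℕ} {φ : ℂ → ℂ} (hφ : Differentiable ℂ φ) {A₀ P J : Mat n}
    (hr : IsJordanReduction A₀ P J) (t : ℂ) :
    P * jordanFun (fun c => φ c - t * (c * φ c)) J * P⁻¹
      = (1 - t • A₀) * (P * jordanFun φ J * P⁻¹) := by
  have hψ : Differentiable ℂ fun c => c * φ c := differentiable_id.mul hφ
  have h1 := hr.hasSum hφ
  have h2 : HasSum (fun m : ℕ => (iteratedDeriv m (fun c => c * φ c) 0 / (m.factorial : ℂ)) •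
      A₀ ^ m) (A₀ * (P * jordanFun φ J * P⁻¹)) := by
    refine (hasSum_nat_add_iff' 1).1 ?_
    simp only [Finset.range_one, Finset.sum_singleton, iteratedDeriv_zero, zero_mul, zero_div,
      zero_smul, sub_zero]
    refine (congrArg (HasSum · _) (funext fun m => ?_)).mpr (h1.mul_left A₀)
    rw [iteratedDeriv_id_mul hφ, mul_smul_comm, ← pow_succ']
    congr 1
    have f1 : ((m : ℂ) + 1) ≠ 0 := by exact_mod_cast m.succ_ne_zero
    have f2 : (m.factorial : ℂ) ≠ 0 := by exact_mod_cast m.factorial_ne_zero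
    rw [Nat.factorial_succ]
    push_cast
    field_simp
    ring
  have h3 := h1.sub (h2.const_smul t)
  have h4 := hr.hasSum (hφ.sub (hψ.const_mul t))
  rw [sub_mul, one_mul, smul_mul_assoc]
  refine h4.unique ((congrArg (HasSum · _) (funext fun m => ?_)).mpr h3)
  have h5 : iteratedDeriv m (φ - fun c => t * (c * φ c)) 0
      = iteratedDeriv m φ 0 - t * iteratedDeriv m (fun c => c * φ c) 0 := by
    rw [iteratedDeriv_sub hφ.contDiff.contDiffAt (hψ.const_mul t).contDiff.contDiffAt,
      iteratedDeriv_const_mul_field]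
  rw [h5, smul_smul, ← sub_smul]
  congr 1
  ring

/-! ### The characters and the logarithms -/

lemma charac_eq_mul_inv (h : ℝ) (c x : ℂ) :
    charac h c x = (h : ℂ) ^ c * (Complex.Gamma (x / h) * (Complex.Gamma (x / h - c))⁻¹) := by
  rw [charac, div_eq_mul_inv]

lemma differentiable_charac {h : ℝ} (hh : 0 < h) (x : ℂ) :
    Differentiable ℂ fun c => charac h c x := by
  simp only [charac_eq_mul_inv]
  have h0 : (h : ℂ) ≠ 0 := by exact_mod_cast hh.ne'
  refine Differentiable.mul (fun c => ?_) ?_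
  · exact (differentiableAt_id.const_cpow (Or.inl h0))
  · refine (differentiable_const _).mul ?_
    exact Complex.differentiable_one_div_Gamma.comp ((differentiable_const _).sub differentiable_id)

/-- The scalar case of the constant system. The functional equation is applied to the entire
function `1/Γ`, so no value of `c` has to be excluded. -/
lemma charac_sub_step {h : ℝ} (hh : 0 < h) {x : ℂ} (hx : h < x.re) (c : ℂ) :
    charac h c (x - h) = charac h c x - h / (x - h) * (c * charac h c x) := by
  have h0 : (h : ℂ) ≠ 0 := by exact_mod_cast hh.ne'
  have hxh : x - h ≠ 0 := by
    intro h1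
    have := congrArg Complex.re h1
    simp at this
    linarith
  have e1 : (x - h) / h = x / h - 1 := by field_simp
  have hz : x / h - 1 ≠ 0 := by rw [← e1]; exact div_ne_zero hxh h0
  have g1 : Complex.Gamma (x / h) = (x / h - 1) * Complex.Gamma (x / h - 1) := by
    rw [← Complex.Gamma_add_one _ hz, sub_add_cancel]
  have g2 := Complex.one_div_Gamma_eq_self_mul_one_div_Gamma_add_one (x / h - 1 - c)
  have e2 : x / h - 1 - c + 1 = x / h - c := by ring
  rw [e2] at g2
  rw [charac_eq_mul_inv, charac_eq_mul_inv, e1, g1, g2]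
  have e3 : h / (x - h) = (x / h - 1)⁻¹ := by rw [← e1, inv_div]
  rw [e3]
  field_simp

lemma charac_eq_mul_charac_sub_one {h : ℝ} (hh : 0 < h) (x c : ℂ) :
    charac h c x = (x - h * c) * charac h (c - 1) x := by
  have h0 : (h : ℂ) ≠ 0 := by exact_mod_cast hh.ne'
  have g2 := Complex.one_div_Gamma_eq_self_mul_one_div_Gamma_add_one (x / h - c)
  have e2 : x / h - (c - 1) = x / h - c + 1 := by ring
  rw [charac_eq_mul_inv, charac_eq_mul_inv, e2, g2, Complex.cpow_sub _ _ h0, Complex.cpow_one]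
  field_simp

/-- Splitting `h^c = h^{x/h} h^{-(x/h - c)}` makes the character a function of `x` times an entire
function of `x/h - c`. The derivatives in `c` then become visibly holomorphic in `x`. -/
lemma logar_eq {h : ℝ} (hh : 0 < h) (k : ℕ) (c x : ℂ) :
    logar h k c x = Complex.Gamma (x / h) * (h : ℂ) ^ (x / h) * ((-1) ^ k *
      iteratedDeriv k (fun w => (h : ℂ) ^ (-w) * (Complex.Gamma w)⁻¹) (x / h - c))
        / (k.factorial : ℂ) := by
  have h0 : (h : ℂ) ≠ 0 := by exact_mod_cast hh.ne'
  set G : ℂ → ℂ := fun w => (h : ℂ) ^ (-w) * (Complex.Gamma w)⁻¹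
  have h1 : (fun c' => charac h c' x) = fun c' =>
      Complex.Gamma (x / h) * (h : ℂ) ^ (x / h) * G (x / h - c') := by
    funext c'
    rw [charac_eq_mul_inv]
    have : (h : ℂ) ^ c' = (h : ℂ) ^ (x / h) * (h : ℂ) ^ (-(x / h - c')) := by
      rw [← Complex.cpow_add _ _ h0]; congr 1; ring
    rw [this]
    ring
  rw [logar, h1, iteratedDeriv_const_mul_field, iteratedDeriv_comp_const_sub]
  rfl

lemma differentiableAt_logar {h : ℝ} (hh : 0 < h) (k : ℕ) (c : ℂ) {x : ℂ} (hx : 0 < x.re) :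
    DifferentiableAt ℂ (logar h k c) x := by
  have h0 : (h : ℂ) ≠ 0 := by exact_mod_cast hh.ne'
  have h1 : logar h k c = fun x => Complex.Gamma (x / h) * (h : ℂ) ^ (x / h) * ((-1) ^ k *
      iteratedDeriv k (fun w => (h : ℂ) ^ (-w) * (Complex.Gamma w)⁻¹) (x / h - c))
        / (k.factorial : ℂ) := funext fun x => logar_eq hh k c x
  have hG : Differentiable ℂ fun w => (h : ℂ) ^ (-w) * (Complex.Gamma w)⁻¹ :=
    Differentiable.mul (fun w => differentiableAt_id.neg.const_cpow (Or.inl h0))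
      Complex.differentiable_one_div_Gamma
  have hd : DifferentiableAt ℂ (fun x : ℂ => x / h) x := differentiableAt_id.div_const _
  have hre : 0 < (x / h).re := by
    rw [Complex.div_ofReal_re]; positivity
  rw [h1]
  refine DifferentiableAt.div_const (DifferentiableAt.mul (DifferentiableAt.mul ?_ ?_) ?_) _
  · refine DifferentiableAt.comp x (Complex.differentiableAt_Gamma _ fun m hm => ?_) hd
    rw [hm] at hre
    simp at hre
    have : (0 : ℝ) ≤ m := m.cast_nonneg
    linarith
  · exact hd.const_cpow (Or.inl h0)
  · refine DifferentiableAt.const_mul ?_ _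
    exact ((differentiable_iteratedDeriv_of_entire hG k).differentiableAt).comp x
      (hd.sub_const c)

/-! ### The limit of the characters -/

open MeasureTheory Set in
-- The Beta integral of `b` and `x / h`, rescaled to the interval `(0, 1/h)` so that its integrand
-- has a limit.
lemma charac_neg_eq_integral {h : ℝ} (hh : 0 < h) {x b : ℂ} (hx : 0 < x.re) (hb : 0 < b.re) :
    charac h (-b) x = (Complex.Gamma b)⁻¹ * ∫ u in Ioo (0 : ℝ) (1 / h),
      (u : ℂ) ^ (b - 1) * ((1 - h * u : ℝ) : ℂ) ^ (x / h - 1) := by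
  have h0 : (h : ℂ) ≠ 0 := by exact_mod_cast hh.ne'
  have ha : 0 < 1 / h := by positivity
  have ha0 : ((1 / h : ℝ) : ℂ) ≠ 0 := by exact_mod_cast ha.ne'
  have hz : 0 < (x / h).re := by rw [Complex.div_ofReal_re]; positivity
  have h1 := Complex.betaIntegral_scaled b (x / h) ha
  rw [intervalIntegral.integral_of_le ha.le, integral_Ioc_eq_integral_Ioo] at h1
  have h2 : ∫ u in Ioo (0 : ℝ) (1 / h), (u : ℂ) ^ (b - 1) * (((1 / h : ℝ) : ℂ) - u) ^ (x / h - 1)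
      = ((1 / h : ℝ) : ℂ) ^ (x / h - 1) * ∫ u in Ioo (0 : ℝ) (1 / h),
        (u : ℂ) ^ (b - 1) * ((1 - h * u : ℝ) : ℂ) ^ (x / h - 1) := by
    rw [← integral_const_mul]
    refine setIntegral_congr_fun measurableSet_Ioo fun u hu => ?_
    have hu1 : 0 ≤ 1 - h * u := by
      have := (lt_div_iff₀ hh).1 hu.2
      linarith
    have e : ((1 / h : ℝ) : ℂ) - u = ((1 / h : ℝ) : ℂ) * ((1 - h * u : ℝ) : ℂ) := by
      push_cast; field_simp
    simp only [e]
    rw [Complex.mul_cpow_ofReal_nonneg ha.le hu1]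
    ring
  rw [h2, Complex.betaIntegral_eq_Gamma_mul_div _ _ hb hz] at h1
  have e1 : b + x / h - 1 = b + (x / h - 1) := by ring
  rw [e1, Complex.cpow_add _ _ ha0] at h1
  have h3 : ((1 / h : ℝ) : ℂ) ^ (x / h - 1) ≠ 0 := by
    rw [Complex.cpow_ne_zero_iff]
    exact Or.inl ha0
  have h4 : ((1 / h : ℝ) : ℂ) ^ b = (h : ℂ) ^ (-b) := by
    rw [one_div, Complex.ofReal_inv, Complex.inv_cpow _ _ (by
      rw [Complex.arg_ofReal_of_nonneg hh.le]; exact Real.pi_ne_zero.symm), Complex.cpow_neg]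
  have h5 : ∫ u in Ioo (0 : ℝ) (1 / h), (u : ℂ) ^ (b - 1) * ((1 - h * u : ℝ) : ℂ) ^ (x / h - 1)
      = (h : ℂ) ^ (-b) * (Complex.Gamma b * Complex.Gamma (x / h) / Complex.Gamma (b + x / h)) := by
    refine mul_left_cancel₀ h3 ?_
    rw [h1, h4]
    ring
  have h6 := Complex.Gamma_ne_zero_of_re_pos hb
  rw [h5, charac, sub_neg_eq_add, add_comm b]
  field_simp

open MeasureTheory Set in
-- The reason is `(1 - h u)^{x/h - 1} → e^{-x u}`, with dominated convergence. The general filter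
-- allows joint limits in the step and in `x` or `b`, hence locally uniform convergence.
lemma tendsto_charac_neg {ι : Type*} {l : Filter ι} [l.IsCountablyGenerated] {h : ι → ℝ}
    {x b : ι → ℂ} {x₀ b₀ : ℂ} (hh : Tendsto h l (𝓝[>] 0)) (hx : Tendsto x l (𝓝 x₀))
    (hb : Tendsto b l (𝓝 b₀)) (hx₀ : 0 < x₀.re) (hb₀ : 0 < b₀.re) :
    Tendsto (fun i => charac (h i) (-b i) (x i)) l
      (𝓝 ((Complex.Gamma b₀)⁻¹ * ∫ u in Ioi (0 : ℝ), (u : ℂ) ^ (b₀ - 1) * Complex.exp (-(x₀ * u)))) := by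
  have hh0 : Tendsto h l (𝓝 0) := hh.mono_right nhdsWithin_le_nhds
  have hpos : ∀ᶠ i in l, 0 < h i := hh.eventually self_mem_nhdsWithin
  set σ := x₀.re / 3 with hσ
  have hσ0 : 0 < σ := by positivity
  have hbre : Tendsto (fun i => (b i).re) l (𝓝 b₀.re) := (Complex.continuous_re.tendsto _).comp hb
  have hxre : Tendsto (fun i => (x i).re) l (𝓝 x₀.re) := (Complex.continuous_re.tendsto _).comp hx
  have hb1 : ∀ᶠ i in l, b₀.re / 2 < (b i).re := hbre.eventually (lt_mem_nhds (by linarith))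
  have hb2 : ∀ᶠ i in l, (b i).re < 2 * b₀.re := hbre.eventually (gt_mem_nhds (by linarith))
  have hx1 : ∀ᶠ i in l, 2 * σ < (x i).re := hxre.eventually (lt_mem_nhds (by linarith))
  have hh1 : ∀ᶠ i in l, h i < σ := hh0.eventually (gt_mem_nhds hσ0)
  have hG : Tendsto (fun i => (Complex.Gamma (b i))⁻¹) l (𝓝 (Complex.Gamma b₀)⁻¹) :=
    (Complex.differentiable_one_div_Gamma.continuous.tendsto b₀).comp hb
  set F : ι → ℝ → ℂ := fun i => indicator (Ioo (0 : ℝ) (1 / h i)) fun u : ℝ =>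
    (u : ℂ) ^ (b i - 1) * ((1 - h i * u : ℝ) : ℂ) ^ (x i / h i - 1) with hF
  have key : Tendsto (fun i => ∫ u in Ioi (0 : ℝ), F i u) l
      (𝓝 (∫ u in Ioi (0 : ℝ), (u : ℂ) ^ (b₀ - 1) * Complex.exp (-(x₀ * u)))) := by
    refine tendsto_integral_filter_of_dominated_convergence
      -- The two powers dominate `u ^ (Re b - 1)` for `u ≤ 1` and `u ≥ 1` respectively. The
      -- exponential comes from `1 - h u ≤ e^{-h u}` and `Re x - h > σ`.
      (fun u => u ^ (b₀.re / 2 - 1) * Real.exp (-σ * u ^ (1 : ℝ))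
        + u ^ (2 * b₀.re - 1) * Real.exp (-σ * u ^ (1 : ℝ))) ?_ ?_ ?_ ?_
    · filter_upwards [hpos] with i hi
      refine AEStronglyMeasurable.mono_measure ?_ Measure.restrict_le_self
      refine (aestronglyMeasurable_indicator_iff measurableSet_Ioo).2
        (ContinuousOn.aestronglyMeasurable (ContinuousOn.mul ?_ ?_) measurableSet_Ioo)
      · refine ContinuousOn.cpow (by fun_prop) (by fun_prop) fun u hu => ?_
        exact Complex.ofReal_mem_slitPlane.2 hu.1
      · refine ContinuousOn.cpow (by fun_prop) (by fun_prop) fun u hu => ?_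
        have := (lt_div_iff₀ hi).1 hu.2
        exact Complex.ofReal_mem_slitPlane.2 (by linarith)
    · filter_upwards [hpos, hb1, hb2, hx1, hh1] with i hi hi1 hi2 hi3 hi4
      refine (ae_restrict_iff' measurableSet_Ioi).2 (ae_of_all _ fun u hu => ?_)
      have hu0 : 0 < u := hu
      have hn1 : 0 ≤ u ^ (b₀.re / 2 - 1) := by positivity
      have hn2 : 0 ≤ u ^ (2 * b₀.re - 1) := by positivity
      by_cases hui : u ∈ Ioo (0 : ℝ) (1 / h i)
      · have hu1 : 0 < 1 - h i * u := by
          have := (lt_div_iff₀ hi).1 hui.2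
          linarith
        simp only [hF, indicator_of_mem hui]
        rw [norm_mul, Complex.norm_cpow_eq_rpow_re_of_pos hu0,
          Complex.norm_cpow_eq_rpow_re_of_pos hu1, ← add_mul, Real.rpow_one]
        refine mul_le_mul ?_ ?_ (by positivity) (by positivity)
        · simp only [Complex.sub_re, Complex.one_re]
          rcases le_total u 1 with h1 | h1
          · have := Real.rpow_le_rpow_of_exponent_ge hu0 h1
              (by linarith : b₀.re / 2 - 1 ≤ (b i).re - 1)
            linarith
          · have := Real.rpow_le_rpow_of_exponent_le h1
              (by linarith : (b i).re - 1 ≤ 2 * b₀.re - 1)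
            linarith
        · have e : (x i / h i - 1).re = (x i).re / h i - 1 := by
            rw [Complex.sub_re, Complex.div_ofReal_re, Complex.one_re]
          have hexp : 0 ≤ (x i).re / h i - 1 := by
            rw [sub_nonneg, one_le_div hi]; linarith
          rw [e]
          calc (1 - h i * u) ^ ((x i).re / h i - 1)
              ≤ (Real.exp (-(h i * u))) ^ ((x i).re / h i - 1) := by
                refine Real.rpow_le_rpow hu1.le ?_ hexp
                have := Real.add_one_le_exp (-(h i * u))
                linarith
            _ = Real.exp (-(u * ((x i).re - h i))) := by
                rw [← Real.exp_mul]; congr 1; field_simp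
            _ ≤ _ := by
                refine Real.exp_le_exp.2 ?_
                nlinarith
      · simp only [hF, indicator_of_notMem hui, norm_zero]
        positivity
    · exact (integrableOn_rpow_mul_exp_neg_mul_rpow (by linarith) one_pos hσ0).add
        (integrableOn_rpow_mul_exp_neg_mul_rpow (by linarith) one_pos hσ0)
    · refine (ae_restrict_iff' measurableSet_Ioi).2 (ae_of_all _ fun u hu => ?_)
      have hu0 : 0 < u := hu
      have hu0' : (u : ℂ) ≠ 0 := by exact_mod_cast hu0.ne'
      have hhu : Tendsto (fun i => h i * u) l (𝓝 0) := by simpa using hh0.mul_const u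
      have hlt : ∀ᶠ i in l, h i * u < 1 := hhu.eventually (gt_mem_nhds one_pos)
      have hlog : Tendsto (fun i => (h i)⁻¹ * Real.log (1 - h i * u)) l (𝓝 (-u)) := by
        have hd : HasDerivAt (fun t : ℝ => Real.log (1 - t * u)) (-u) 0 := by
          have h1 : HasDerivAt (fun t : ℝ => 1 - t * u) (-(1 * u)) 0 :=
            ((hasDerivAt_id (0 : ℝ)).mul_const u).const_sub 1
          simpa using h1.log (by simp)
        have h2 := (hasDerivAt_iff_tendsto_slope_zero.1 hd).comp
          (hh.mono_right (nhdsWithin_mono _ fun y hy => ne_of_gt hy))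
        refine h2.congr fun i => ?_
        simp
      have hlog0 : Tendsto (fun i => Real.log (1 - h i * u)) l (𝓝 0) := by
        have := (tendsto_const_nhds (x := (1 : ℝ))).sub hhu |>.log (by norm_num)
        simpa using this
      have hE : Tendsto (fun i => Complex.exp (((((h i)⁻¹ * Real.log (1 - h i * u) : ℝ) : ℂ)) * x i
          - ((Real.log (1 - h i * u) : ℝ) : ℂ))) l (𝓝 (Complex.exp (-(x₀ * u)))) := by
        have h3 := (((Complex.continuous_ofReal.tendsto _).comp hlog).mul hx).sub
          ((Complex.continuous_ofReal.tendsto _).comp hlog0)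
        have e : -(x₀ * u) = ((-u : ℝ) : ℂ) * x₀ - ((0 : ℝ) : ℂ) := by push_cast; ring
        rw [e]
        exact (Complex.continuous_exp.tendsto _).comp h3
      have hP : Tendsto (fun i => (u : ℂ) ^ (b i - 1)) l (𝓝 ((u : ℂ) ^ (b₀ - 1))) :=
        (hb.sub_const 1).const_cpow (Or.inl hu0')
      refine (hP.mul hE).congr' ?_
      filter_upwards [hpos, hlt] with i hi hi1
      have hui : u ∈ Ioo (0 : ℝ) (1 / h i) := ⟨hu0, by rw [lt_div_iff₀ hi]; linarith⟩
      have hpos1 : 0 < 1 - h i * u := by linarith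
      have hi0 : (h i : ℂ) ≠ 0 := by exact_mod_cast hi.ne'
      simp only [hF, indicator_of_mem hui]
      rw [Complex.cpow_def_of_ne_zero (x := ((1 - h i * u : ℝ) : ℂ))
        (by exact_mod_cast hpos1.ne'), ← Complex.ofReal_log hpos1.le]
      congr 2
      push_cast
      field_simp
  refine (hG.mul key).congr' ?_
  filter_upwards [hpos, hb1, hx1] with i hi hi1 hi2
  rw [charac_neg_eq_integral hi (by linarith) (by linarith)]
  congr 1
  simp only [hF]
  rw [setIntegral_indicator measurableSet_Ioo, inter_eq_right.2 Ioo_subset_Ioi_self]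

/-- A joint limit is continuous in the parameter. -/
lemma continuousAt_of_tendsto_prod {ι α β : Type*} [TopologicalSpace α] [TopologicalSpace β]
    [RegularSpace β] {l : Filter ι} [l.NeBot] {F : ι → α → β} {f : α → β} {s : Set α}
    (hs : IsOpen s)
    (hF : ∀ y ∈ s, Tendsto (fun p : ι × α => F p.1 p.2) (l ×ˢ 𝓝 y) (𝓝 (f y))) {y₀ : α}
    (hy₀ : y₀ ∈ s) : ContinuousAt f y₀ := by
  refine (closed_nhds_basis (f y₀)).tendsto_right_iff.2 fun V hV => ?_
  have h1 : ∀ᶠ p in 𝓝 y₀ ×ˢ l, F p.2 p.1 ∈ V :=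
    ((hF y₀ hy₀).comp tendsto_prod_swap).eventually_mem hV.1
  filter_upwards [h1.curry, hs.mem_nhds hy₀] with y hy hys
  have h2 : Tendsto (fun i => F i y) l (𝓝 (f y)) :=
    (hF y hys).comp (tendsto_id.prodMk tendsto_const_nhds)
  exact hV.2.mem_of_tendsto h2 hy

lemma tendstoLocallyUniformlyOn_of_tendsto_prod {ι α : Type*} [TopologicalSpace α] {l : Filter ι}
    [l.NeBot] {F : ι → α → ℂ} {f : α → ℂ} {s : Set α} (hs : IsOpen s)
    (hF : ∀ y ∈ s, Tendsto (fun p : ι × α => F p.1 p.2) (l ×ˢ 𝓝 y) (𝓝 (f y))) :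
    TendstoLocallyUniformlyOn F f l s := by
  rw [hs.tendstoLocallyUniformlyOn_iff_forall_tendsto]
  intro y hy
  have h1 : Tendsto (fun p : ι × α => f p.2) (l ×ˢ 𝓝 y) (𝓝 (f y)) :=
    (continuousAt_of_tendsto_prod hs hF hy).tendsto.comp tendsto_snd
  exact (h1.prodMk_nhds (hF y hy)).mono_right (nhds_le_uniformity _)

lemma isOpen_re_pos : IsOpen {z : ℂ | 0 < z.re} :=
  isOpen_lt continuous_const Complex.continuous_re

lemma differentiableAt_charac {h : ℝ} (hh : 0 < h) (c : ℂ) {x : ℂ} (hx : 0 < x.re) :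
    DifferentiableAt ℂ (charac h c) x := by
  have h1 := differentiableAt_logar hh 0 c hx
  have h2 : logar h 0 c = charac h c := by
    funext x
    simp [logar]
  rwa [h2] at h1

open MeasureTheory in
-- Known for real `x > 0` and extended by the identity theorem. The integral is holomorphic in `x`
-- because it is a locally uniform limit of characters.
lemma integral_cpow_mul_exp_neg_mul {x b : ℂ} (hx : 0 < x.re) (hb : 0 < b.re) :
    (Complex.Gamma b)⁻¹ * ∫ u in Set.Ioi (0 : ℝ), (u : ℂ) ^ (b - 1) * Complex.exp (-(x * u))
      = x ^ (-b) := by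
  set f : ℂ → ℂ := fun x =>
    (Complex.Gamma b)⁻¹ * ∫ u in Set.Ioi (0 : ℝ), (u : ℂ) ^ (b - 1) * Complex.exp (-(x * u)) with hf
  have h1 : TendstoLocallyUniformlyOn (fun h x => charac h (-b) x) f (𝓝[>] 0) {z : ℂ | 0 < z.re} :=
    tendstoLocallyUniformlyOn_of_tendsto_prod isOpen_re_pos fun y hy =>
      tendsto_charac_neg tendsto_fst tendsto_snd tendsto_const_nhds hy hb
  have h2 : DifferentiableOn ℂ f {z : ℂ | 0 < z.re} :=
    h1.differentiableOn (eventually_mem_nhdsWithin.mono fun h hh y hy =>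
      (differentiableAt_charac hh _ hy).differentiableWithinAt) isOpen_re_pos
  have h3 : DifferentiableOn ℂ (fun x : ℂ => x ^ (-b)) {z : ℂ | 0 < z.re} := fun y hy =>
    (differentiableAt_id.cpow_const (Or.inl hy)).differentiableWithinAt
  have hconv : IsPreconnected {z : ℂ | 0 < z.re} :=
    (convex_halfSpace_re_gt 0).isPreconnected
  refine (h2.analyticOnNhd isOpen_re_pos).eqOn_of_preconnected_of_frequently_eq
    (h3.analyticOnNhd isOpen_re_pos) hconv (z₀ := 1) (by simp) ?_ hx
  have h4 : ∀ r : ℝ, 0 < r → f r = (r : ℂ) ^ (-b) := by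
    intro r hr
    have h5 := Complex.integral_cpow_mul_exp_neg_mul_Ioi hb hr
    simp only [hf]
    rw [h5, one_div, Complex.inv_cpow _ _ (by
      rw [Complex.arg_ofReal_of_nonneg hr.le]; exact Real.pi_ne_zero.symm), Complex.cpow_neg]
    field_simp [Complex.Gamma_ne_zero_of_re_pos hb]
  have h6 : Tendsto (fun r : ℝ => (r : ℂ)) (𝓝[>] 1) (𝓝[≠] 1) := by
    refine tendsto_nhdsWithin_iff.2 ⟨?_, ?_⟩
    · exact (Complex.continuous_ofReal.tendsto' 1 1 (by simp)).mono_left nhdsWithin_le_nhds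
    · filter_upwards [self_mem_nhdsWithin] with r hr
      have : (1 : ℝ) < r := hr
      simp only [Set.mem_compl_iff, Set.mem_singleton_iff]
      exact_mod_cast this.ne'
  refine h6.frequently (Eventually.frequently ?_)
  filter_upwards [self_mem_nhdsWithin] with r hr
  exact h4 r (one_pos.trans hr)

/-- The character of step `h` with exponent `c` converges to `x ^ c`. -/
lemma tendsto_charac {ι : Type*} {l : Filter ι} [l.IsCountablyGenerated] {h : ι → ℝ}
    {x c : ι → ℂ} {x₀ c₀ : ℂ} (hh : Tendsto h l (𝓝[>] 0)) (hx : Tendsto x l (𝓝 x₀))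
    (hc : Tendsto c l (𝓝 c₀)) (hx₀ : 0 < x₀.re) :
    Tendsto (fun i => charac (h i) (c i) (x i)) l (𝓝 (x₀ ^ c₀)) := by
  -- Induction on an integer bound of `Re c₀`: the base case `Re c₀ < 0` is the integral, and
  -- `charac_eq_mul_charac_sub_one` raises the exponent by one.
  obtain ⟨N, hN⟩ := exists_nat_gt c₀.re
  induction N generalizing c c₀ with
  | zero =>
    have h1 := tendsto_charac_neg hh hx hc.neg hx₀ (by simpa using hN)
    rw [integral_cpow_mul_exp_neg_mul hx₀ (by simpa using hN)] at h1
    simpa using h1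
  | succ N ih =>
    have h1 := ih (hc.sub_const 1) (by push_cast at hN; simp; linarith)
    have hh0 : Tendsto h l (𝓝 0) := hh.mono_right nhdsWithin_le_nhds
    have h2 := (hx.sub (((Complex.continuous_ofReal.tendsto _).comp hh0).mul hc)).mul h1
    have hx0' : x₀ ≠ 0 := fun h => by simp [h] at hx₀
    have e : (x₀ - ((0 : ℝ) : ℂ) * c₀) * x₀ ^ (c₀ - 1) = x₀ ^ c₀ := by
      rw [Complex.cpow_sub _ _ hx0', Complex.cpow_one]
      push_cast
      field_simp
      ring
    rw [e] at h2
    refine h2.congr' ?_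
    filter_upwards [hh.eventually self_mem_nhdsWithin] with i hi
    exact (charac_eq_mul_charac_sub_one hi _ _).symm

/-- The characters converge locally uniformly in the exponent, so by Weierstrass' theorem all their
derivatives in `c` do. -/
lemma tendsto_logar {x c : ℝ → ℂ} {x₀ c₀ : ℂ} (hx : Tendsto x (𝓝[>] 0) (𝓝 x₀))
    (hc : Tendsto c (𝓝[>] 0) (𝓝 c₀)) (hx₀ : 0 < x₀.re) (k : ℕ) :
    Tendsto (fun h => logar h k (c h) (x h)) (𝓝[>] 0)
      (𝓝 (iteratedDeriv k (fun c => x₀ ^ c) c₀ / (k.factorial : ℂ))) := by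
  have hx0' : x₀ ≠ 0 := fun h => by simp [h] at hx₀
  have hlim : Differentiable ℂ fun c : ℂ => x₀ ^ c := fun c =>
    differentiableAt_id.const_cpow (Or.inl hx0')
  have hdiff : ∀ᶠ h in 𝓝[>] (0 : ℝ), ∀ k, Differentiable ℂ
      (iteratedDeriv k fun c => charac h c (x h)) :=
    eventually_mem_nhdsWithin.mono fun h hh k =>
      differentiable_iteratedDeriv_of_entire (differentiable_charac hh _) k
  have h1 : ∀ k, TendstoLocallyUniformlyOn (fun h => iteratedDeriv k fun c => charac h c (x h))
      (iteratedDeriv k fun c => x₀ ^ c) (𝓝[>] 0) Set.univ := by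
    intro k
    induction k with
    | zero =>
      simp only [iteratedDeriv_zero]
      exact tendstoLocallyUniformlyOn_of_tendsto_prod isOpen_univ fun y _ =>
        tendsto_charac tendsto_fst (hx.comp tendsto_fst) tendsto_snd hx₀
    | succ k ih =>
      have h2 := ih.deriv (hdiff.mono fun h hh => (hh k).differentiableOn) isOpen_univ
      simp only [iteratedDeriv_succ]
      exact h2
  have h2 := (h1 k).tendsto_comp (x := c₀) (g := c)
    (differentiable_iteratedDeriv_of_entire hlim k).continuous.continuousWithinAt
    (Set.mem_univ _) (by rwa [nhdsWithin_univ])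
  exact h2.div_const _

/-! ### Solutions of systems with constant matrix -/

lemma IsConstantSolution.eq {n : ℕ} {h : ℝ} (hh : 0 < h) {A₀ : Mat n} {e e' : ℂ → Mat n}
    (he : IsConstantSolution h A₀ e) (he' : IsConstantSolution h A₀ e') : e = e' := by
  obtain ⟨P, J, hr, h1⟩ := he
  obtain ⟨P', J', hr', h1'⟩ := he'
  funext x
  rw [h1, h1', jordanSol_eq_jordanFun, jordanSol_eq_jordanFun]
  exact (hr.hasSum (differentiable_charac hh x)).unique (hr'.hasSum (differentiable_charac hh x))

lemma IsConstantSolution.sub_step {n : ℕ} {h : ℝ} (hh : 0 < h) {A₀ : Mat n} {e : ℂ → Mat n}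
    (he : IsConstantSolution h A₀ e) {x : ℂ} (hx : h < x.re) :
    e (x - h) = (1 - ((h : ℂ) / (x - h)) • A₀) * e x := by
  obtain ⟨P, J, hr, h1⟩ := he
  rw [h1, h1, jordanSol_eq_jordanFun, jordanSol_eq_jordanFun,
    ← hr.affine_mul (differentiable_charac hh x)]
  simp only [charac_sub_step hh hx]

lemma IsConstantSolution.differentiableAt {n : ℕ} {h : ℝ} (hh : 0 < h) {A₀ : Mat n}
    {e : ℂ → Mat n} (he : IsConstantSolution h A₀ e) {x : ℂ} (hx : 0 < x.re) (i j : Fin n) :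
    DifferentiableAt ℂ (fun z => e z i j) x := by
  obtain ⟨P, J, hr, h1⟩ := he
  have h2 : ∀ k l, DifferentiableAt ℂ (fun z => jordanSol h J z k l) x := by
    intro k l
    simp only [jordanSol, Matrix.of_apply]
    split_ifs
    · exact differentiableAt_logar hh _ _ hx
    · exact differentiableAt_const _
  have h3 : (fun z => e z i j) = fun z => ∑ l, (∑ k, P i k * jordanSol h J z k l) * P⁻¹ l j := by
    funext z
    rw [h1, Matrix.mul_apply]
    simp only [Matrix.mul_apply]
  rw [h3]
  exact DifferentiableAt.fun_sum fun l _ => (DifferentiableAt.fun_sum fun k _ =>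
    (h2 k l).const_mul _).mul_const _

section
attribute [local instance] Matrix.linftyOpNormedRing Matrix.linftyOpNormedAlgebra

lemma iteratedDeriv_cpow_zero {x : ℂ} (hx : x ≠ 0) (m : ℕ) :
    iteratedDeriv m (fun c : ℂ => x ^ c) 0 = Complex.log x ^ m := by
  have h1 : (fun c : ℂ => x ^ c) = fun c => Complex.exp (Complex.log x * c) := by
    funext c; rw [Complex.cpow_def_of_ne_zero hx]
  rw [h1, iteratedDeriv_cexp_const_mul]
  simp

lemma IsJordanReduction.exp_log {n : ℕ} {A₀ P J : Mat n} (hr : IsJordanReduction A₀ P J) {x : ℂ}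
    (hx : x ≠ 0) : NormedSpace.exp (Complex.log x • A₀) = P * jordanFun (fun c => x ^ c) J * P⁻¹ := by
  have h1 := NormedSpace.exp_series_hasSum_exp' (𝕂 := ℂ) (Complex.log x • A₀)
  have hd : Differentiable ℂ fun c : ℂ => x ^ c := fun c =>
    differentiableAt_id.const_cpow (Or.inl hx)
  have h2 := hr.hasSum hd
  refine h1.unique ((congrArg (HasSum · _) (funext fun m => ?_)).mp h2)
  rw [iteratedDeriv_cpow_zero hx, smul_pow, smul_smul, div_eq_inv_mul]

end

lemma tendsto_matrix_inv {n : ℕ} {ι : Type*} {l : Filter ι} {P : ι → Mat n} {P₀ : Mat n}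
    (hP : Tendsto P l (𝓝 P₀)) (h₀ : IsUnit P₀.det) :
    Tendsto (fun i => (P i)⁻¹) l (𝓝 P₀⁻¹) := by
  simp only [Matrix.inv_def, Ring.inverse_eq_inv']
  have h1 : Tendsto (fun i => (P i).det) l (𝓝 P₀.det) :=
    ((continuous_id.matrix_det).tendsto P₀).comp hP
  have h2 : Tendsto (fun i => (P i).adjugate) l (𝓝 P₀.adjugate) :=
    ((continuous_id.matrix_adjugate).tendsto P₀).comp hP
  exact (h1.inv₀ h₀.ne_zero).smul h2

/-- If Jordan forms converge, their superdiagonals are eventually constant. -/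
lemma eventually_sameBlock_iff {n : ℕ} {ι : Type*} {l : Filter ι} {J : ι → Mat n} {J₀ : Mat n}
    (hJ : Tendsto J l (𝓝 J₀)) (hJ₀ : IsJordanForm J₀) (hJl : ∀ᶠ i in l, IsJordanForm (J i)) :
    ∀ᶠ m in l, ∀ i j, SameBlock (J m) i j ↔ SameBlock J₀ i j := by
  have h1 : ∀ i j : Fin n, ∀ᶠ m in l, j.val = i.val + 1 → (J m i j = 1 ↔ J₀ i j = 1) := by
    intro i j
    have h2 : Tendsto (fun m => J m i j) l (𝓝 (J₀ i j)) := tendsto_pi_nhds.1 (tendsto_pi_nhds.1 hJ i) j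
    by_cases hij : j.val = i.val + 1
    · rcases hJ₀.2 i j hij with h0 | h0
      · rw [h0] at h2
        filter_upwards [h2.eventually_ne zero_ne_one] with m hm _
        simp [hm, h0]
      · rw [h0.1] at h2
        filter_upwards [h2.eventually_ne one_ne_zero, hJl] with m hm hJm _
        rcases hJm.2 i j hij with h3 | h3
        · exact absurd h3 hm
        · simp [h3.1, h0.1]
    · exact Eventually.of_forall fun m h => absurd h hij
  filter_upwards [eventually_all.2 fun i => eventually_all.2 (h1 i)] with m hm i j
  unfold SameBlock
  refine and_congr Iff.rfl (forall_congr' fun k => forall_congr' fun l => ?_)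
  exact imp_congr Iff.rfl (imp_congr Iff.rfl (forall_congr' fun hkl => hm k l hkl))

/-- The solution may be computed with the converging reductions. Their block structure is eventually
that of the limit, so every entry is either constantly `0` or a converging logarithm. -/
lemma JordanUnfolds.tendsto_constantSolution {n : ℕ} {h₀ : ℝ} (hh₀ : 0 < h₀) {A₀ : Mat n}
    {B : ℝ → Mat n} (hu : JordanUnfolds h₀ A₀ B) {e : ℝ → ℂ → Mat n}
    (he : ∀ᶠ h in 𝓝[>] 0, IsConstantSolution h (B h) (e h)) {x : ℝ → ℂ} {x₀ : ℂ}
    (hx : Tendsto x (𝓝[>] 0) (𝓝 x₀)) (hx₀ : 0 < x₀.re) :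
    Tendsto (fun h => e h (x h)) (𝓝[>] 0) (𝓝 (NormedSpace.exp (Complex.log x₀ • A₀))) := by
  obtain ⟨P, J, Ph, Jh, hr, hrh, hP, hJ⟩ := hu
  have hx0 : x₀ ≠ 0 := fun h => by simp [h] at hx₀
  have hI : ∀ᶠ h in 𝓝[>] (0 : ℝ), h ∈ Set.Ioo 0 h₀ := Ioo_mem_nhdsGT hh₀
  have hb := eventually_sameBlock_iff hJ hr.2.1 (hI.mono fun h hh => (hrh h hh).2.1)
  rw [hr.exp_log hx0]
  have hmain : Tendsto (fun h => jordanSol h (Jh h) (x h)) (𝓝[>] 0)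
      (𝓝 (jordanFun (fun c => x₀ ^ c) J)) := by
    refine tendsto_pi_nhds.2 fun i => tendsto_pi_nhds.2 fun j => ?_
    have hJi : Tendsto (fun h => Jh h i i) (𝓝[>] 0) (𝓝 (J i i)) :=
      tendsto_pi_nhds.1 (tendsto_pi_nhds.1 hJ i) i
    by_cases hs : SameBlock J i j
    · have h1 := tendsto_logar hx hJi hx₀ (j.val - i.val)
      rw [jordanFun, Matrix.of_apply, if_pos hs]
      refine h1.congr' ?_
      filter_upwards [hb] with h hbh
      rw [jordanSol, Matrix.of_apply]
      exact (if_pos ((hbh i j).2 hs)).symm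
    · rw [jordanFun, Matrix.of_apply, if_neg hs]
      refine tendsto_const_nhds.congr' ?_
      filter_upwards [hb] with h hbh
      rw [jordanSol, Matrix.of_apply]
      exact (if_neg fun h => hs ((hbh i j).1 h)).symm
  refine ((hP.mul hmain).mul (tendsto_matrix_inv hP hr.1)).congr' ?_
  filter_upwards [hI, he, self_mem_nhdsWithin] with h hh heh hpos
  have h2 : IsConstantSolution h (B h) fun x => Ph h * jordanSol h (Jh h) x * (Ph h)⁻¹ :=
    ⟨_, _, hrh h hh, fun _ => rfl⟩
  rw [heh.eq hpos h2]

/-! ### Products along arithmetic progressions -/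

section Products
variable {𝔸 : Type*} [NormedRing 𝔸] [NormedAlgebra ℂ 𝔸]

/-- `M(x + h) M(x + 2h) ⋯ M(x + Nh)`. -/
def stepProd {𝔸 : Type*} [Ring 𝔸] (M : ℂ → 𝔸) (h : ℝ) : ℕ → ℂ → 𝔸
  | 0, _ => 1
  | N + 1, x => M (x + h) * stepProd M h N (x + h)

lemma stepProd_add {𝔸 : Type*} [Ring 𝔸] (M : ℂ → 𝔸) (h : ℝ) (N N' : ℕ) (x : ℂ) :
    stepProd M h (N + N') x = stepProd M h N x * stepProd M h N' (x + N * h) := by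
  induction N generalizing x with
  | zero => simp [stepProd]
  | succ N ih =>
    rw [Nat.succ_add, stepProd, ih, stepProd, mul_assoc]
    congr 3
    push_cast
    ring

lemma stepProd_mul_eq {𝔸 : Type*} [Ring 𝔸] {M Y : ℂ → 𝔸} {h : ℝ} {N : ℕ} {x : ℂ}
    (hY : ∀ k < N, Y (x + k * h) = M (x + (k + 1) * h) * Y (x + (k + 1) * h)) :
    stepProd M h N x * Y (x + N * h) = Y x := by
  induction N generalizing x with
  | zero => simp [stepProd]
  | succ N ih =>
    have h1 := hY 0 (Nat.succ_pos _)
    simp only [Nat.cast_zero, zero_mul, add_zero, zero_add, one_mul] at h1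
    rw [h1, ← ih (x := x + h) fun k hk => ?_, stepProd, mul_assoc]
    · congr 3
      push_cast
      ring
    · have h2 := hY (k + 1) (Nat.succ_lt_succ hk)
      have e1 : x + h + k * h = x + ((k + 1 : ℕ) : ℂ) * h := by push_cast; ring
      have e2 : x + h + (k + 1) * h = x + (((k + 1 : ℕ) : ℂ) + 1) * h := by push_cast; ring
      rw [e1, e2, h2]

/-- Grouping two half steps into one makes the Euler products of steps `h / 2` and `h` comparable
factor by factor. -/
lemma stepProd_half {𝔸 : Type*} [Ring 𝔸] (M : ℂ → 𝔸) (h : ℝ) (N : ℕ) (x : ℂ) :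
    stepProd M (h / 2) (2 * N) x = stepProd (fun y => M (y - (h / 2 : ℝ)) * M y) h N x := by
  induction N generalizing x with
  | zero => simp [stepProd]
  | succ N ih =>
    have e1 : x + h - ((h / 2 : ℝ) : ℂ) = x + (h / 2 : ℝ) := by push_cast; ring
    have e2 : x + (h / 2 : ℝ) + (h / 2 : ℝ) = x + h := by push_cast; ring
    rw [show 2 * (N + 1) = 2 * N + 1 + 1 from rfl, stepProd, stepProd, stepProd, e2, ih, e1,
      mul_assoc]

lemma norm_stepProd_le (h1 : ‖(1 : 𝔸)‖ ≤ 1) {M : ℂ → 𝔸} {h q : ℝ} (hq : 0 ≤ q) {N : ℕ} {x : ℂ}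
    (hM : ∀ k < N, ‖M (x + (k + 1) * h)‖ ≤ q) : ‖stepProd M h N x‖ ≤ q ^ N := by
  induction N generalizing x with
  | zero => simpa [stepProd] using h1
  | succ N ih =>
    have h2 := hM 0 (Nat.succ_pos _)
    simp only [Nat.cast_zero, zero_add, one_mul] at h2
    have h3 : ‖stepProd M h N (x + h)‖ ≤ q ^ N := ih fun k hk => by
      have := hM (k + 1) (Nat.succ_lt_succ hk)
      rwa [show x + (((k + 1 : ℕ) : ℂ) + 1) * h = x + h + (k + 1) * h by push_cast; ring] at this
    rw [stepProd, pow_succ']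
    exact (norm_mul_le _ _).trans (mul_le_mul h2 h3 (norm_nonneg _) hq)

lemma norm_stepProd_sub_le (h1 : ‖(1 : 𝔸)‖ ≤ 1) {M M' : ℂ → 𝔸} {h q τ : ℝ} (hq : 1 ≤ q)
    (hτ : 0 ≤ τ) {N : ℕ} {x : ℂ} (hM : ∀ k < N, ‖M (x + (k + 1) * h)‖ ≤ q)
    (hM' : ∀ k < N, ‖M' (x + (k + 1) * h)‖ ≤ q)
    (hMM : ∀ k < N, ‖M' (x + (k + 1) * h) - M (x + (k + 1) * h)‖ ≤ τ) :
    ‖stepProd M' h N x - stepProd M h N x‖ ≤ N * τ * q ^ N := by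
  induction N generalizing x with
  | zero => simp [stepProd]
  | succ N ih =>
    have e : ∀ k : ℕ, x + (((k + 1 : ℕ) : ℂ) + 1) * h = x + h + (k + 1) * h := fun k => by
      push_cast; ring
    have a1 : ∀ k < N, ‖M (x + h + (k + 1) * h)‖ ≤ q := fun k hk => by
      rw [← e]; exact hM (k + 1) (Nat.succ_lt_succ hk)
    have a2 : ∀ k < N, ‖M' (x + h + (k + 1) * h)‖ ≤ q := fun k hk => by
      rw [← e]; exact hM' (k + 1) (Nat.succ_lt_succ hk)
    have a3 : ∀ k < N, ‖M' (x + h + (k + 1) * h) - M (x + h + (k + 1) * h)‖ ≤ τ := fun k hk => by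
      rw [← e]; exact hMM (k + 1) (Nat.succ_lt_succ hk)
    have b2 := hM' 0 (Nat.succ_pos _)
    have b3 := hMM 0 (Nat.succ_pos _)
    simp only [Nat.cast_zero, zero_add, one_mul] at b2 b3
    have c1 := ih a1 a2 a3
    have c2 := norm_stepProd_le h1 (zero_le_one.trans hq) a1
    have hqN : q ^ N ≤ q ^ (N + 1) := pow_le_pow_right₀ hq (Nat.le_succ N)
    rw [stepProd, stepProd]
    calc _ = ‖M' (x + h) * (stepProd M' h N (x + h) - stepProd M h N (x + h))
          + (M' (x + h) - M (x + h)) * stepProd M h N (x + h)‖ := by congr 1; noncomm_ring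
      _ ≤ q * (N * τ * q ^ N) + τ * q ^ N := by
          refine (norm_add_le _ _).trans (add_le_add ?_ ?_)
          · exact (norm_mul_le _ _).trans (mul_le_mul b2 c1 (norm_nonneg _) (by linarith))
          · exact (norm_mul_le _ _).trans (mul_le_mul b3 c2 (norm_nonneg _) hτ)
      _ ≤ N * τ * q ^ (N + 1) + τ * q ^ (N + 1) := by
          rw [pow_succ]
          have := mul_le_mul_of_nonneg_left hqN hτ
          rw [pow_succ] at this
          nlinarith
      _ = _ := by push_cast; ring

/-- Discrete Grönwall inequality. -/
lemma norm_stepProd_mul_sub_le {M E : ℂ → 𝔸} {h q τ : ℝ} (hq : 1 ≤ q)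
    (hτ : 0 ≤ τ) {N : ℕ} {x : ℂ} (U : 𝔸)
    (hM : ∀ k < N, ‖M (x + (k + 1) * h)‖ ≤ q)
    (hE : ∀ k < N, ‖E (x + k * h) - M (x + (k + 1) * h) * E (x + (k + 1) * h)‖ ≤ τ) :
    ‖stepProd M h N x * U - E x‖ ≤ q ^ N * (‖U - E (x + N * h)‖ + N * τ) := by
  induction N generalizing x with
  | zero => simp [stepProd]
  | succ N ih =>
    have e : ∀ k : ℕ, x + (((k + 1 : ℕ) : ℂ) + 1) * h = x + h + (k + 1) * h := fun k => by
      push_cast; ring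
    have e' : ∀ k : ℕ, x + ((k + 1 : ℕ) : ℂ) * h = x + h + k * h := fun k => by
      push_cast; ring
    have a1 : ∀ k < N, ‖M (x + h + (k + 1) * h)‖ ≤ q := fun k hk => by
      rw [← e]; exact hM (k + 1) (Nat.succ_lt_succ hk)
    have a3 : ∀ k < N, ‖E (x + h + k * h) - M (x + h + (k + 1) * h) * E (x + h + (k + 1) * h)‖ ≤ τ :=
      fun k hk => by rw [← e, ← e']; exact hE (k + 1) (Nat.succ_lt_succ hk)
    have b2 := hM 0 (Nat.succ_pos _)
    have b3 := hE 0 (Nat.succ_pos _)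
    simp only [Nat.cast_zero, zero_add, one_mul, zero_mul, add_zero] at b2 b3
    have c1 := ih a1 a3
    rw [stepProd, e']
    have hqN : 1 ≤ q ^ (N + 1) := one_le_pow₀ hq
    calc _ = ‖M (x + h) * (stepProd M h N (x + h) * U - E (x + h))
          - (E x - M (x + h) * E (x + h))‖ := by congr 1; noncomm_ring
      _ ≤ q * (q ^ N * (‖U - E (x + h + N * h)‖ + N * τ)) + τ := by
          refine (norm_sub_le _ _).trans (add_le_add ?_ b3)
          exact (norm_mul_le _ _).trans (mul_le_mul b2 c1 (norm_nonneg _) (by linarith))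
      _ ≤ q ^ (N + 1) * (‖U - E (x + h + N * h)‖ + N * τ) + q ^ (N + 1) * τ := by
          rw [pow_succ']
          rw [pow_succ'] at hqN
          nlinarith [mul_le_mul_of_nonneg_right hqN hτ]
      _ = _ := by push_cast; ring

lemma differentiableOn_stepProd {M : ℂ → 𝔸} {h : ℝ} (hh : 0 ≤ h) {U : Set ℂ}
    (hU : ∀ x ∈ U, ∀ t : ℝ, 0 ≤ t → x + t ∈ U) (hM : DifferentiableOn ℂ M U) (N : ℕ) :
    DifferentiableOn ℂ (stepProd M h N) U := by
  have hshift : DifferentiableOn ℂ (fun x : ℂ => x + h) U := (differentiableOn_id.add_const _)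
  have hmaps : Set.MapsTo (fun x : ℂ => x + h) U U := fun x hx => hU x hx h hh
  induction N with
  | zero => exact differentiableOn_const _
  | succ N ih => exact (hM.comp hshift hmaps).mul (ih.comp hshift hmaps)

end Products

/-! ### Lipschitz estimates on compact convex sets -/

section Lipschitz
variable {E : Type*} [NormedAddCommGroup E] [NormedSpace ℂ E] [CompleteSpace E]

lemma exists_lipschitz_of_differentiableOn {f : ℂ → E} {U K : Set ℂ} (hU : IsOpen U)
    (hf : DifferentiableOn ℂ f U) (hK : IsCompact K) (hKc : Convex ℝ K) (hKU : K ⊆ U) :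
    ∃ Λ : ℝ, 0 ≤ Λ ∧ ∀ y ∈ K, ∀ z ∈ K, ‖f z - f y‖ ≤ Λ * ‖z - y‖ := by
  have hd : ContinuousOn (deriv f) K := ((hf.deriv hU).continuousOn).mono hKU
  obtain ⟨Λ, hΛ⟩ := hK.exists_bound_of_continuousOn hd
  refine ⟨max Λ 0, le_max_right _ _, fun y hy z hz => ?_⟩
  exact hKc.norm_image_sub_le_of_norm_hasDerivWithin_le (f' := deriv f)
    (fun x hx => ((hf.differentiableAt (hU.mem_nhds (hKU hx))).hasDerivAt).hasDerivWithinAt)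
    (fun x hx => (hΛ x hx).trans (le_max_left _ _)) hy hz

lemma exists_taylor_of_differentiableOn {f : ℂ → E} {U K : Set ℂ} (hU : IsOpen U)
    (hf : DifferentiableOn ℂ f U) (hK : IsCompact K) (hKc : Convex ℝ K) (hKU : K ⊆ U) :
    ∃ Λ : ℝ, 0 ≤ Λ ∧ ∀ y ∈ K, ∀ z ∈ K,
      ‖f z - f y - (z - y) • deriv f y‖ ≤ Λ * ‖z - y‖ ^ 2 := by
  obtain ⟨Λ, hΛ0, hΛ⟩ := exists_lipschitz_of_differentiableOn hU (hf.deriv hU) hK hKc hKU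
  refine ⟨Λ, hΛ0, fun y hy z hz => ?_⟩
  have hs : segment ℝ y z ⊆ K := hKc.segment_subset hy hz
  have h1 := (convex_segment (𝕜 := ℝ) y z).norm_image_sub_le_of_norm_hasDerivWithin_le
    (𝕜 := ℂ) (f := fun w => f w - (w - y) • deriv f y) (f' := fun w => deriv f w - (1 : ℂ) • deriv f y)
    (C := Λ * ‖z - y‖) (x := y) (y := z)
    (fun w hw => by
      have d1 := (hf.differentiableAt (hU.mem_nhds (hKU (hs hw)))).hasDerivAt
      have d2 := ((hasDerivAt_id w).sub_const y).smul_const (deriv f y)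
      exact (d1.sub d2).hasDerivWithinAt)
    (fun w hw => by
      rw [one_smul]
      refine (hΛ y hy w (hs hw)).trans (mul_le_mul_of_nonneg_left ?_ hΛ0)
      have := norm_sub_le_of_mem_segment hw
      simpa [norm_sub_rev] using this)
    (left_mem_segment ℝ y z) (right_mem_segment ℝ y z)
  calc _ = ‖f z - (z - y) • deriv f y - (f y - (y - y) • deriv f y)‖ := by
        congr 1; rw [sub_self, zero_smul]; abel
    _ ≤ _ := h1
    _ = _ := by ring

end Lipschitz

/-- The points at distance at most `r` from the segment `[x, x + T]`. -/
def stadium (x : ℂ) (r T : ℝ) : Set ℂ :=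
  {z | ∃ b ∈ Metric.closedBall x r, ∃ t ∈ Set.Icc 0 T, z = b + (t : ℝ)}

lemma stadium_eq_add (x : ℂ) (r T : ℝ) :
    stadium x r T = Set.image2 (· + ·) (Metric.closedBall x r) ((fun t : ℝ => (t : ℂ)) '' Set.Icc 0 T) := by
  ext z
  simp only [stadium, Set.mem_ofPred_eq, Set.mem_image2, Set.exists_mem_image]
  constructor
  · rintro ⟨b, hb, t, ht, rfl⟩; exact ⟨b, hb, t, ht, rfl⟩
  · rintro ⟨b, hb, t, ht, rfl⟩; exact ⟨b, hb, t, ht, rfl⟩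

lemma isCompact_stadium (x : ℂ) (r T : ℝ) : IsCompact (stadium x r T) := by
  rw [stadium_eq_add]
  exact (isCompact_closedBall x r).add (isCompact_Icc.image Complex.continuous_ofReal)

lemma convex_stadium (x : ℂ) (r T : ℝ) : Convex ℝ (stadium x r T) := by
  rw [stadium_eq_add]
  exact (convex_closedBall x r).add ((convex_Icc 0 T).linear_image Complex.ofRealCLM.toLinearMap)

lemma add_mem_stadium {x b : ℂ} {r T t : ℝ} (hb : b ∈ Metric.closedBall x r) (ht : 0 ≤ t)
    (ht' : t ≤ T) : b + t ∈ stadium x r T := ⟨b, hb, t, ⟨ht, ht'⟩, rfl⟩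

lemma stadium_subset {U : Set ℂ} (hU : ∀ x ∈ U, ∀ t : ℝ, 0 ≤ t → x + t ∈ U) {x : ℂ} {r : ℝ}
    (h : Metric.closedBall x r ⊆ U) (T : ℝ) : stadium x r T ⊆ U := by
  rintro _ ⟨b, hb, t, ht, rfl⟩
  exact hU b (h hb) t ht.1

/-! ### The Euler scheme for linear differential equations -/

section Euler
variable {𝔸 : Type*} [NormedRing 𝔸] [NormedAlgebra ℂ 𝔸] [CompleteSpace 𝔸]

/-- Consistency plus stability: a step errs by `O(h²) + h ε`, there are at most `T / h` steps, and
the product of the norms stays below `exp ((KB + 1) T)`. The matrices need only agree with those of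
the Euler scheme up to `o(h)`, which covers the difference system. -/
lemma tendsto_stepProd_mul (h1 : ‖(1 : 𝔸)‖ ≤ 1) {ι : Type*} {l : Filter ι} {h : ι → ℝ} {N : ι → ℕ}
    {M : ι → ℂ → 𝔸} {u : ι → 𝔸} {B E : ℂ → 𝔸} {U : Set ℂ} (hU : IsOpen U)
    (hB : DifferentiableOn ℂ B U) (hE : ∀ z ∈ U, HasDerivAt E (B z * E z) z) {x : ℂ} {T : ℝ}
    (hT : 0 ≤ T) (hxT : stadium x 0 T ⊆ U) (hh : Tendsto h l (𝓝[>] 0))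
    (hN : ∀ᶠ i in l, N i * h i ≤ T)
    (hM : ∀ ε > 0, ∀ᶠ i in l, ∀ y ∈ stadium x 0 T, ‖M i y - (1 - (h i : ℂ) • B y)‖ ≤ h i * ε)
    (hu : Tendsto (fun i => u i - E (x + N i * h i)) l (𝓝 0)) :
    Tendsto (fun i => stepProd (M i) (h i) (N i) x * u i) l (𝓝 (E x)) := by
  have hEd : DifferentiableOn ℂ E U := fun z hz => (hE z hz).differentiableAt.differentiableWithinAt
  have hK := isCompact_stadium x 0 T
  obtain ⟨KB, hKB⟩ := hK.exists_bound_of_continuousOn (hB.continuousOn.mono hxT)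
  obtain ⟨KE, hKE⟩ := hK.exists_bound_of_continuousOn (hEd.continuousOn.mono hxT)
  obtain ⟨Λ, hΛ0, hΛ⟩ := exists_taylor_of_differentiableOn hU hEd hK (convex_stadium x 0 T) hxT
  have hmem : ∀ t : ℝ, 0 ≤ t → t ≤ T → x + t ∈ stadium x 0 T := fun t h0 h2 =>
    add_mem_stadium (Metric.mem_closedBall_self le_rfl) h0 h2
  have hKB0 : 0 ≤ KB := (norm_nonneg _).trans (hKB _ (hmem 0 le_rfl hT))
  have hKE0 : 0 ≤ KE := (norm_nonneg _).trans (hKE _ (hmem 0 le_rfl hT))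
  set G := Real.exp ((KB + 1) * T) with hG
  have hG0 : 0 < G := Real.exp_pos _
  have hpos : ∀ᶠ i in l, 0 < h i := hh.eventually self_mem_nhdsWithin
  have key : ∀ ε > 0, ε ≤ 1 → ∀ᶠ i in l, ‖stepProd (M i) (h i) (N i) x * u i - E x‖
      ≤ G * (‖u i - E (x + N i * h i)‖ + T * Λ * h i) + G * T * KE * ε := by
    intro ε hε hε1
    filter_upwards [hpos, hN, hM ε hε] with i hi hNi hMi
    have hpt : ∀ k < N i, (x + (k + 1) * h i ∈ stadium x 0 T) ∧ (x + k * h i ∈ stadium x 0 T) := by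
      intro k hk
      have hk' : ((k : ℝ) + 1) ≤ N i := by exact_mod_cast hk
      have h2 : ((k : ℝ) + 1) * h i ≤ T := (mul_le_mul_of_nonneg_right hk' hi.le).trans hNi
      have a1 := hmem (((k : ℝ) + 1) * h i) (by positivity) h2
      have a2 := hmem ((k : ℝ) * h i) (by positivity) (by nlinarith)
      push_cast at a1 a2
      exact ⟨a1, a2⟩
    have hMb : ∀ k < N i, ‖M i (x + (k + 1) * h i)‖ ≤ 1 + h i * (KB + 1) := by
      intro k hk
      have hy := (hpt k hk).1
      set y : ℂ := x + (k + 1) * h i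
      calc ‖M i y‖ = ‖(M i y - (1 - (h i : ℂ) • B y)) + (1 - (h i : ℂ) • B y)‖ := by
            rw [sub_add_cancel]
        _ ≤ h i * ε + (1 + h i * KB) := by
            refine (norm_add_le _ _).trans (add_le_add (hMi y hy) ((norm_sub_le _ _).trans
              (add_le_add h1 ?_)))
            rw [norm_smul, Complex.norm_real, Real.norm_of_nonneg hi.le]
            exact mul_le_mul_of_nonneg_left (hKB y hy) hi.le
        _ ≤ _ := by nlinarith
    have hres : ∀ k < N i, ‖E (x + k * h i) - M i (x + (k + 1) * h i) * E (x + (k + 1) * h i)‖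
        ≤ Λ * h i ^ 2 + h i * ε * KE := by
      intro k hk
      obtain ⟨hy, hy'⟩ := hpt k hk
      have e : x + k * h i = x + (k + 1) * h i - h i := by ring
      rw [e] at hy' ⊢
      set y : ℂ := x + (k + 1) * h i
      have t1 := hΛ y hy _ hy'
      rw [(hE y (hxT hy)).deriv, sub_sub_cancel_left, norm_neg, Complex.norm_real,
        Real.norm_of_nonneg hi.le] at t1
      calc _ = ‖(E (y - h i) - E y - (-(h i : ℂ)) • (B y * E y))
            - (M i y - (1 - (h i : ℂ) • B y)) * E y‖ := by
              congr 1
              rw [sub_mul, sub_mul, one_mul, smul_mul_assoc, neg_smul]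
              abel
        _ ≤ _ := by
          refine (norm_sub_le _ _).trans (add_le_add t1 ((norm_mul_le _ _).trans ?_))
          exact mul_le_mul (hMi y hy) (hKE y hy) (norm_nonneg _) (by positivity)
    have g := norm_stepProd_mul_sub_le (q := 1 + h i * (KB + 1)) (τ := Λ * h i ^ 2 + h i * ε * KE)
      (by nlinarith) (by positivity) (u i) hMb hres
    have hq : (1 + h i * (KB + 1)) ^ N i ≤ G := by
      calc _ ≤ (Real.exp (h i * (KB + 1))) ^ N i := by
            refine pow_le_pow_left₀ (by positivity) ?_ _
            linarith [Real.add_one_le_exp (h i * (KB + 1))]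
        _ = Real.exp (N i * (h i * (KB + 1))) := (Real.exp_nat_mul _ _).symm
        _ ≤ G := by
            refine Real.exp_le_exp.2 ?_
            nlinarith
    refine g.trans ?_
    have hNτ : N i * (Λ * h i ^ 2 + h i * ε * KE) ≤ T * (Λ * h i + ε * KE) := by
      have : N i * (Λ * h i ^ 2 + h i * ε * KE) = (N i * h i) * (Λ * h i + ε * KE) := by ring
      rw [this]
      exact mul_le_mul_of_nonneg_right hNi (by positivity)
    calc _ ≤ G * (‖u i - E (x + N i * h i)‖ + T * (Λ * h i + ε * KE)) :=
          mul_le_mul hq (by linarith) (by positivity) hG0.le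
      _ = _ := by ring
  rw [tendsto_iff_norm_sub_tendsto_zero, Metric.tendsto_nhds]
  intro η hη
  have hz : Tendsto (fun i => G * (‖u i - E (x + N i * h i)‖ + T * Λ * h i)) l (𝓝 0) := by
    have h0 : Tendsto h l (𝓝 0) := hh.mono_right nhdsWithin_le_nhds
    have := ((tendsto_norm_zero.comp hu).add (h0.const_mul (T * Λ))).const_mul G
    simpa using this
  have hc : 0 < G * T * KE + 1 := by positivity
  set ε := min 1 (η / (2 * (G * T * KE + 1))) with hε
  have hε0 : 0 < ε := lt_min one_pos (by positivity)
  have hε2 : G * T * KE * ε ≤ η / 2 := by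
    calc _ ≤ (G * T * KE + 1) * (η / (2 * (G * T * KE + 1))) :=
          mul_le_mul (by linarith) (min_le_right _ _) hε0.le hc.le
      _ = η / 2 := by field_simp
  filter_upwards [key ε hε0 (min_le_left _ _), hz.eventually_lt_const (half_pos hη)] with i hi hi2
  rw [Real.dist_eq, sub_zero, abs_of_nonneg (norm_nonneg _)]
  linarith

/-- The Euler product with `2^m` steps from `x + T` to `x`. -/
def eulerProd (B : ℂ → 𝔸) (T : ℝ) (m : ℕ) (x : ℂ) : 𝔸 :=
  stepProd (fun y => 1 - ((T / 2 ^ m : ℝ) : ℂ) • B y) (T / 2 ^ m) (2 ^ m) x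

/-- With `k = T / 2 ^ m`, two half steps differ from one full step by at most `k² (Λ + K²) / 4`.
Summed over `2 ^ m` steps, this error is proportional to `2 ^ (-m)`. -/
lemma exists_eulerProd_sub_le (h1 : ‖(1 : 𝔸)‖ ≤ 1) {B : ℂ → 𝔸} {U : Set ℂ} (hU : IsOpen U)
    (hB : DifferentiableOn ℂ B U) {x₀ : ℂ} {r T : ℝ} (hr : 0 ≤ r) (hT : 0 ≤ T)
    (hxT : stadium x₀ r T ⊆ U) :
    ∃ c : ℝ, ∀ m, ∀ x ∈ Metric.closedBall x₀ r,
      ‖eulerProd B T (m + 1) x - eulerProd B T m x‖ ≤ c * (1 / 2) ^ m := by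
  have hK := isCompact_stadium x₀ r T
  obtain ⟨K, hKB⟩ := hK.exists_bound_of_continuousOn (hB.continuousOn.mono hxT)
  obtain ⟨Λ, hΛ0, hΛ⟩ := exists_lipschitz_of_differentiableOn hU hB hK (convex_stadium x₀ r T) hxT
  have hK0 : 0 ≤ K := (norm_nonneg _).trans (hKB _ (add_mem_stadium (t := 0)
    (Metric.mem_closedBall_self hr) le_rfl hT))
  refine ⟨T ^ 2 * (Λ + K ^ 2) / 4 * Real.exp (K * T), fun m x hx => ?_⟩
  set k : ℝ := T / 2 ^ m with hk
  have hk0 : 0 ≤ k := by positivity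
  have hNk : (2 ^ m : ℕ) * k = T := by rw [hk]; push_cast; field_simp
  have e : eulerProd B T (m + 1) x = stepProd (fun y => (1 - ((k / 2 : ℝ) : ℂ) • B (y - (k / 2 : ℝ)))
      * (1 - ((k / 2 : ℝ) : ℂ) • B y)) k (2 ^ m) x := by
    rw [eulerProd, show T / 2 ^ (m + 1) = k / 2 by rw [hk, pow_succ]; field_simp, pow_succ',
      stepProd_half]
  rw [e, eulerProd, ← hk]
  have hpt : ∀ j : ℕ, j < 2 ^ m → (x + (j + 1) * k ∈ stadium x₀ r T) ∧
      (x + (j + 1) * k - (k / 2 : ℝ) ∈ stadium x₀ r T) := by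
    intro j hj
    have hj' : ((j : ℝ) + 1) ≤ (2 ^ m : ℕ) := by exact_mod_cast hj
    have h2 : ((j : ℝ) + 1) * k ≤ T := (mul_le_mul_of_nonneg_right hj' hk0).trans hNk.le
    have h3 : 0 ≤ (j : ℝ) * k := by positivity
    have a1 := add_mem_stadium hx (t := ((j : ℝ) + 1) * k) (by positivity) h2
    have a2 := add_mem_stadium hx (t := ((j : ℝ) + 1) * k - k / 2) (T := T) (by nlinarith) (by linarith)
    push_cast at a1 a2 ⊢
    refine ⟨a1, ?_⟩
    convert a2 using 1
    ring
  have hb : ∀ t : ℝ, 0 ≤ t → ∀ y ∈ stadium x₀ r T, ‖1 - (t : ℂ) • B y‖ ≤ Real.exp (K * t) := by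
    intro t ht y hy
    calc _ ≤ 1 + t * K := by
          refine (norm_sub_le _ _).trans (add_le_add h1 ?_)
          rw [norm_smul, Complex.norm_real, Real.norm_of_nonneg ht]
          exact mul_le_mul_of_nonneg_left (hKB y hy) ht
      _ ≤ _ := by linarith [Real.add_one_le_exp (K * t)]
  have hmain := norm_stepProd_sub_le h1 (M := fun y => 1 - (k : ℂ) • B y)
    (M' := fun y => (1 - ((k / 2 : ℝ) : ℂ) • B (y - (k / 2 : ℝ))) * (1 - ((k / 2 : ℝ) : ℂ) • B y))
    (h := k) (q := Real.exp (K * k)) (τ := k ^ 2 / 4 * (Λ + K ^ 2)) (N := 2 ^ m) (x := x)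
    (Real.one_le_exp (by positivity)) (by positivity)
    (fun j hj => hb k hk0 _ (hpt j hj).1)
    (fun j hj => by
      refine (norm_mul_le _ _).trans ((mul_le_mul (hb (k / 2) (by positivity) _ (hpt j hj).2)
        (hb (k / 2) (by positivity) _ (hpt j hj).1) (norm_nonneg _) (Real.exp_pos _).le).trans ?_)
      rw [← Real.exp_add]
      exact Real.exp_le_exp.2 (by linarith))
    (fun j hj => by
      obtain ⟨hy, hy'⟩ := hpt j hj
      set y : ℂ := x + (j + 1) * k
      set y' : ℂ := y - (k / 2 : ℝ) with hy'_def
      have hk2 : ‖((k / 2 : ℝ) : ℂ)‖ = k / 2 := by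
        rw [Complex.norm_real, Real.norm_of_nonneg (by positivity)]
      have e2 : (1 - ((k / 2 : ℝ) : ℂ) • B y') * (1 - ((k / 2 : ℝ) : ℂ) • B y) - (1 - (k : ℂ) • B y)
          = ((k / 2 : ℝ) : ℂ) • (B y - B y') + ((k / 2 : ℝ) : ℂ) • ((k / 2 : ℝ) : ℂ) • (B y' * B y) := by
        have e3 : (k : ℂ) = (k / 2 : ℝ) + (k / 2 : ℝ) := by push_cast; ring
        rw [e3, add_smul, sub_mul, one_mul, mul_sub, mul_one, smul_mul_assoc, mul_smul_comm, smul_sub]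
        abel
      rw [e2]
      have l1 := hΛ y' hy' y hy
      rw [hy'_def, sub_sub_cancel, hk2] at l1
      calc _ ≤ k / 2 * (Λ * (k / 2)) + k / 2 * (k / 2 * (K * K)) := by
            refine (norm_add_le _ _).trans (add_le_add ?_ ?_)
            · rw [norm_smul, hk2]
              exact mul_le_mul_of_nonneg_left l1 (by positivity)
            · rw [norm_smul, norm_smul, hk2]
              refine mul_le_mul_of_nonneg_left (mul_le_mul_of_nonneg_left ?_ (by positivity))
                (by positivity)
              exact (norm_mul_le _ _).trans (mul_le_mul (hKB _ hy') (hKB _ hy) (norm_nonneg _) hK0)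
        _ = _ := by ring)
  refine hmain.trans (le_of_eq ?_)
  rw [← Real.exp_nat_mul]
  have e4 : ((2 ^ m : ℕ) : ℝ) * (K * k) = K * T := by rw [← hNk]; ring
  rw [e4]
  have e5 : ((2 ^ m : ℕ) : ℝ) * (k ^ 2 / 4 * (Λ + K ^ 2)) = T * k * (Λ + K ^ 2) / 4 := by
    rw [← hNk]; ring
  rw [e5, hk, one_div, inv_pow]
  field_simp

/-- The dyadic products form a locally uniformly convergent telescoping series of holomorphic
functions. The limit `W` plays the part of the resolvent from `x + T` to `x`. -/
lemma exists_eulerProd_limit (h1 : ‖(1 : 𝔸)‖ ≤ 1) {B : ℂ → 𝔸} {U : Set ℂ} (hU : IsOpen U)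
    (hUt : ∀ x ∈ U, ∀ t : ℝ, 0 ≤ t → x + t ∈ U) (hB : DifferentiableOn ℂ B U) {T : ℝ} (hT : 0 ≤ T) :
    ∃ W : ℂ → 𝔸, DifferentiableOn ℂ W U ∧
      ∀ x ∈ U, Tendsto (fun m => eulerProd B T m x) atTop (𝓝 (W x)) := by
  have hp : ∀ m, DifferentiableOn ℂ (eulerProd B T m) U := fun m =>
    differentiableOn_stepProd (M := fun y => 1 - ((T / 2 ^ m : ℝ) : ℂ) • B y) (h := T / 2 ^ m)
      (by positivity) hUt ((differentiableOn_const _).sub (hB.fun_const_smul _)) (2 ^ m)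
  set W : ℂ → 𝔸 := fun x => eulerProd B T 0 x + ∑' m, (eulerProd B T (m + 1) x - eulerProd B T m x)
    with hW
  have hs : ∀ c : ℝ, Summable fun m : ℕ => c * (1 / 2 : ℝ) ^ m := fun c =>
    summable_geometric_two.mul_left c
  have hball : ∀ x ∈ U, ∃ r > 0, Metric.closedBall x r ⊆ U := fun x hx =>
    (Metric.nhds_basis_closedBall.mem_iff).1 (hU.mem_nhds hx)
  refine ⟨W, fun x hx => ?_, fun x hx => ?_⟩
  · obtain ⟨r, hr, hrU⟩ := hball x hx
    obtain ⟨c, hc⟩ := exists_eulerProd_sub_le h1 hU hB hr.le hT (stadium_subset hUt hrU T)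
    have hsub : Metric.ball x r ⊆ U := Metric.ball_subset_closedBall.trans hrU
    have hd := Complex.differentiableOn_tsum_of_summable_norm (hs c)
      (F := fun m x => eulerProd B T (m + 1) x - eulerProd B T m x)
      (fun m => ((hp (m + 1)).sub (hp m)).mono hsub) Metric.isOpen_ball
      (fun m y hy => hc m y (Metric.ball_subset_closedBall hy))
    exact ((((hp 0).mono hsub).add hd).differentiableAt
      (Metric.ball_mem_nhds x hr)).differentiableWithinAt
  · obtain ⟨r, hr, hrU⟩ := hball x hx
    obtain ⟨c, hc⟩ := exists_eulerProd_sub_le h1 hU hB hr.le hT (stadium_subset hUt hrU T)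
    have hsum : Summable fun m => eulerProd B T (m + 1) x - eulerProd B T m x :=
      Summable.of_norm_bounded (hs c) fun m => hc m x (Metric.mem_closedBall_self hr.le)
    have := (hsum.hasSum.tendsto_sum_nat).const_add (eulerProd B T 0 x)
    refine this.congr fun m => ?_
    rw [Finset.sum_range_sub (fun m => eulerProd B T m x)]
    abel

lemma isPreconnected_of_forall_add {U : Set ℂ} (hUt : ∀ x ∈ U, ∀ t : ℝ, 0 ≤ t → x + t ∈ U) {R : ℝ}
    (hR : {z : ℂ | R < z.re} ⊆ U) : IsPreconnected U := by
  have hH : IsPreconnected {z : ℂ | R < z.re} := (convex_halfSpace_re_gt R).isPreconnected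
  refine isPreconnected_of_forall ((R + 1 : ℝ) : ℂ) fun y hy => ?_
  refine ⟨(fun t : ℝ => y + t) '' Set.Ici 0 ∪ {z : ℂ | R < z.re}, ?_, Or.inr ?_, Or.inl ?_, ?_⟩
  · rintro _ (⟨t, ht, rfl⟩ | hz)
    · exact hUt y hy t ht
    · exact hR hz
  · show R < (((R + 1 : ℝ) : ℂ)).re
    rw [Complex.ofReal_re]; linarith
  · exact ⟨0, le_refl (0 : ℝ), by simp⟩
  · refine IsPreconnected.union (y + (max 0 (R + 1 - y.re) : ℝ)) ⟨_, Set.mem_Ici.2 (le_max_left _ _), rfl⟩ ?_ ?_ hH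
    · show R < (y + ((max 0 (R + 1 - y.re) : ℝ) : ℂ)).re
      rw [Complex.add_re, Complex.ofReal_re]
      linarith [le_max_right 0 (R + 1 - y.re)]
    · exact isPreconnected_Ici.image _ (by fun_prop)

/-- Analytic continuation, to the left, of a solution of a linear differential equation. -/
lemma exists_continuation (h1 : ‖(1 : 𝔸)‖ ≤ 1) {B E₀ : ℂ → 𝔸} {U : Set ℂ} (hU : IsOpen U)
    (hUt : ∀ x ∈ U, ∀ t : ℝ, 0 ≤ t → x + t ∈ U) (hB : DifferentiableOn ℂ B U) {R : ℝ}
    (hR : {z : ℂ | R < z.re} ⊆ U) (hE₀ : ∀ z : ℂ, R < z.re → HasDerivAt E₀ (B z * E₀ z) z) :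
    ∃ E : ℂ → 𝔸, DifferentiableOn ℂ E U ∧ ∀ z : ℂ, R < z.re → E z = E₀ z := by
  have hHo : IsOpen {z : ℂ | R < z.re} := isOpen_lt continuous_const Complex.continuous_re
  choose W hWd hW using fun N : ℕ => exists_eulerProd_limit h1 hU hUt hB (T := N) N.cast_nonneg
  set V : ℕ → Set ℂ := fun N => {z ∈ U | R < z.re + N} with hV
  have hVo : ∀ N, IsOpen (V N) := fun N =>
    hU.inter (isOpen_lt continuous_const (Complex.continuous_re.add_const _))
  have hVR : ∀ N, {z : ℂ | R < z.re} ⊆ V N := fun N z hz =>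
    ⟨hR hz, lt_of_lt_of_le hz (le_add_of_nonneg_right N.cast_nonneg)⟩
  have hVc : ∀ N, IsPreconnected (V N) := fun N =>
    isPreconnected_of_forall_add (fun z hz t ht => ⟨hUt z hz.1 t ht, by
      rw [Complex.add_re, Complex.ofReal_re]; linarith [hz.2]⟩) (hVR N)
  -- `F N` transports the solution over the distance `N`. It equals `E₀` on the half-plane, by
  -- convergence of the Euler scheme there, so the `F N` agree on the connected sets `V N`, which
  -- exhaust `U`.
  set F : ℕ → ℂ → 𝔸 := fun N z => W N z * E₀ (z + N) with hF
  have hFd : ∀ N, DifferentiableOn ℂ (F N) (V N) := fun N z hz => by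
    have d1 := (hWd N).differentiableAt (hU.mem_nhds hz.1)
    have d2 : DifferentiableAt ℂ (fun z : ℂ => E₀ (z + N)) z :=
      DifferentiableAt.comp z (hE₀ (z + N) (by simpa using hz.2)).differentiableAt
        (differentiableAt_id.add_const _)
    exact (d1.mul d2).differentiableWithinAt
  have hF0 : ∀ N, ∀ z : ℂ, R < z.re → F N z = E₀ z := by
    intro N z hz
    have hst : stadium z 0 N ⊆ {z : ℂ | R < z.re} := by
      rintro _ ⟨b, hb, t, ht, rfl⟩
      rw [Metric.closedBall_zero, Set.mem_singleton_iff] at hb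
      show R < (b + (t : ℂ)).re
      rw [hb, Complex.add_re, Complex.ofReal_re]
      linarith [ht.1]
    rcases Nat.eq_zero_or_pos N with rfl | hNpos
    · have h2 := hW 0 z (hR hz)
      have h3 : ∀ m, eulerProd B ((0 : ℕ) : ℝ) m z = 1 := by
        intro m
        have : ∀ k x, stepProd (fun _ : ℂ => (1 : 𝔸)) 0 k x = 1 := by
          intro k
          induction k with
          | zero => intro x; rfl
          | succ k ih => intro x; rw [stepProd, ih, one_mul]
        simp [eulerProd, this]
      simp only [h3] at h2
      rw [hF]
      simp only [tendsto_nhds_unique h2 tendsto_const_nhds, one_mul, Nat.cast_zero, add_zero]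
    · have hN0 : (0 : ℝ) < N := by exact_mod_cast hNpos
      have hlim : Tendsto (fun m : ℕ => (N : ℝ) / 2 ^ m) atTop (𝓝[>] 0) := by
        refine tendsto_nhdsWithin_iff.2 ⟨?_, Eventually.of_forall fun m => ?_⟩
        · exact tendsto_const_nhds.div_atTop (tendsto_pow_atTop_atTop_of_one_lt one_lt_two)
        · show 0 < (N : ℝ) / 2 ^ m
          positivity
      have hmul : ∀ m : ℕ, ((2 ^ m : ℕ) : ℝ) * ((N : ℝ) / 2 ^ m) = N := fun m => by
        push_cast; field_simp
      have h2 := tendsto_stepProd_mul h1 (l := atTop) (h := fun m : ℕ => (N : ℝ) / 2 ^ m)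
        (N := fun m => 2 ^ m) (M := fun m y => 1 - (((N : ℝ) / 2 ^ m : ℝ) : ℂ) • B y)
        (u := fun _ => E₀ (z + N)) hHo (hB.mono hR) hE₀ (x := z) (T := N) N.cast_nonneg hst
        hlim (Eventually.of_forall fun m => (hmul m).le)
        (fun ε hε => Eventually.of_forall fun m y _ => by
          rw [sub_self, norm_zero]; positivity)
        (tendsto_const_nhds.congr fun m => by
          have h3 : (((2 ^ m : ℕ) : ℂ) * (((N : ℝ) / 2 ^ m : ℝ) : ℂ)) = N := by
            rw [← Complex.ofReal_natCast, ← Complex.ofReal_mul, hmul, Complex.ofReal_natCast]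
          rw [h3, sub_self])
      exact tendsto_nhds_unique ((hW N z (hR hz)).mul_const _) h2
  have hagree : ∀ N M : ℕ, N ≤ M → ∀ z ∈ V N, F N z = F M z := by
    intro N M hNM
    have hsub : V N ⊆ V M := fun z hz => ⟨hz.1, lt_of_lt_of_le hz.2 (by
      have : (N : ℝ) ≤ M := by exact_mod_cast hNM
      linarith)⟩
    have hz0 : ((R + 1 : ℝ) : ℂ) ∈ {z : ℂ | R < z.re} := by
      show R < (((R + 1 : ℝ) : ℂ)).re
      rw [Complex.ofReal_re]; linarith
    refine ((hFd N).analyticOnNhd (hVo N)).eqOn_of_preconnected_of_eventuallyEq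
      (((hFd M).mono hsub).analyticOnNhd (hVo N)) (hVc N) (hVR N hz0) ?_
    filter_upwards [hHo.mem_nhds hz0] with w hw
    rw [hF0 N w hw, hF0 M w hw]
  have hex : ∀ z : ℂ, ∃ N : ℕ, R < z.re + N := fun z => by
    obtain ⟨N, hN⟩ := exists_nat_gt (R - z.re)
    exact ⟨N, by linarith⟩
  choose ν hν using hex
  have hE : ∀ M : ℕ, ∀ z ∈ V M, F (ν z) z = F M z := by
    intro M z hz
    rcases le_total (ν z) M with h2 | h2
    · exact hagree _ _ h2 z ⟨hz.1, hν z⟩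
    · exact (hagree _ _ h2 z hz).symm
  refine ⟨fun z => F (ν z) z, fun z hz => ?_, fun z hz => hF0 _ z hz⟩
  have hz' : z ∈ V (ν z) := ⟨hz, hν z⟩
  have d := (hFd (ν z)).differentiableAt ((hVo _).mem_nhds hz')
  refine (d.congr_of_eventuallyEq ?_).differentiableWithinAt
  filter_upwards [(hVo (ν z)).mem_nhds hz'] with w hw
  exact hE _ w hw

end Euler

section MatrixNorm
attribute [local instance] Matrix.linftyOpNormedRing Matrix.linftyOpNormedAlgebra

/-! ### Matrix-valued functions -/

/-- The hypotheses bound entries, while the Banach algebra norm is the maximal row sum; the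
comparison costs a factor `n`. -/
lemma norm_mat_le {n : ℕ} {A : Mat n} {c : ℝ} (hc : 0 ≤ c) (hA : ∀ i j, ‖A i j‖ ≤ c) :
    ‖A‖ ≤ n * c := by
  rw [Matrix.linfty_opNorm_def]
  have hc' : (0 : ℝ) ≤ n * c := by positivity
  lift (n * c : ℝ) to NNReal using hc' with d hd
  rw [NNReal.coe_le_coe]
  refine Finset.sup_le fun i _ => ?_
  rw [← NNReal.coe_le_coe, hd]
  push_cast
  refine (Finset.sum_le_sum fun j _ => hA i j).trans (le_of_eq ?_)
  simp

lemma norm_one_mat_le (n : ℕ) : ‖(1 : Mat n)‖ ≤ 1 := by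
  rcases Nat.eq_zero_or_pos n with rfl | hn
  · rw [Subsingleton.elim (1 : Mat 0) 0, norm_zero]; exact zero_le_one
  · have : Nonempty (Fin n) := ⟨⟨0, hn⟩⟩
    exact (norm_one).le

lemma hasDerivAt_mat_iff {n : ℕ} {F : ℂ → Mat n} {F' : Mat n} {x : ℂ} :
    HasDerivAt F F' x ↔ ∀ i j, HasDerivAt (fun z => F z i j) (F' i j) x := by
  refine ⟨fun h i j => ?_, fun h => ?_⟩
  · exact ((Matrix.entryLinearMap ℂ ℂ i j).toContinuousLinearMap.hasFDerivAt).comp_hasDerivAt x h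
  · have h1 : ∀ A : Mat n, A = ∑ i, ∑ j, A i j • Matrix.single i j (1 : ℂ) := fun A => by
      conv_lhs => rw [Matrix.matrix_eq_sum_single A]
      simp
    rw [h1 F', funext fun z => h1 (F z)]
    exact HasDerivAt.fun_sum fun i _ => HasDerivAt.fun_sum fun j _ => (h i j).smul_const _

lemma differentiableAt_mat_iff {n : ℕ} {F : ℂ → Mat n} {x : ℂ} :
    DifferentiableAt ℂ F x ↔ ∀ i j, DifferentiableAt ℂ (fun z => F z i j) x := by
  refine ⟨fun h i j => (hasDerivAt_mat_iff.1 h.hasDerivAt i j).differentiableAt, fun h => ?_⟩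
  exact (hasDerivAt_mat_iff (F' := Matrix.of fun i j => deriv (fun z => F z i j) x).2
    fun i j => (h i j).hasDerivAt).differentiableAt

lemma summable_norm_mat {n : ℕ} {f : ℕ → Mat n} (hf : Summable f) : Summable fun s => ‖f s‖ := by
  have h1 : ∀ i j, Summable fun s => ‖f s i j‖ := fun i j =>
    (Pi.summable.1 (Pi.summable.1 hf i) j).norm
  refine Summable.of_nonneg_of_le (fun _ => norm_nonneg _) (fun s => ?_)
    ((summable_sum (s := Finset.univ) fun i _ => summable_sum (s := Finset.univ) fun j _ =>
      h1 i j).mul_left (n : ℝ))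
  refine norm_mat_le (by positivity) fun i j => ?_
  refine le_trans ?_ (Finset.single_le_sum (f := fun i => ∑ j, ‖f s i j‖)
    (fun _ _ => by positivity) (Finset.mem_univ i))
  exact Finset.single_le_sum (f := fun j => ‖f s i j‖) (fun _ _ => norm_nonneg _) (Finset.mem_univ j)

lemma wtSummable_of_summable {n : ℕ} {h ξ : ℝ} (hh : 0 ≤ h) (hξ : 0 < ξ) {f : ℕ → Mat n}
    (hf : Summable fun s => factTerm h s ξ • f s) : WtSummable h ξ f := by
  refine (summable_norm_mat hf).congr fun s => ?_
  rw [norm_smul, factTerm_ofReal, Complex.norm_real, Real.norm_of_nonneg (wt_pos hh hξ s).le]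

lemma HasFactorialExpansion.exists_wtSummable {n : ℕ} {h : ℝ} (hh : 0 ≤ h) {a : ℕ → Mat n}
    {f : ℂ → Mat n} (hf : HasFactorialExpansion h a f) :
    ∃ X : ℝ, ∀ ξ, X < ξ → WtSummable h ξ a ∧ ∀ z : ℂ, ξ ≤ z.re → f z = factSum h a z := by
  obtain ⟨M, hM⟩ := hf
  refine ⟨max M 0, fun ξ hξ => ?_⟩
  have hξ0 : 0 < ξ := (le_max_right _ _).trans_lt hξ
  have hξM : M < ξ := (le_max_left _ _).trans_lt hξ
  have h1 := wtSummable_of_summable hh hξ0 (hM ξ (by simpa using hξM)).summable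
  exact ⟨h1, fun z hz => (hM z (hξM.trans_le hz)).unique (h1.hasSum (IsFar.of_re hz) hh hξ0)⟩

lemma WtSummable.hasFactorialExpansion {n : ℕ} {h ξ : ℝ} (hh : 0 ≤ h) (hξ : 0 < ξ) {a : ℕ → Mat n}
    (ha : WtSummable h ξ a) : HasFactorialExpansion h a (factSum h a) :=
  ⟨ξ, fun _ hx => ha.hasSum (IsFar.of_re (le_of_lt hx)) hh hξ⟩

/-! ### Systems of bounded type -/

/-- The coefficients are dominated by those of the expansion of `C / (x - lam)`. -/
def TypeBound {n : ℕ} (h C lam : ℝ) (a : ℕ → Mat n) : Prop :=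
  ∀ s : ℕ, 1 ≤ s → ∀ i j, ‖a s i j‖ ≤ C * risingFact h (s - 1) lam

/-- The majorant `∑ lam^{[k]_h} ξ^{-[k+1]_h}` sums exactly to `1 / (ξ - lam)`, which is independent
of `h` and small for `ξ` large. -/
lemma TypeBound.sum_le {n : ℕ} {h C lam ξ : ℝ} (hh : 0 ≤ h) (hC : 0 ≤ C) (hlam : 0 ≤ lam)
    (hξ : lam < ξ) {a : ℕ → Mat n} (ha : TypeBound h C lam a) (N : ℕ) :
    ∑ i ∈ Finset.Icc 1 N, wt h ξ i * ‖a i‖ ≤ n * C / (ξ - lam) := by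
  have hξ0 : 0 < ξ := hlam.trans_lt hξ
  have h1 := hasSum_risingFact_mul_factTerm (z := (ξ : ℂ)) (IsFar.of_re (h := h) (ξ := ξ) (by simp))
    hh hξ0 0 hlam (by simpa using hξ)
  simp only [factTerm_ofReal] at h1
  have h2 : HasSum (fun k => risingFact h k lam * wt h ξ (0 + k + 1)) (wt h ξ 0 * (ξ + (0 : ℕ) * h - lam)⁻¹) := by
    exact_mod_cast h1
  have h3 := h2.mul_left (n * C : ℝ)
  have e : ∀ g : ℕ → ℝ, ∑ i ∈ Finset.Icc 1 N, g i = ∑ k ∈ Finset.range N, g (k + 1) := by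
    intro g
    rw [Finset.range_eq_Ico, Finset.sum_Ico_add' g 0 N 1]
    rfl
  have nn : ∀ k, 0 ≤ risingFact h k lam := fun k => risingFact_nonneg hh hlam k
  have h4 : ∑ i ∈ Finset.Icc 1 N, wt h ξ i * ‖a i‖
      ≤ ∑ k ∈ Finset.range N, n * C * (risingFact h k lam * wt h ξ (0 + k + 1)) := by
    rw [e]
    refine Finset.sum_le_sum fun k _ => ?_
    have h5 := norm_mat_le (mul_nonneg hC (nn k)) (ha (k + 1) (Nat.succ_pos k))
    calc _ ≤ wt h ξ (k + 1) * (n * (C * risingFact h k lam)) :=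
          mul_le_mul_of_nonneg_left h5 (wt_pos hh hξ0 _).le
      _ = _ := by rw [zero_add]; ring
  refine h4.trans ((sum_le_hasSum _ (fun k _ => mul_nonneg (by positivity)
    (mul_nonneg (nn k) (wt_pos hh hξ0 _).le)) h3).trans (le_of_eq ?_))
  rw [wt_zero]
  simp [div_eq_mul_inv]

lemma TypeBound.wtSummable {n : ℕ} {h C lam ξ : ℝ} (hh : 0 ≤ h) (hC : 0 ≤ C) (hlam : 0 ≤ lam)
    (hξ : lam < ξ) {a : ℕ → Mat n} (ha : TypeBound h C lam a) : WtSummable h ξ a := by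
  have hξ0 : 0 < ξ := hlam.trans_lt hξ
  refine (summable_nat_add_iff 1).1 (summable_of_sum_range_le (c := n * C / (ξ - lam))
    (fun k => mul_nonneg (wt_pos hh hξ0 _).le (norm_nonneg _)) fun N => ?_)
  refine le_trans (le_of_eq ?_) (ha.sum_le hh hC hlam hξ N)
  rw [Finset.range_eq_Ico, Finset.sum_Ico_add' (fun i => wt h ξ i * ‖a i‖) 0 N 1]
  rfl

/-- Convergence of the normalizing gauge transformation, uniformly in the step. -/
lemma exists_uniform_wtSummable {n : ℕ} {C lam B K : ℝ} (hC : 0 ≤ C) (hlam : 0 ≤ lam) (hB : 0 ≤ B)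
    (hK0 : 0 ≤ K) : ∃ ξ : ℝ, 2 ≤ ξ ∧ ∀ h : ℝ, 0 ≤ h → h ≤ 1 → ∀ a f : ℕ → Mat n,
      TypeBound h C lam a → ‖a 0‖ ≤ B → SylvesterBound K (a 0) → IsGaugeCoef h a f →
        WtSummable h ξ a ∧ WtSummable h ξ f ∧ (WtSummable h ξ fun s => (s : ℂ) • f s) ∧
          ∀ r, wt h ξ r * ‖f r‖ ≤ 2 := by
  have p1 : 0 ≤ K * (n * C) := by positivity
  have p2 : 0 ≤ K * B := by positivity
  -- Each of the two terms of the smallness condition of `IsGaugeCoef.sum_le` becomes at most `1 /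
  -- 4`; the summand `2` leaves room for `h ≤ 1`.
  set ξ := lam + 2 + 4 * (K * (n * C)) + 4 * (K * B) with hξ
  refine ⟨ξ, by linarith, fun h hh hh1 a f ha ha0 hK hf => ?_⟩
  have hlamξ : lam < ξ := by linarith
  have hhξ : h < ξ := by linarith
  have hξ0 : 0 < ξ := by linarith
  have hsmall : K * (n * C / (ξ - lam) + h * ‖a 0‖ * (ξ - h)⁻¹) ≤ 1 / 2 := by
    have q1 : K * (n * C / (ξ - lam)) ≤ 1 / 4 := by
      rw [← mul_div_assoc, div_le_iff₀ (by linarith)]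
      linarith
    have q2 : K * (h * ‖a 0‖ * (ξ - h)⁻¹) ≤ 1 / 4 := by
      rw [← mul_assoc, ← div_eq_mul_inv, div_le_iff₀ (by linarith)]
      have : h * ‖a 0‖ ≤ 1 * B := mul_le_mul hh1 ha0 (norm_nonneg _) zero_le_one
      have := mul_le_mul_of_nonneg_left this hK0
      linarith
    rw [mul_add]
    linarith
  have h1 := hf.sum_le hh hhξ hK0 hK (ha.sum_le hh hC hlam hlamξ) hsmall
  have h2 := wtSummable_of_sum_le hh hξ0 h1
  refine ⟨ha.wtSummable hh hC hlam hlamξ, h2.1, h2.2.1, fun r => (h2.2.2 r).trans ?_⟩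
  have := norm_one_mat_le n
  linarith

/-! ### The normalizing gauge transformation -/

lemma sub_ofReal_ne_zero {h : ℝ} {x : ℂ} (hx : h < x.re) : x - h ≠ 0 := by
  intro h1
  have := congrArg Complex.re h1
  simp at this
  linarith

lemma gaugeTransform_eq_iff {n : ℕ} {h : ℝ} (hh : 0 < h) {A F : ℂ → Mat n} {A₀ : Mat n} {x : ℂ}
    (hx : h < x.re) {G : Mat n} (hG : F (x - h) * G = 1) :
    gaugeTransform h A F x = A₀ ↔
      F (x - h) * (1 - ((h : ℂ) / (x - h)) • A₀) = (1 - ((h : ℂ) / (x - h)) • A x) * F x := by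
  have hdet : IsUnit (F (x - h)).det := Matrix.isUnit_det_of_right_inverse hG
  have h0 : (h : ℂ) ≠ 0 := by exact_mod_cast hh.ne'
  have hxh := sub_ofReal_ne_zero hx
  set t : ℂ := h / (x - h) with ht
  have ht0 : t ≠ 0 := div_ne_zero h0 hxh
  have e : (x - h) / h = t⁻¹ := by rw [ht, inv_div]
  rw [gaugeTransform, e, inv_smul_eq_iff₀ ht0, sub_eq_iff_eq_add', ← sub_eq_iff_eq_add, mul_assoc]
  constructor
  · intro h1
    rw [h1, ← mul_assoc, Matrix.mul_nonsing_inv _ hdet, one_mul]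
  · intro h1
    rw [← h1, ← mul_assoc, Matrix.nonsing_inv_mul _ hdet, one_mul]

/-- The two forms of the gauge equation. -/
lemma gauge_equation_iff {𝔸 : Type*} [Ring 𝔸] [Algebra ℂ 𝔸] {t : ℂ} (ht : t ≠ 0)
    {F F' D A A₀ : 𝔸} (hF : F' = F + t • D) :
    F' * (1 - t • A₀) = (1 - t • A) * F ↔ t • (D * A₀) - D - A * F + F * A₀ = 0 := by
  have e : F' * (1 - t • A₀) - (1 - t • A) * F = -(t • (t • (D * A₀) - D - A * F + F * A₀)) := by
    rw [hF]
    simp only [add_mul, mul_sub, sub_mul, mul_one, one_mul, smul_mul_assoc, mul_smul_comm, smul_sub,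
      smul_add]
    abel
  rw [← sub_eq_zero, e, neg_eq_zero, smul_eq_zero_iff_right ht]

lemma isNormalizingGauge_factSum {n : ℕ} {h ξ : ℝ} (hh : 0 < h) (hξ : h < ξ) {a f : ℕ → Mat n}
    {A : ℂ → Mat n} (hA : HasFactorialExpansion h a A) (hg : IsGaugeCoef h a f)
    (ha : WtSummable h ξ a) (hf : WtSummable h ξ f) (hf' : WtSummable h ξ fun s => (s : ℂ) • f s) :
    IsNormalizingGauge h A (a 0) (factSum h f) := by
  have hξ0 : 0 < ξ := hh.trans hξ
  obtain ⟨g, ξ', hξξ', hgs, hinv⟩ := exists_factSum_inverse hh.le hξ0 hg.1 hf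
  obtain ⟨X, hX⟩ := hA.exists_wtSummable hh.le
  refine ⟨⟨f, hg.1, hf.hasFactorialExpansion hh.le hξ0⟩, ⟨g, factSum h g,
    hgs.hasFactorialExpansion hh.le (hξ0.trans_le hξξ'), ξ', fun x hx => hinv x (IsFar.of_re hx.le)⟩,
    max (ξ' + h) (X + 1), fun x hx => ?_⟩
  have hx1 : ξ' + h < x.re := (le_max_left _ _).trans_lt hx
  have hx2 : X + 1 < x.re := (le_max_right _ _).trans_lt hx
  have hre : (x - h).re = x.re - h := by simp
  have hfar : IsFar h ξ x := IsFar.of_re (by linarith)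
  have hfar' : IsFar h ξ (x - h) := IsFar.of_re (by rw [hre]; linarith)
  have hh' : h < x.re := by linarith
  rw [gaugeTransform_eq_iff hh hh' (hinv (x - h) (IsFar.of_re (by rw [hre]; linarith))),
    gauge_equation_iff (div_ne_zero (by exact_mod_cast hh.ne') (sub_ofReal_ne_zero hh'))
      (factSum_sub_factSum hh.le hξ0 hf hfar hfar'), (hX (X + 1) (by linarith)).2 x hx2.le]
  exact hg.factSum_eq hh.le hξ ha hf hf' hfar

/-- The coefficients of any normalizing gauge satisfy the recurrence, whose solution is unique. -/
lemma IsNormalizingGauge.eq_factSum {n : ℕ} {h K : ℝ} (hh : 0 < h) {a f : ℕ → Mat n}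
    {A F : ℂ → Mat n} (hK : SylvesterBound K (a 0)) (hA : HasFactorialExpansion h a A)
    (hg : IsGaugeCoef h a f) (hF : IsNormalizingGauge h A (a 0) F) :
    ∃ X : ℝ, ∀ x : ℂ, X < x.re → F x = factSum h f x := by
  obtain ⟨⟨f', hf'0, hf'⟩, ⟨-, G, -, M, hG⟩, M', hM'⟩ := hF
  obtain ⟨X, hX⟩ := hA.exists_wtSummable hh.le
  obtain ⟨X', hX'⟩ := hf'.exists_wtSummable hh.le
  obtain ⟨ξ, hξ⟩ := exists_gt (max (max X X') (max (max M M') (2 * h)))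
  simp only [max_lt_iff] at hξ
  obtain ⟨⟨b1, b2⟩, ⟨b3, b4⟩, b5⟩ := hξ
  have hξ0 : 0 < ξ := by linarith
  have hfs := (hX' ξ b2).1
  have hle : ξ ≤ ξ + h + 1 := by linarith
  have hgc : IsGaugeCoef h a f' := by
    refine isGaugeCoef_of_factSum_eq (X := ξ + h + 1) (ξ := ξ + h + 1) hh.le (by linarith) hf'0
      ((hX ξ b1).1.mono hh.le hξ0 hle) (hfs.mono hh.le hξ0 hle) (hfs.natCast_smul hh.le hξ0)
      fun x hx => ?_
    have hre : ((x : ℂ) - h).re = x - h := by simp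
    have hre' : (x : ℂ).re = x := Complex.ofReal_re x
    have hh' : h < (x : ℂ).re := by linarith
    have e1 := (gaugeTransform_eq_iff hh hh' (hG ((x : ℂ) - h) (by linarith))).1
      (hM' x (by linarith))
    rw [(hX' ξ b2).2 x (by linarith), (hX' ξ b2).2 (x - h) (by linarith),
      (hX ξ b1).2 x (by linarith), gauge_equation_iff
        (div_ne_zero (by exact_mod_cast hh.ne') (sub_ofReal_ne_zero hh'))
        (factSum_sub_factSum hh.le hξ0 hfs (IsFar.of_re (by linarith))
        (IsFar.of_re (by linarith)))] at e1
    exact e1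
  rw [hg.unique hK hgc]
  exact ⟨ξ, fun x hx => (hX' ξ b2).2 x hx.le⟩

end MatrixNorm

/-! ### Rational matrices and the cut plane -/

lemma finite_isPole {n : ℕ} (L : RatMat n) : {p | IsPole L p}.Finite := by
  have h1 : {p | IsPole L p} = ⋃ i, ⋃ j, {p | (L i j).denom.IsRoot p} := by
    ext p; simp [IsPole]
  rw [h1]
  exact Set.finite_iUnion fun i => Set.finite_iUnion fun j =>
    Polynomial.finite_setOfPred_isRoot (L i j).denom_ne_zero

lemma analyticAt_evalMat {n : ℕ} (L : RatMat n) {z : ℂ} (hz : ¬ IsPole L z) (i j : Fin n) :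
    AnalyticAt ℂ (fun z => evalMat L z i j) z := by
  have hd : ((L i j).denom).eval z ≠ 0 := fun h => hz ⟨i, j, h⟩
  have h1 : (fun z => evalMat L z i j) = fun z => (L i j).num.eval z / (L i j).denom.eval z := by
    funext z
    simp [evalMat, RatFunc.eval, Polynomial.eval₂_eq_eval_map]
  rw [h1]
  exact (AnalyticOnNhd.eval_polynomial _ z trivial).div (AnalyticOnNhd.eval_polynomial _ z trivial) hd

lemma meromorphicAt_evalMat {n : ℕ} (L : RatMat n) (z : ℂ) (i j : Fin n) :
    MeromorphicAt (fun z => evalMat L z i j) z := by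
  have h1 : (fun z => evalMat L z i j) = fun z => (L i j).num.eval z / (L i j).denom.eval z := by
    funext z
    simp [evalMat, RatFunc.eval, Polynomial.eval₂_eq_eval_map]
  rw [h1]
  exact (AnalyticOnNhd.eval_polynomial _ z trivial).meromorphicAt.div
    (AnalyticOnNhd.eval_polynomial _ z trivial).meromorphicAt

lemma cutPlane_eq {n : ℕ} (L : RatMat n) :
    cutPlane L = ⋂ p ∈ insert 0 {p | IsPole L p}, {x : ℂ | ¬ (x.im = p.im ∧ x.re ≤ p.re)} := by
  ext x
  simp [cutPlane]

lemma isOpen_cutPlane {n : ℕ} (L : RatMat n) : IsOpen (cutPlane L) := by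
  rw [cutPlane_eq]
  refine ((finite_isPole L).insert 0).isOpen_biInter fun p _ => ?_
  have : IsClosed {x : ℂ | x.im = p.im ∧ x.re ≤ p.re} :=
    (isClosed_eq Complex.continuous_im continuous_const).inter
      (isClosed_le Complex.continuous_re continuous_const)
  exact this.isOpen_compl

lemma add_mem_cutPlane {n : ℕ} {L : RatMat n} {x : ℂ} (hx : x ∈ cutPlane L) {t : ℝ} (ht : 0 ≤ t) :
    x + t ∈ cutPlane L := fun p hp h => hx p hp ⟨by simpa using h.1, by
  have := h.2
  simp at this
  linarith⟩

lemma not_isPole_of_mem_cutPlane {n : ℕ} {L : RatMat n} {x : ℂ} (hx : x ∈ cutPlane L) :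
    ¬ IsPole L x := fun h => hx x (Or.inr h) ⟨rfl, le_rfl⟩

lemma ne_zero_of_mem_cutPlane {n : ℕ} {L : RatMat n} {x : ℂ} (hx : x ∈ cutPlane L) : x ≠ 0 :=
  fun h => hx 0 (Or.inl rfl) (by simp [h])

lemma exists_halfPlane_subset_cutPlane {n : ℕ} (L : RatMat n) :
    ∃ R : ℝ, {z : ℂ | R < z.re} ⊆ cutPlane L := by
  obtain ⟨R, hR⟩ := (((finite_isPole L).insert 0).image Complex.re).bddAbove
  refine ⟨R, fun z hz p hp h => ?_⟩
  have h1 : p.re ≤ R := hR ⟨p, hp, rfl⟩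
  exact absurd (h.2.trans h1) (not_le.2 hz)

lemma isPreconnected_cutPlane {n : ℕ} (L : RatMat n) : IsPreconnected (cutPlane L) := by
  obtain ⟨R, hR⟩ := exists_halfPlane_subset_cutPlane L
  exact isPreconnected_of_forall_add (fun x hx t ht => add_mem_cutPlane hx ht) hR

lemma ofReal_mem_halfPlane (R : ℝ) : ((R + 1 : ℝ) : ℂ) ∈ {z : ℂ | R < z.re} := by
  show R < (((R + 1 : ℝ) : ℂ)).re
  rw [Complex.ofReal_re]; linarith

lemma isOpen_halfPlane (R : ℝ) : IsOpen {z : ℂ | R < z.re} :=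
  isOpen_lt continuous_const Complex.continuous_re

section Frobenius
attribute [local instance] Matrix.linftyOpNormedRing Matrix.linftyOpNormedAlgebra

/-! ### The Frobenius canonical solution -/

lemma differentiableOn_inv_smul_evalMat {n : ℕ} (L : RatMat n) :
    DifferentiableOn ℂ (fun z => z⁻¹ • evalMat L z) (cutPlane L) := fun z hz => by
  refine DifferentiableAt.differentiableWithinAt ?_
  exact (differentiableAt_inv (ne_zero_of_mem_cutPlane hz)).smul (differentiableAt_mat_iff.2
    fun i j => (analyticAt_evalMat L (not_isPole_of_mem_cutPlane hz) i j).differentiableAt)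

lemma hasDerivAt_mul_exp_log {n : ℕ} {F : ℂ → Mat n} {A A₀ : Mat n} {z : ℂ} (hz : 0 < z.re)
    (hF : HasDerivAt F (z⁻¹ • (A * F z - F z * A₀)) z) :
    HasDerivAt (fun z => F z * NormedSpace.exp (Complex.log z • A₀))
      ((z⁻¹ • A) * (F z * NormedSpace.exp (Complex.log z • A₀))) z := by
  have h1 : HasDerivAt (fun z => NormedSpace.exp (Complex.log z • A₀))
      (z⁻¹ • (A₀ * NormedSpace.exp (Complex.log z • A₀))) z :=
    (hasDerivAt_exp_smul_const' A₀ (Complex.log z)).scomp z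
      (Complex.hasDerivAt_log (Or.inl hz))
  refine (hF.mul h1).congr_deriv ?_
  simp only [smul_mul_assoc, mul_smul_comm, sub_mul, smul_sub, mul_assoc]
  abel

lemma factTerm_zero_step_hasSum {n : ℕ} {f : ℕ → Mat n} {x : ℂ} {y : Mat n} :
    HasSum (fun s => (x ^ s)⁻¹ • f s) y ↔ HasSum (fun s => factTerm 0 s x • f s) y := by
  simp only [factTerm_step_zero]

/-- Near `+∞`, a Frobenius solution is determined by the gauge recurrence. -/
lemma IsFrobeniusSolution.eq_factSum {n : ℕ} {L : RatMat n} {ℓ : ℕ → Mat n} {K : ℝ}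
    {E : ℂ → Mat n} {f : ℕ → Mat n} (hK : SylvesterBound K (ℓ 0))
    (hL : ∃ R : ℝ, ∀ x : ℂ, R < ‖x‖ → HasSum (fun s : ℕ => (x ^ s)⁻¹ • ℓ s) (evalMat L x))
    (hf : IsGaugeCoef 0 ℓ f) (hE : IsFrobeniusSolution L (ℓ 0) E) :
    ∃ X : ℝ, ∀ x : ℂ, X < x.re → E x = factSum 0 f x * NormedSpace.exp (Complex.log x • ℓ 0) := by
  obtain ⟨R, hR⟩ := hL
  obtain ⟨-, f', F, R', hR'0, hf'0, hF, hFd, hEF⟩ := hE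
  obtain ⟨ξ, hξ⟩ := exists_gt (max R R')
  obtain ⟨hξR, hξR'⟩ := max_lt_iff.1 hξ
  have hξ0 : 0 < ξ := hR'0.trans hξR'
  have hn : ‖(ξ : ℂ)‖ = ξ := by rw [Complex.norm_real, Real.norm_of_nonneg hξ0.le]
  have hℓ : WtSummable 0 ξ ℓ := wtSummable_of_summable le_rfl hξ0
    (factTerm_zero_step_hasSum.1 (hR ξ (by rwa [hn]))).summable
  have hf's : WtSummable 0 ξ f' := wtSummable_of_summable le_rfl hξ0
    (factTerm_zero_step_hasSum.1 (hF ξ (by rwa [hn]))).summable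
  have hL' : ∀ x : ℂ, ξ ≤ ‖x‖ → evalMat L x = factSum 0 ℓ x := fun x hx =>
    (factTerm_zero_step_hasSum.1 (hR x (hξR.trans_le hx))).unique
      (hℓ.hasSum (IsFar.of_norm hx) le_rfl hξ0)
  have hF' : ∀ x : ℂ, ξ ≤ ‖x‖ → F x = factSum 0 f' x := fun x hx =>
    (factTerm_zero_step_hasSum.1 (hF x (hξR'.trans_le hx))).unique
      (hf's.hasSum (IsFar.of_norm hx) le_rfl hξ0)
  have hgc : IsGaugeCoef 0 ℓ f' := by
    refine isGaugeCoef_of_factSum_eq (X := ξ) (ξ := ξ + 0 + 1) le_rfl (by linarith) hf'0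
      (hℓ.mono le_rfl hξ0 (by linarith)) (hf's.mono le_rfl hξ0 (by linarith))
      (hf's.natCast_smul le_rfl hξ0) fun x hx => ?_
    have hx0 : 0 < x := hξ0.trans hx
    have hnx : ‖(x : ℂ)‖ = x := by rw [Complex.norm_real, Real.norm_of_nonneg hx0.le]
    have hxc : (x : ℂ) ≠ 0 := by exact_mod_cast hx0.ne'
    have d1 := hasDerivAt_factSum_zero hξ0 hf's (z := (x : ℂ)) (by rwa [hnx])
    have d2 := hasDerivAt_mat_iff.2 (hFd x (by rw [hnx]; linarith))
    have hev : F =ᶠ[𝓝 (x : ℂ)] factSum 0 f' := by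
      filter_upwards [(isOpen_lt continuous_const continuous_norm).mem_nhds
        (show ξ < ‖(x : ℂ)‖ by rwa [hnx])] with w hw
      exact hF' w (le_of_lt hw)
    have d3 := d1.unique (d2.congr_of_eventuallyEq hev.symm)
    rw [← smul_neg] at d3
    have d4 := smul_right_injective _ (inv_ne_zero hxc) d3
    rw [hL' x (by rw [hnx]; exact hx.le), hF' x (by rw [hnx]; exact hx.le)] at d4
    simp only [Complex.ofReal_zero, zero_div, zero_smul, zero_sub, d4]
    abel
  rw [hf.unique hK hgc]
  refine ⟨ξ, fun x hx => ?_⟩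
  rw [hEF x (hξR'.trans hx), hF' x (hx.le.trans (Complex.re_le_norm x))]

lemma IsFrobeniusSolution.eqOn {n : ℕ} {L : RatMat n} {A₀ : Mat n} {E E' : ℂ → Mat n}
    (hE : IsFrobeniusSolution L A₀ E) (hE' : IsFrobeniusSolution L A₀ E') {X : ℝ}
    (hX : ∀ x : ℂ, X < x.re → E x = E' x) : Set.EqOn E E' (cutPlane L) := by
  obtain ⟨R, hR⟩ := exists_halfPlane_subset_cutPlane L
  have h0 : ((max R X + 1 : ℝ) : ℂ) ∈ {z : ℂ | max R X < z.re} := ofReal_mem_halfPlane _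
  have h1 : ((max R X + 1 : ℝ) : ℂ) ∈ cutPlane L :=
    hR (lt_of_le_of_lt (le_max_left R X) h0)
  intro z hz
  ext i j
  refine (hE.1 i j).eqOn_of_preconnected_of_eventuallyEq (hE'.1 i j) (isPreconnected_cutPlane L)
    h1 ?_ hz
  filter_upwards [(isOpen_halfPlane _).mem_nhds h0] with w hw
  rw [hX w (lt_of_le_of_lt (le_max_right R X) hw)]

/-- The definition gives the differential equation near `+∞` only; both sides are analytic on the
connected cut plane, so it propagates. -/
lemma IsFrobeniusSolution.hasDerivAt {n : ℕ} {L : RatMat n} {A₀ : Mat n} {E : ℂ → Mat n}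
    (hE : IsFrobeniusSolution L A₀ E) {z : ℂ} (hz : z ∈ cutPlane L) :
    HasDerivAt E ((z⁻¹ • evalMat L z) * E z) z := by
  obtain ⟨hEa, f, F, R, hR0, -, -, hFd, hEF⟩ := hE
  have hd : ∀ z ∈ cutPlane L, DifferentiableAt ℂ E z := fun z hz =>
    differentiableAt_mat_iff.2 fun i j => (hEa i j z hz).differentiableAt
  have hdo : DifferentiableOn ℂ E (cutPlane L) := fun z hz => (hd z hz).differentiableWithinAt
  have hU := isOpen_cutPlane L
  obtain ⟨R', hR'⟩ := exists_halfPlane_subset_cutPlane L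
  have h0 : ((max R R' + 1 : ℝ) : ℂ) ∈ {z : ℂ | max R R' < z.re} := ofReal_mem_halfPlane _
  have key := ((hdo.deriv hU).analyticOnNhd hU).eqOn_of_preconnected_of_eventuallyEq
    (((differentiableOn_inv_smul_evalMat L).mul hdo).analyticOnNhd hU) (isPreconnected_cutPlane L)
    (hR' (lt_of_le_of_lt (le_max_right R R') h0)) (by
      filter_upwards [(isOpen_halfPlane _).mem_nhds h0] with w hw
      have hwR : R < w.re := lt_of_le_of_lt (le_max_left R R') hw
      have d := hasDerivAt_mul_exp_log (F := F) (hR0.trans hwR)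
        (hasDerivAt_mat_iff.2 (hFd w (hwR.trans_le (Complex.re_le_norm w))))
      have hev : E =ᶠ[𝓝 w] fun x => F x * NormedSpace.exp (Complex.log x • A₀) := by
        filter_upwards [(isOpen_halfPlane _).mem_nhds hwR] with v hv
        exact hEF v hv
      rw [(d.congr_of_eventuallyEq hev).deriv, ← hEF w hwR]
      rfl) hz
  have := (hd z hz).hasDerivAt
  rw [key] at this
  exact this

/-- The gauge equation at step `0` is the differential equation of `F`, so the power series comes
from the same recurrence, and `exists_continuation` extends the solution to the cut plane. -/
lemma exists_isFrobeniusSolution {n : ℕ} {L : RatMat n} {ℓ : ℕ → Mat n} {ξ : ℝ} {f : ℕ → Mat n}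
    (hξ : 0 < ξ) (hf : IsGaugeCoef 0 ℓ f) (hℓs : WtSummable 0 ξ ℓ) (hfs : WtSummable 0 ξ f)
    (hfs' : WtSummable 0 ξ fun s => (s : ℂ) • f s)
    (hL : ∃ R : ℝ, ∀ x : ℂ, R < ‖x‖ → HasSum (fun s : ℕ => (x ^ s)⁻¹ • ℓ s) (evalMat L x)) :
    ∃ E : ℂ → Mat n, IsFrobeniusSolution L (ℓ 0) E := by
  obtain ⟨R, hR⟩ := hL
  obtain ⟨R', hR'⟩ := exists_halfPlane_subset_cutPlane L
  have hF : ∀ x : ℂ, max ξ R < ‖x‖ → HasDerivAt (factSum 0 f)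
      (x⁻¹ • (evalMat L x * factSum 0 f x - factSum 0 f x * ℓ 0)) x := by
    intro x hx
    obtain ⟨hx1, hx2⟩ := max_lt_iff.1 hx
    have hfar : IsFar 0 ξ x := IsFar.of_norm hx1.le
    have d := hasDerivAt_factSum_zero hξ hfs hx1
    have e := hf.factSum_eq le_rfl hξ hℓs hfs hfs' hfar
    have hL : evalMat L x = factSum 0 ℓ x :=
      (factTerm_zero_step_hasSum.1 (hR x hx2)).unique (hℓs.hasSum hfar le_rfl hξ)
    refine d.congr_deriv ?_
    rw [hL, ← smul_neg]
    congr 1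
    simp only [Complex.ofReal_zero, zero_div, zero_smul, zero_sub] at e
    rw [← sub_eq_zero, ← e]
    abel
  obtain ⟨E, hE, hE0⟩ := exists_continuation (norm_one_mat_le n) (isOpen_cutPlane L)
    (fun x hx t ht => add_mem_cutPlane hx ht) (differentiableOn_inv_smul_evalMat L)
    (R := max (max ξ R) R') (fun z hz => hR' ((le_max_right (max ξ R) R').trans_lt hz))
    (E₀ := fun z => factSum 0 f z * NormedSpace.exp (Complex.log z • ℓ 0)) (fun z hz => by
      have hz1 : max ξ R < z.re := lt_of_le_of_lt (le_max_left _ _) hz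
      have hz0 : 0 < z.re := hξ.trans ((le_max_left _ _).trans_lt hz1)
      exact hasDerivAt_mul_exp_log hz0 (hF z (hz1.trans_le (Complex.re_le_norm z))))
  refine ⟨E, fun i j => ?_, f, factSum 0 f, max (max ξ R) R',
    hξ.trans_le ((le_max_left _ _).trans (le_max_left _ _)), hf.1, fun x hx => ?_,
    fun x hx i j => ?_, hE0⟩
  · refine DifferentiableOn.analyticOnNhd (fun z hz => ?_) (isOpen_cutPlane L)
    exact (differentiableAt_mat_iff.1 (hE.differentiableAt ((isOpen_cutPlane L).mem_nhds hz))
      i j).differentiableWithinAt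
  · exact factTerm_zero_step_hasSum.2 (hfs.hasSum (IsFar.of_norm
      (((le_max_left _ _).trans (le_max_left _ _)).trans hx.le)) le_rfl hξ)
  · exact hasDerivAt_mat_iff.1 (hF x ((le_max_left _ _).trans_lt hx)) i j

end Frobenius

/-! ### Meromorphic functions in normal form -/

/-- The difference has infinite order at a point far to the right, hence everywhere in the connected
half-plane. Only punctured neighbourhoods are controlled; normal forms later restore the value at
the centre. -/
lemma eventuallyEq_nhdsNE_of_eq_right {f g : ℂ → ℂ} {R X : ℝ}
    (hf : MeromorphicOn f {z | R < z.re}) (hg : MeromorphicOn g {z | R < z.re})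
    (hfg : ∀ z : ℂ, X < z.re → f z = g z) {z : ℂ} (hz : R < z.re) : f =ᶠ[𝓝[≠] z] g := by
  have hd : MeromorphicOn (f - g) {z | R < z.re} := hf.sub hg
  have h0 := ofReal_mem_halfPlane (max R X)
  have hR : ((max R X + 1 : ℝ) : ℂ) ∈ {z : ℂ | R < z.re} := lt_of_le_of_lt (le_max_left R X) h0
  have htop : meromorphicOrderAt (f - g) ((max R X + 1 : ℝ) : ℂ) = ⊤ := by
    rw [meromorphicOrderAt_eq_top_iff]
    refine Filter.Eventually.filter_mono nhdsWithin_le_nhds ?_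
    filter_upwards [(isOpen_halfPlane _).mem_nhds h0] with w hw
    rw [Pi.sub_apply, hfg w (lt_of_le_of_lt (le_max_right R X) hw), sub_self]
  have h1 : meromorphicOrderAt (f - g) z = ⊤ := by
    by_contra h2
    exact hd.meromorphicOrderAt_ne_top_of_isPreconnected
      (convex_halfSpace_re_gt R).isPreconnected hz hR h2 htop
  rw [meromorphicOrderAt_eq_top_iff] at h1
  exact h1.mono fun w hw => sub_eq_zero.1 hw

lemma MeromorphicNFOn.eq_of_eq_right {f g : ℂ → ℂ} {X : ℝ} (hf : MeromorphicNFOn f Set.univ)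
    (hg : MeromorphicNFOn g Set.univ) (hfg : ∀ z : ℂ, X < z.re → f z = g z) : f = g := by
  funext z
  have h1 := eventuallyEq_nhdsNE_of_eq_right (R := z.re - 1) (z := z)
    (hf.meromorphicOn.mono_set (Set.subset_univ _))
    (hg.meromorphicOn.mono_set (Set.subset_univ _)) hfg (by linarith)
  exact ((MeromorphicNFAt.eventuallyEq_nhdsNE_iff_eventuallyEq_nhds (hf trivial)
    (hg trivial)).1 h1).eq_of_nhds

lemma MeromorphicNFAt.eventuallyEq_nhds_of_analyticAt {f g : ℂ → ℂ} {x : ℂ}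
    (hf : MeromorphicNFAt f x) (hg : AnalyticAt ℂ g x) (hfg : f =ᶠ[𝓝[≠] x] g) : f =ᶠ[𝓝 x] g :=
  (hf.eventuallyEq_nhdsNE_iff_eventuallyEq_nhds hg.meromorphicNFAt).1 hfg

/-! ### Continuation of solutions of difference systems -/

lemma meromorphicAt_mul_apply {n : ℕ} {F G : ℂ → Mat n} {x : ℂ}
    (hF : ∀ i j, MeromorphicAt (fun z => F z i j) x)
    (hG : ∀ i j, MeromorphicAt (fun z => G z i j) x) (i j : Fin n) :
    MeromorphicAt (fun z => (F z * G z) i j) x := by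
  simp only [Matrix.mul_apply]
  exact MeromorphicAt.fun_sum fun k _ => (hF i k).fun_mul (hG k j)

lemma analyticAt_mul_apply {n : ℕ} {F G : ℂ → Mat n} {x : ℂ}
    (hF : ∀ i j, AnalyticAt ℂ (fun z => F z i j) x)
    (hG : ∀ i j, AnalyticAt ℂ (fun z => G z i j) x) (i j : Fin n) :
    AnalyticAt ℂ (fun z => (F z * G z) i j) x := by
  simp only [Matrix.mul_apply]
  exact Finset.analyticAt_fun_sum _ fun k _ => (hF i k).mul (hG k j)

lemma MeromorphicAt.comp_add {f : ℂ → ℂ} {x c : ℂ} (hf : MeromorphicAt f (x + c)) :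
    MeromorphicAt (fun z => f (z + c)) x :=
  hf.comp_analyticAt (g := fun z => z + c) (by fun_prop)

lemma AnalyticAt.comp_add {f : ℂ → ℂ} {x c : ℂ} (hf : AnalyticAt ℂ f (x + c)) :
    AnalyticAt ℂ (fun z => f (z + c)) x :=
  hf.comp_of_eq (g := f) (f := fun z => z + c) (by fun_prop) rfl

lemma meromorphicAt_stepProd {n : ℕ} {M : ℂ → Mat n} {h : ℝ}
    (hM : ∀ z i j, MeromorphicAt (fun z => M z i j) z) (N : ℕ) (x : ℂ) (i j : Fin n) :
    MeromorphicAt (fun z => stepProd M h N z i j) x := by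
  induction N generalizing x i j with
  | zero => exact MeromorphicAt.const _ _
  | succ N ih =>
    exact meromorphicAt_mul_apply (F := fun z => M (z + h)) (G := fun z => stepProd M h N (z + h))
      (fun i j => MeromorphicAt.comp_add (f := fun z => M z i j) (hM _ i j))
      (fun i j => MeromorphicAt.comp_add (f := fun z => stepProd M h N z i j) (ih _ i j)) i j

lemma analyticAt_stepProd {n : ℕ} {M : ℂ → Mat n} {h : ℝ} {N : ℕ} {x : ℂ}
    (hM : ∀ k < N, ∀ i j, AnalyticAt ℂ (fun z => M z i j) (x + (k + 1) * h)) (i j : Fin n) :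
    AnalyticAt ℂ (fun z => stepProd M h N z i j) x := by
  induction N generalizing x i j with
  | zero => exact analyticAt_const
  | succ N ih =>
    have h1 := hM 0 (Nat.succ_pos _)
    simp only [Nat.cast_zero, zero_add, one_mul] at h1
    refine analyticAt_mul_apply (F := fun z => M (z + h)) (G := fun z => stepProd M h N (z + h))
      (fun i j => AnalyticAt.comp_add (f := fun z => M z i j) (h1 i j))
      (fun i j => AnalyticAt.comp_add (f := fun z => stepProd M h N z i j)
        (ih (x := x + h) (fun k hk i j => ?_) i j)) i j
    have h2 := hM (k + 1) (Nat.succ_lt_succ hk) i j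
    rwa [show x + (((k + 1 : ℕ) : ℂ) + 1) * h = x + h + (k + 1) * h by push_cast; ring] at h2

/-- The matrix `1 - h A(x) / (x - h)` of the system `Y(x - h) = (1 - h A(x) / (x - h)) Y(x)`. -/
def stepMat {n : ℕ} (h : ℝ) (A : ℂ → Mat n) (x : ℂ) : Mat n := 1 - ((h : ℂ) / (x - h)) • A x

lemma meromorphicAt_stepMat {n : ℕ} (h : ℝ) (A : RatMat n) (x : ℂ) (i j : Fin n) :
    MeromorphicAt (fun z => stepMat h (evalMat A) z i j) x := by
  simp only [stepMat, Matrix.sub_apply, Matrix.smul_apply, smul_eq_mul]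
  refine (MeromorphicAt.const _ _).fun_sub (MeromorphicAt.fun_mul (MeromorphicAt.fun_div
    (MeromorphicAt.const _ _) ?_) (meromorphicAt_evalMat A x i j))
  exact AnalyticAt.meromorphicAt (by fun_prop)

lemma analyticAt_stepMat {n : ℕ} {h : ℝ} {A : RatMat n} {x : ℂ} (hx : x - h ≠ 0)
    (hA : ¬ IsPole A x) (i j : Fin n) :
    AnalyticAt ℂ (fun z => stepMat h (evalMat A) z i j) x := by
  simp only [stepMat, Matrix.sub_apply, Matrix.smul_apply, smul_eq_mul]
  exact analyticAt_const.fun_sub (AnalyticAt.fun_mul (AnalyticAt.fun_div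
    analyticAt_const (by fun_prop) hx) (analyticAt_evalMat A hA i j))

lemma add_natCast_mul_re (x : ℂ) (N : ℕ) (h : ℝ) : (x + N * h).re = x.re + N * h := by
  have : ((N : ℂ) * h) = ((N * h : ℝ) : ℂ) := by push_cast; ring
  rw [this, Complex.add_re, Complex.ofReal_re]

/-- Backward products carry a solution near `+∞` to every half-plane. -/
lemma eventuallyEq_stepProd_mul {n : ℕ} {h ξ X : ℝ} (hh : 0 ≤ h) {A : RatMat n}
    {U Y : ℂ → Mat n} (hU : ∀ i j, ∀ z : ℂ, ξ < z.re → AnalyticAt ℂ (fun z => U z i j) z)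
    (hUs : ∀ z : ℂ, X < z.re → U (z - h) = stepMat h (evalMat A) z * U z)
    (hY : ∀ i j, MeromorphicOn (fun z => Y z i j) Set.univ) (hYU : ∀ z : ℂ, X < z.re → Y z = U z)
    {N : ℕ} {x : ℂ} (hx : ξ < x.re + N * h) (i j : Fin n) :
    (fun z => Y z i j) =ᶠ[𝓝[≠] x]
      fun z => (stepProd (stepMat h (evalMat A)) h N z * U (z + N * h)) i j := by
  refine eventuallyEq_nhdsNE_of_eq_right (R := ξ - N * h) (X := X)
    ((hY i j).mono_set (Set.subset_univ _)) (fun z hz => ?_) (fun z hz => ?_) (by linarith)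
  · refine meromorphicAt_mul_apply (G := fun z => U (z + N * h))
      (fun i j => meromorphicAt_stepProd (meromorphicAt_stepMat h A) N z i j) (fun i j => ?_) i j
    refine (AnalyticAt.comp_add (f := fun z => U z i j) (hU i j _ ?_)).meromorphicAt
    have : ξ - N * h < z.re := hz
    rw [add_natCast_mul_re]
    linarith
  · rw [stepProd_mul_eq, hYU z hz]
    intro k _
    have e : z + k * h = z + (k + 1) * h - h := by ring
    rw [e]
    refine hUs _ ?_
    have := add_natCast_mul_re z (k + 1) h
    push_cast at this
    rw [this]
    have : 0 ≤ ((k : ℝ) + 1) * h := by positivity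
    linarith

/-- A solution near `+∞` has a meromorphic continuation. -/
lemma exists_meromorphic_continuation {n : ℕ} {h ξ X : ℝ} (hh : 0 < h) {A : RatMat n}
    {U : ℂ → Mat n} (hU : ∀ i j, ∀ z : ℂ, ξ < z.re → AnalyticAt ℂ (fun z => U z i j) z)
    (hUs : ∀ z : ℂ, X < z.re → U (z - h) = stepMat h (evalMat A) z * U z) :
    ∃ Y : ℂ → Mat n, (∀ i j, MeromorphicNFOn (fun z => Y z i j) Set.univ) ∧
      ∃ X' : ℝ, ∀ z : ℂ, X' < z.re → Y z = U z := by
  set M := stepMat h (evalMat A) with hM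
  set V : ℕ → ℂ → Mat n := fun N z => stepProd M h N z * U (z + N * h) with hV
  have hVV : ∀ N N' : ℕ, N ≤ N' → ∀ z : ℂ, X < z.re + N * h → V N z = V N' z := by
    intro N N' hNN z hz
    obtain ⟨d, rfl⟩ := Nat.exists_eq_add_of_le hNN
    simp only [hV]
    have e1 : z + ((N + d : ℕ) : ℂ) * h = z + N * h + d * h := by push_cast; ring
    have key : stepProd M h d (z + N * h) * U (z + N * h + d * h) = U (z + N * h) := ?_
    · rw [stepProd_add, mul_assoc, e1, key]
    refine stepProd_mul_eq fun k _ => ?_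
    have e : z + N * h + k * h = z + N * h + (k + 1) * h - h := by ring
    rw [e]
    refine hUs _ ?_
    have := add_natCast_mul_re (z + N * h) (k + 1) h
    push_cast at this
    rw [this, add_natCast_mul_re]
    have : 0 ≤ ((k : ℝ) + 1) * h := by positivity
    linarith
  have hex : ∀ z : ℂ, ∃ N : ℕ, max X ξ < z.re + N * h := fun z => by
    obtain ⟨N, hN⟩ := exists_nat_gt ((max X ξ - z.re) / h)
    rw [div_lt_iff₀ hh] at hN
    exact ⟨N, by linarith⟩
  choose ν hν using hex
  -- Near each `x` this is the single meromorphic function `V (ν x)`, since the `V N` agree wherever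
  -- `z + N h` lies in the region where the equation of `U` holds.
  set Y₀ : ℂ → Mat n := fun z => V (ν z) z with hY₀
  have hY₀V : ∀ N : ℕ, ∀ z : ℂ, X < z.re + N * h → Y₀ z = V N z := by
    intro N z hz
    rcases le_total (ν z) N with h2 | h2
    · exact hVV _ _ h2 z ((le_max_left _ _).trans_lt (hν z))
    · exact (hVV _ _ h2 z hz).symm
  have hmero : ∀ i j, MeromorphicOn (fun z => Y₀ z i j) Set.univ := by
    intro i j x _
    have h1 : MeromorphicAt (fun z => V (ν x) z i j) x := by
      refine meromorphicAt_mul_apply (G := fun z => U (z + ν x * h))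
        (fun i j => meromorphicAt_stepProd (meromorphicAt_stepMat h A) _ x i j) (fun i j => ?_) i j
      refine (AnalyticAt.comp_add (f := fun z => U z i j) (hU i j _ ?_)).meromorphicAt
      rw [add_natCast_mul_re]
      exact (le_max_right _ _).trans_lt (hν x)
    refine h1.congr (Filter.EventuallyEq.filter_mono ?_ nhdsWithin_le_nhds)
    filter_upwards [(isOpen_halfPlane (X - ν x * h)).mem_nhds
      (show X - ν x * h < x.re by linarith [(le_max_left X ξ).trans_lt (hν x)])] with z hz
    have hz' : X - ν x * h < z.re := hz
    rw [hY₀V (ν x) z (by linarith)]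
  refine ⟨fun z => Matrix.of fun i j => toMeromorphicNFOn (fun z => Y₀ z i j) Set.univ z,
    fun i j => meromorphicNFOn_toMeromorphicNFOn _ _, max X ξ, fun z hz => ?_⟩
  ext i j
  obtain ⟨hzX, hzξ⟩ := max_lt_iff.1 hz
  have h1 := (hmero i j).toMeromorphicNFOn_eq_self_on_nhdsNE (x := z) trivial
  have h2 : (fun w => Y₀ w i j) =ᶠ[𝓝 z] fun w => U w i j := by
    filter_upwards [(isOpen_halfPlane X).mem_nhds hzX] with w hw
    rw [hY₀V 0 w (by simpa using hw)]
    simp [hV, stepProd]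
  exact (MeromorphicNFAt.eventuallyEq_nhds_of_analyticAt
    (meromorphicNFOn_toMeromorphicNFOn (fun z => Y₀ z i j) Set.univ trivial) (hU i j z hzξ)
    (h1.trans (h2.filter_mono nhdsWithin_le_nhds))).eq_of_nhds

section Canonical
attribute [local instance] Matrix.linftyOpNormedRing Matrix.linftyOpNormedAlgebra

/-! ### The canonical solution -/

lemma factSum_mul_sub_step {n : ℕ} {h : ℝ} (hh : 0 < h) {A : ℂ → Mat n} {A₀ : Mat n}
    {F e : ℂ → Mat n} (hF : IsNormalizingGauge h A A₀ F) (he : IsConstantSolution h A₀ e) :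
    ∃ X : ℝ, ∀ z : ℂ, X < z.re → F (z - h) * e (z - h) = stepMat h A z * (F z * e z) := by
  obtain ⟨-, ⟨g, G, -, M, hG⟩, M', hM'⟩ := hF
  refine ⟨max (max M M') 0 + h, fun z hz => ?_⟩
  have b0 : 0 ≤ max (max M M') 0 := le_max_right _ _
  have b1 : M ≤ max (max M M') 0 := (le_max_left _ _).trans (le_max_left _ _)
  have b2 : M' ≤ max (max M M') 0 := (le_max_right _ _).trans (le_max_left _ _)
  have hre : (z - h).re = z.re - h := by simp
  have hzh : h < z.re := by linarith
  rw [he.sub_step hh hzh, ← mul_assoc, (gaugeTransform_eq_iff hh hzh (hG (z - h)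
    (by rw [hre]; linarith))).1 (hM' z (by linarith)), mul_assoc, stepMat]

lemma analyticAt_factSum_mul {n : ℕ} {h ξ : ℝ} (hh : 0 < h) (hξ : 0 < ξ) {f : ℕ → Mat n}
    (hf : WtSummable h ξ f) {A₀ : Mat n} {e : ℂ → Mat n} (he : IsConstantSolution h A₀ e)
    (i j : Fin n) {z : ℂ} (hz : ξ < z.re) :
    AnalyticAt ℂ (fun z => (factSum h f z * e z) i j) z := by
  refine analyticAt_mul_apply (fun i j => ?_) (fun i j => ?_) i j
  · refine DifferentiableOn.analyticAt (s := {z | ξ < z.re}) (fun w hw => ?_)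
      ((isOpen_halfPlane ξ).mem_nhds hz)
    exact (differentiableAt_mat_iff.1 ((differentiableOn_factSum hh.le hξ hf).differentiableAt
      ((isOpen_halfPlane ξ).mem_nhds hw)) i j).differentiableWithinAt
  · refine DifferentiableOn.analyticAt (s := {z | ξ < z.re}) (fun w hw => ?_)
      ((isOpen_halfPlane ξ).mem_nhds hz)
    exact (he.differentiableAt hh (hξ.trans hw) i j).differentiableWithinAt

lemma IsCanonicalSolution.eq_factSum_mul {n : ℕ} {h K : ℝ} (hh : 0 < h) {a f : ℕ → Mat n}
    {A Y e : ℂ → Mat n} (hK : SylvesterBound K (a 0)) (hA : HasFactorialExpansion h a A)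
    (hg : IsGaugeCoef h a f) (he : IsConstantSolution h (a 0) e)
    (hY : IsCanonicalSolution h A (a 0) Y) :
    ∃ X : ℝ, ∀ x : ℂ, X < x.re → Y x = factSum h f x * e x := by
  obtain ⟨-, F, e', hF, he', M, hM⟩ := hY
  obtain ⟨X, hX⟩ := hF.eq_factSum hh hK hA hg
  refine ⟨max M X, fun x hx => ?_⟩
  obtain ⟨h1, h2⟩ := max_lt_iff.1 hx
  rw [hM x h1, hX x h2, he'.eq hh he]

lemma existsUnique_isCanonicalSolution {n : ℕ} {h K ξ : ℝ} (hh : 0 < h) (hξ : h < ξ)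
    {a f : ℕ → Mat n} {A : RatMat n} {e : ℂ → Mat n} (hK : SylvesterBound K (a 0))
    (hA : HasFactorialExpansion h a (evalMat A)) (hg : IsGaugeCoef h a f)
    (ha : WtSummable h ξ a) (hf : WtSummable h ξ f) (hf' : WtSummable h ξ fun s => (s : ℂ) • f s)
    (he : IsConstantSolution h (a 0) e) :
    ∃! Y : ℂ → Mat n, IsCanonicalSolution h (evalMat A) (a 0) Y := by
  have hF := isNormalizingGauge_factSum hh hξ hA hg ha hf hf'
  obtain ⟨X, hX⟩ := factSum_mul_sub_step hh hF he
  obtain ⟨Y, hY, X', hX'⟩ := exists_meromorphic_continuation hh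
    (U := fun z => factSum h f z * e z)
    (fun i j z hz => analyticAt_factSum_mul hh (hh.trans hξ) hf he i j hz) hX
  refine ⟨Y, ⟨hY, factSum h f, e, hF, he, X', hX'⟩, fun Y' hY' => ?_⟩
  obtain ⟨X'', hX''⟩ := hY'.eq_factSum_mul hh hK hA hg he
  funext z
  ext i j
  refine congrFun (MeromorphicNFOn.eq_of_eq_right (X := max X' X'') (hY'.1 i j) (hY i j)
    fun z hz => ?_) z
  obtain ⟨h1, h2⟩ := max_lt_iff.1 hz
  rw [hX'' z h2, hX' z h1]

/-! ### Confluence -/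

variable {n : ℕ} {h₀ C lam : ℝ} {A : ℝ → RatMat n} {L : RatMat n} {a : ℝ → ℕ → Mat n}
  {ℓ : ℕ → Mat n}

lemma ConfluenceHypothesis.eventually_not_isPole (hyp : ConfluenceHypothesis h₀ C lam A L a ℓ)
    {K : Set ℂ} (hK : IsCompact K) (hKL : ∀ z ∈ K, ¬ IsPole L z) :
    ∀ᶠ h in 𝓝[>] (0 : ℝ), ∀ z ∈ K, ¬ IsPole (A h) z := by
  refine hK.induction_on (p := fun s => ∀ᶠ h in 𝓝[>] (0 : ℝ), ∀ z ∈ s, ¬ IsPole (A h) z) ?_ ?_ ?_ ?_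
  · simp
  · exact fun s t hst ht => ht.mono fun h hh z hz => hh z (hst hz)
  · intro s t hs ht
    filter_upwards [hs, ht] with h h1 h2 z hz
    exact hz.elim (h1 z) (h2 z)
  · intro z hz
    obtain ⟨U, hU, hUh⟩ := hyp.no_poles z (hKL z hz)
    exact ⟨U, mem_nhdsWithin_of_mem_nhds hU, hUh⟩

lemma ConfluenceHypothesis.typeBound_limit (hyp : ConfluenceHypothesis h₀ C lam A L a ℓ) :
    TypeBound 0 C lam ℓ := by
  obtain ⟨⟨h', ⟨h'0, -⟩, hC⟩, -⟩ := hyp.type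
  intro s hs i j
  have h1 : Tendsto (fun h => ‖a h s i j‖) (𝓝[>] 0) (𝓝 ‖ℓ s i j‖) :=
    (tendsto_pi_nhds.1 (tendsto_pi_nhds.1 (hyp.coeff_tendsto s) i) j).norm
  have h2 : Tendsto (fun h => C * risingFact h (s - 1) lam) (𝓝[>] 0)
      (𝓝 (C * risingFact 0 (s - 1) lam)) := by
    have : Continuous fun h : ℝ => C * risingFact h (s - 1) lam := by
      unfold risingFact
      fun_prop
    exact (this.tendsto 0).mono_left nhdsWithin_le_nhds
  refine le_of_tendsto_of_tendsto h1 h2 ?_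
  filter_upwards [Ioo_mem_nhdsGT h'0] with h hh
  exact hC h hh s hs i j

/-- The coefficients of the difference system converge to those of the differential system. -/
lemma ConfluenceHypothesis.eventually_stepMat_sub_le (hyp : ConfluenceHypothesis h₀ C lam A L a ℓ)
    {K : Set ℂ} (hK : IsCompact K) (hKL : K ⊆ cutPlane L) {ε : ℝ} (hε : 0 < ε) :
    ∀ᶠ h in 𝓝[>] (0 : ℝ), ∀ y ∈ K,
      ‖stepMat h (evalMat (A h)) y - (1 - (h : ℂ) • y⁻¹ • evalMat L y)‖ ≤ h * ε := by
  rcases K.eq_empty_or_nonempty with rfl | hne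
  · simp
  obtain ⟨c, hc0, hc⟩ : ∃ c > 0, ∀ y ∈ K, c ≤ ‖y‖ := by
    obtain ⟨y₀, hy₀, hmin⟩ := hK.exists_isMinOn hne continuous_norm.continuousOn
    exact ⟨‖y₀‖, norm_pos_iff.2 (ne_zero_of_mem_cutPlane (hKL hy₀)), fun y hy => hmin hy⟩
  have hLc : ContinuousOn (evalMat L) K := fun z hz =>
    (differentiableAt_mat_iff.2 fun i j => (analyticAt_evalMat L
      (not_isPole_of_mem_cutPlane (hKL hz)) i j).differentiableAt).continuousAt.continuousWithinAt
  obtain ⟨B, hB⟩ := hK.exists_bound_of_continuousOn hLc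
  have hB0 : 0 ≤ B := (norm_nonneg _).trans (hB _ hne.choose_spec)
  -- The error splits into the replacement of `A h` by `L`, controlled by `δ`, and that of `(y -
  -- h)⁻¹` by `y⁻¹`, controlled by the smallness of `h`; each gets `ε / 2`. The bound `h < c / 2`
  -- keeps `‖y - h‖ ≥ c / 2`.
  set δ := ε * c / (4 * (n + 1)) with hδ
  have hδ0 : 0 < δ := by positivity
  have h1 : ∀ᶠ h in 𝓝[>] (0 : ℝ), ∀ i j, ∀ y ∈ K, dist (evalMat L y i j) (evalMat (A h) y i j) < δ :=
    eventually_all.2 fun i => eventually_all.2 fun j => Metric.tendstoUniformlyOn_iff.1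
      (hyp.uniform K hK (fun z hz => not_isPole_of_mem_cutPlane (hKL hz)) i j) δ hδ0
  filter_upwards [h1, Ioo_mem_nhdsGT (show 0 < min (c / 2) (ε * c ^ 2 / (4 * (B + 1))) by positivity)]
    with h hAL hh y hy
  obtain ⟨hpos, hh2⟩ := hh
  obtain ⟨hhc, hhε⟩ := lt_min_iff.1 hh2
  have hy0 : y ≠ 0 := ne_zero_of_mem_cutPlane (hKL hy)
  have hnh : ‖(h : ℂ)‖ = h := by rw [Complex.norm_real, Real.norm_of_nonneg hpos.le]
  have hyh : c / 2 ≤ ‖y - h‖ := by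
    have := norm_sub_norm_le y h
    rw [hnh] at this
    linarith [hc y hy]
  have hyh0 : y - h ≠ 0 := norm_pos_iff.1 (lt_of_lt_of_le (by positivity) hyh)
  have e : stepMat h (evalMat (A h)) y - (1 - (h : ℂ) • y⁻¹ • evalMat L y)
      = (h : ℂ) • ((y - h)⁻¹ • (evalMat L y - evalMat (A h) y)
        - ((h : ℂ) * ((y - h)⁻¹ * y⁻¹)) • evalMat L y) := by
    have e2 : y⁻¹ = (y - h)⁻¹ - (h : ℂ) * ((y - h)⁻¹ * y⁻¹) := by
      field_simp
    have e3 : y⁻¹ • evalMat L y = (y - h)⁻¹ • evalMat L y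
        - ((h : ℂ) * ((y - h)⁻¹ * y⁻¹)) • evalMat L y := by
      rw [← sub_smul, ← e2]
    rw [e3, stepMat, div_eq_mul_inv, mul_smul, smul_sub (y - h)⁻¹]
    simp only [smul_sub]
    abel
  rw [e, norm_smul, hnh]
  refine mul_le_mul_of_nonneg_left ?_ hpos.le
  have hi : ‖(y - h)⁻¹‖ ≤ 2 / c := by
    rw [norm_inv]
    calc _ ≤ (c / 2)⁻¹ := inv_anti₀ (by positivity) hyh
      _ = 2 / c := by rw [inv_div]
  have hi' : ‖y⁻¹‖ ≤ 1 / c := by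
    rw [norm_inv, one_div]
    exact inv_anti₀ hc0 (hc y hy)
  have hAn : ‖evalMat L y - evalMat (A h) y‖ ≤ n * δ := norm_mat_le hδ0.le fun i j => by
    have := hAL i j y hy
    rw [dist_eq_norm] at this
    exact this.le
  have t1 : ‖(y - h)⁻¹ • (evalMat L y - evalMat (A h) y)‖ ≤ ε / 2 := by
    rw [norm_smul]
    calc _ ≤ 2 / c * (n * δ) := mul_le_mul hi hAn (norm_nonneg _) (by positivity)
      _ = ε / 2 * (n / (n + 1)) := by rw [hδ]; field_simp; ring
      _ ≤ ε / 2 * 1 := mul_le_mul_of_nonneg_left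
          ((div_le_one (by positivity)).2 (by linarith)) (by positivity)
      _ = _ := mul_one _
  have t2 : ‖((h : ℂ) * ((y - h)⁻¹ * y⁻¹)) • evalMat L y‖ ≤ ε / 2 := by
    rw [norm_smul, norm_mul, norm_mul, hnh]
    calc _ ≤ ε * c ^ 2 / (4 * (B + 1)) * (2 / c * (1 / c)) * (B + 1) := by
          refine mul_le_mul (mul_le_mul hhε.le (mul_le_mul hi hi' (norm_nonneg _) (by positivity))
            (by positivity) (by positivity)) ((hB y hy).trans (by linarith)) (norm_nonneg _)
            (by positivity)
      _ = ε / 2 := by field_simp; ring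
  linarith [norm_sub_le ((y - h)⁻¹ • (evalMat L y - evalMat (A h) y))
    (((h : ℂ) * ((y - h)⁻¹ * y⁻¹)) • evalMat L y)]

/-- Confluence, from a description of the solutions in a fixed right half-plane. -/
lemma ConfluenceHypothesis.tendsto_of_eq_right (hyp : ConfluenceHypothesis h₀ C lam A L a ℓ)
    {ξ X : ℝ} {U Y : ℝ → ℂ → Mat n} {E : ℂ → Mat n} (hE : IsFrobeniusSolution L (ℓ 0) E)
    (hU : ∀ᶠ h in 𝓝[>] (0 : ℝ), ∀ i j, ∀ z : ℂ, ξ < z.re → AnalyticAt ℂ (fun z => U h z i j) z)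
    (hUs : ∀ᶠ h in 𝓝[>] (0 : ℝ), ∃ X : ℝ, ∀ z : ℂ, X < z.re →
      U h (z - h) = stepMat h (evalMat (A h)) z * U h z)
    (hY : ∀ᶠ h in 𝓝[>] (0 : ℝ), ∀ i j, MeromorphicNFOn (fun z => Y h z i j) Set.univ)
    (hYU : ∀ᶠ h in 𝓝[>] (0 : ℝ), ∃ X : ℝ, ∀ z : ℂ, X < z.re → Y h z = U h z)
    (hUE : ∀ (z : ℝ → ℂ) (z₀ : ℂ), Tendsto z (𝓝[>] 0) (𝓝 z₀) → X < z₀.re →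
      Tendsto (fun h => U h (z h)) (𝓝[>] 0) (𝓝 (E z₀)))
    {x : ℂ} (hx : x ∈ cutPlane L) :
    (∀ᶠ h in 𝓝[>] (0 : ℝ), ∀ i j, AnalyticAt ℂ (fun z => Y h z i j) x) ∧
      Tendsto (fun h => Y h x) (𝓝[>] 0) (𝓝 (E x)) := by
  -- The point `x + T` lies in both half-planes where `U` is understood. With `N h = ⌈T / h⌉₊` the
  -- starting points `x + N h * h` tend to it, and the whole path stays in a fixed compact stadium
  -- of length `T + 1`.
  obtain ⟨T, hT⟩ := exists_gt (max 0 (max ξ X - x.re))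
  obtain ⟨hT0, hT1⟩ := max_lt_iff.1 hT
  have hTξ : ξ < x.re + T := by linarith [le_max_left ξ X]
  have hTX : X < x.re + T := by linarith [le_max_right ξ X]
  set N : ℝ → ℕ := fun h => ⌈T / h⌉₊ with hN
  have hpos : ∀ᶠ h in 𝓝[>] (0 : ℝ), h ∈ Set.Ioo (0 : ℝ) 1 := Ioo_mem_nhdsGT one_pos
  have hN1 : ∀ h ∈ Set.Ioo (0 : ℝ) 1, T ≤ N h * h ∧ N h * h ≤ T + h := by
    intro h hh
    have e : T / h * h = T := div_mul_cancel₀ _ hh.1.ne'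
    have h1 := mul_le_mul_of_nonneg_right (Nat.le_ceil (T / h)) hh.1.le
    have h2 := mul_le_mul_of_nonneg_right (Nat.ceil_lt_add_one (a := T / h)
      (div_nonneg hT0.le hh.1.le)).le hh.1.le
    rw [e] at h1
    rw [add_mul, e, one_mul] at h2
    exact ⟨h1, h2⟩
  have hNh : Tendsto (fun h : ℝ => (N h : ℝ) * h) (𝓝[>] 0) (𝓝 T) := by
    have h2 : Tendsto (fun h : ℝ => T + h) (𝓝[>] 0) (𝓝 T) := by
      have : Continuous fun h : ℝ => T + h := by fun_prop
      simpa using (this.tendsto 0).mono_left (nhdsWithin_le_nhds (s := Set.Ioi (0 : ℝ)))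
    exact tendsto_of_tendsto_of_tendsto_of_le_of_le' tendsto_const_nhds h2
      (hpos.mono fun h hh => (hN1 h hh).1) (hpos.mono fun h hh => (hN1 h hh).2)
  have hz : Tendsto (fun h : ℝ => x + N h * h) (𝓝[>] 0) (𝓝 (x + T)) := by
    have h1 := ((Complex.continuous_ofReal.tendsto T).comp hNh).const_add x
    refine h1.congr fun h => ?_
    simp
  have hst : stadium x 0 (T + 1) ⊆ cutPlane L := stadium_subset (U := cutPlane L)
    (fun x hx t ht => add_mem_cutPlane hx ht) (by simpa using hx) _
  have hformula : ∀ᶠ h in 𝓝[>] (0 : ℝ), ∀ i j, (fun z => Y h z i j) =ᶠ[𝓝 x]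
      (fun z => (stepProd (stepMat h (evalMat (A h))) h (N h) z * U h (z + N h * h)) i j) ∧
      AnalyticAt ℂ (fun z => Y h z i j) x := by
    filter_upwards [hU, hUs, hY, hYU, hpos, hyp.eventually_not_isPole (isCompact_stadium x 0 (T + 1))
      fun z hz => not_isPole_of_mem_cutPlane (hst hz)] with h hUh hUsh hYh hYUh hh hpole i j
    obtain ⟨X₁, hX₁⟩ := hUsh
    obtain ⟨X₂, hX₂⟩ := hYUh
    obtain ⟨hNa, hNb⟩ := hN1 h hh
    have hξN : ξ < x.re + N h * h := by linarith
    have h1 := eventuallyEq_stepProd_mul (X := max X₁ X₂) hh.1.le hUh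
      (fun z hz => hX₁ z ((le_max_left _ _).trans_lt hz)) (fun i j => (hYh i j).meromorphicOn)
      (fun z hz => hX₂ z ((le_max_right _ _).trans_lt hz)) hξN i j
    have h2 : AnalyticAt ℂ (fun z => (stepProd (stepMat h (evalMat (A h))) h (N h) z
        * U h (z + N h * h)) i j) x := by
      refine analyticAt_mul_apply (G := fun z => U h (z + N h * h)) (fun i j =>
        analyticAt_stepProd (fun k hk i j => ?_) i j) (fun i j => ?_) i j
      · have hk' : ((k : ℝ) + 1) * h ≤ T + 1 := by
          have : ((k : ℝ) + 1) ≤ N h := by exact_mod_cast hk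
          have := mul_le_mul_of_nonneg_right this hh.1.le
          linarith [hh.2]
        have hmem := add_mem_stadium (x := x) (r := 0) (Metric.mem_closedBall_self le_rfl)
          (t := ((k : ℝ) + 1) * h) (by have := hh.1; positivity) hk'
        have hmem' := add_mem_cutPlane hx (t := (k : ℝ) * h) (by have := hh.1; positivity)
        push_cast at hmem hmem'
        refine analyticAt_stepMat ?_ (hpole _ hmem) i j
        -- The factor `h / (y - h)` is singular only if the preceding point of the path is `0`,
        -- which the cut excludes.
        rw [show x + (k + 1) * h - h = x + k * h by ring]
        exact ne_zero_of_mem_cutPlane hmem'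
      · refine AnalyticAt.comp_add (f := fun z => U h z i j) (hUh i j _ ?_)
        rw [add_natCast_mul_re]
        exact hξN
    -- The product formula is analytic at `x`, so the normal form upgrades the punctured equality to
    -- an equality of values at `x`.
    have h3 := MeromorphicNFAt.eventuallyEq_nhds_of_analyticAt (hYh i j trivial) h2 h1
    exact ⟨h3, h2.congr h3.symm⟩
  refine ⟨hformula.mono fun h hh i j => (hh i j).2, ?_⟩
  have hEc : ContinuousAt E (x + T) := (hE.hasDerivAt (add_mem_cutPlane hx hT0.le)).continuousAt
  have hu : Tendsto (fun h => U h (x + N h * h) - E (x + N h * h)) (𝓝[>] 0) (𝓝 0) := by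
    have h1 := (hUE _ _ hz (by simpa using hTX)).sub (hEc.tendsto.comp hz)
    rwa [sub_self] at h1
  have hlim := tendsto_stepProd_mul (norm_one_mat_le n) (isOpen_cutPlane L)
    (differentiableOn_inv_smul_evalMat L) (fun z hz => hE.hasDerivAt hz) (x := x) (T := T + 1)
    (by linarith) hst (h := fun h : ℝ => h) (N := N) tendsto_id
    (hpos.mono fun h hh => (hN1 h hh).2.trans (by linarith [hh.2]))
    (fun ε hε => hyp.eventually_stepMat_sub_le (isCompact_stadium x 0 (T + 1)) hst hε) hu
  refine hlim.congr' ?_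
  filter_upwards [hformula] with h hh
  ext i j
  exact (hh i j).1.eq_of_nhds.symm

end Canonical

/-! ### Assembly: one threshold for the step and one abscissa for all series -/

section Main
attribute [local instance] Matrix.linftyOpNormedRing Matrix.linftyOpNormedAlgebra

lemma ConfluenceHypothesis.confluence {n : ℕ} {h₀ C lam : ℝ} (hh₀ : 0 < h₀) (hC : 0 ≤ C) (hlam : 0 ≤ lam)
    {A : ℝ → RatMat n} {L : RatMat n} {a : ℝ → ℕ → Mat n} {ℓ : ℕ → Mat n}
    (hyp : ConfluenceHypothesis h₀ C lam A L a ℓ) :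
    ∃ h₁ ∈ Set.Ioo 0 h₀,
      (∀ h ∈ Set.Ioo 0 h₁, NonResonant (a h 0) ∧
        ∃! Y : ℂ → Mat n, IsCanonicalSolution h (evalMat (A h)) (a h 0) Y) ∧
      (∃ E : ℂ → Mat n, IsFrobeniusSolution L (ℓ 0) E) ∧
      (∀ E E' : ℂ → Mat n, IsFrobeniusSolution L (ℓ 0) E →
        IsFrobeniusSolution L (ℓ 0) E' → Set.EqOn E E' (cutPlane L)) ∧
      ∀ (Y : ℝ → ℂ → Mat n) (E : ℂ → Mat n),
        (∀ h ∈ Set.Ioo 0 h₁, IsCanonicalSolution h (evalMat (A h)) (a h 0) (Y h)) →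
        IsFrobeniusSolution L (ℓ 0) E → ∀ x ∈ cutPlane L,
          (∀ᶠ h in 𝓝[>] (0 : ℝ), ∀ i j, AnalyticAt ℂ (fun z => Y h z i j) x) ∧
          Tendsto (fun h => Y h x) (𝓝[>] 0) (𝓝 (E x)) := by
  obtain ⟨K, hK0, ε, hε, hK⟩ := exists_sylvesterBound (ℓ := ℓ 0)
    fun r hr => hyp.nonresonant.sylvester_injective hr
  obtain ⟨⟨h', ⟨h'0, -⟩, hCh⟩, B, hB⟩ := hyp.type
  have hclose : ∀ᶠ h in 𝓝[>] (0 : ℝ), ‖a h 0 - ℓ 0‖ < ε := by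
    have h1 : Tendsto (fun h => ‖a h 0 - ℓ 0‖) (𝓝[>] 0) (𝓝 0) :=
      tendsto_iff_norm_sub_tendsto_zero.1 (hyp.coeff_tendsto 0)
    exact h1.eventually_lt_const hε
  obtain ⟨u, hu0, hu⟩ := mem_nhdsGT_iff_exists_Ioo_subset.1 (hclose.and
    (Ioo_mem_nhdsGT (show (0 : ℝ) < min h' 1 by positivity)))
  have hu0' : 0 < u := hu0
  -- `u` ensures the Sylvester and type bounds and `h < 1`; the half ensures `h₁ < h₀` strictly.
  set h₁ := min u (h₀ / 2) with hh₁
  have hh₁0 : 0 < h₁ := lt_min hu0' (half_pos hh₀)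
  have hlt : h₁ < h₀ := (min_le_right _ _).trans_lt (half_lt_self hh₀)
  have hsmall : ∀ h ∈ Set.Ioo 0 h₁, ‖a h 0 - ℓ 0‖ < ε ∧ h < h' ∧ h < 1 ∧ h < h₀ := by
    intro h hh
    have h2 := hu ⟨hh.1, hh.2.trans_le (min_le_left _ _)⟩
    obtain ⟨h3, h4⟩ := lt_min_iff.1 h2.2.2
    exact ⟨h2.1, h3, h4, hh.2.trans hlt⟩
  have hB0 : 0 ≤ max B 0 := le_max_right _ _
  obtain ⟨ξ, hξ2, hξ⟩ := exists_uniform_wtSummable (n := n) (B := n * max B 0 + ‖ℓ 0‖) hC hlam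
    (by positivity) hK0.le
  have hKh : ∀ h ∈ Set.Ioo 0 h₁, SylvesterBound K (a h 0) := fun h hh => hK _ (hsmall h hh).1
  have hKℓ : SylvesterBound K (ℓ 0) := hK _ (by rwa [sub_self, norm_zero])
  have hfe : ∀ h, ∃ f, h ∈ Set.Ioo 0 h₁ → IsGaugeCoef h (a h) f := fun h => by
    by_cases hh : h ∈ Set.Ioo 0 h₁
    · obtain ⟨f, hf⟩ := exists_isGaugeCoef (h := h) (hKh h hh)
      exact ⟨f, fun _ => hf⟩
    · exact ⟨0, fun h => absurd h hh⟩
  choose f hf using hfe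
  obtain ⟨f₀, hf₀⟩ := exists_isGaugeCoef (h := 0) hKℓ
  have hsum : ∀ h ∈ Set.Ioo 0 h₁, WtSummable h ξ (a h) ∧ WtSummable h ξ (f h) ∧
      (WtSummable h ξ fun s => (s : ℂ) • f h s) ∧ ∀ r, wt h ξ r * ‖f h r‖ ≤ 2 := by
    intro h hh
    obtain ⟨-, q1, q2, q3⟩ := hsmall h hh
    refine hξ h hh.1.le q2.le (a h) (f h) (fun s hs => hCh h ⟨hh.1, q1⟩ s hs) ?_ (hKh h hh) (hf h hh)
    have := norm_mat_le (A := a h 0) hB0 fun i j =>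
      (hB h ⟨hh.1, q3⟩ i j).trans (le_max_left _ _)
    linarith [norm_nonneg (ℓ 0)]
  -- The limit system is the member of step `0` of the family, and the same `ξ` serves for it.
  have hsum₀ := hξ 0 le_rfl zero_le_one ℓ f₀ hyp.typeBound_limit
    (by linarith [show 0 ≤ n * max B 0 by positivity]) hKℓ hf₀
  have hee : ∀ h, ∃ e : ℂ → Mat n, h ∈ Set.Ioo 0 h₁ → IsConstantSolution h (a h 0) e := fun h => by
    obtain ⟨-, -, Ph, Jh, -, hr, -, -⟩ := hyp.unfolds
    exact ⟨fun x => Ph h * jordanSol h (Jh h) x * (Ph h)⁻¹,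
      fun hh => ⟨Ph h, Jh h, hr h ⟨hh.1, hh.2.trans hlt⟩, fun _ => rfl⟩⟩
  choose e he using hee
  have hI : ∀ᶠ h in 𝓝[>] (0 : ℝ), h ∈ Set.Ioo 0 h₁ := Ioo_mem_nhdsGT hh₁0
  have hhξ : ∀ h ∈ Set.Ioo 0 h₁, h < ξ := fun h hh => by linarith [(hsmall h hh).2.2.1]
  have hexp : ∀ h ∈ Set.Ioo 0 h₁, HasFactorialExpansion h (a h) (evalMat (A h)) := fun h hh =>
    hyp.expansion h ⟨hh.1, hh.2.trans hlt⟩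
  refine ⟨h₁, ⟨hh₁0, hlt⟩, fun h hh => ⟨(hKh h hh).nonResonant, ?_⟩, ?_, ?_, ?_⟩
  · exact existsUnique_isCanonicalSolution hh.1 (hhξ h hh) (hKh h hh) (hexp h hh) (hf h hh)
      (hsum h hh).1 (hsum h hh).2.1 (hsum h hh).2.2.1 (he h hh)
  · exact exists_isFrobeniusSolution (by linarith) hf₀ hsum₀.1 hsum₀.2.1 hsum₀.2.2.1
      hyp.limit_expansion
  · intro E E' hE hE'
    obtain ⟨X, hX⟩ := hE.eq_factSum hKℓ hyp.limit_expansion hf₀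
    obtain ⟨X', hX'⟩ := hE'.eq_factSum hKℓ hyp.limit_expansion hf₀
    refine hE.eqOn hE' (X := max X X') fun x hx => ?_
    obtain ⟨h1, h2⟩ := max_lt_iff.1 hx
    rw [hX x h1, hX' x h2]
  · intro Y E hY hE x hx
    obtain ⟨X, hX⟩ := hE.eq_factSum hKℓ hyp.limit_expansion hf₀
    have hlimf := tendsto_gaugeCoef hyp.coeff_tendsto (hI.mono hKh) (hI.mono hf) hf₀
    -- The margin `2` is the shift that `wt_add_two_le` requires for the dominated convergence of
    -- the gauge series.
    refine hyp.tendsto_of_eq_right (ξ := ξ) (X := max X (ξ + 2))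
      (U := fun h z => factSum h (f h) z * e h z) hE ?_ ?_ ?_ ?_ ?_ hx
    · filter_upwards [hI] with h hh i j z hz
      exact analyticAt_factSum_mul hh.1 (by linarith) (hsum h hh).2.1 (he h hh) i j hz
    · filter_upwards [hI] with h hh
      exact factSum_mul_sub_step hh.1 (isNormalizingGauge_factSum hh.1 (hhξ h hh) (hexp h hh)
        (hf h hh) (hsum h hh).1 (hsum h hh).2.1 (hsum h hh).2.2.1) (he h hh)
    · filter_upwards [hI] with h hh i j
      exact (hY h hh).1 i j
    · filter_upwards [hI] with h hh
      exact (hY h hh).eq_factSum_mul hh.1 (hKh h hh) (hexp h hh) (hf h hh) (he h hh)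
    · intro z z₀ hz hz₀
      obtain ⟨h1, h2⟩ := max_lt_iff.1 hz₀
      rw [hX z₀ h1]
      exact (tendsto_factSum (by linarith) hlimf (hI.mono fun h hh => (hsum h hh).2.2.2) hz h2).mul
        (hyp.unfolds.tendsto_constantSolution hh₀ (hI.mono he) hz (by linarith))

end Main

end Confluence

end

theorem mainTheorem3 {n : ℕ} (h₀ C lam : ℝ) (hh₀ : 0 < h₀) (hC : 0 ≤ C) (hlam : 0 ≤ lam)
    (A : ℝ → Confluence.RatMat n) (L : Confluence.RatMat n)
    (a : ℝ → ℕ → Confluence.Mat n) (ℓ : ℕ → Confluence.Mat n)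
    (hyp : Confluence.ConfluenceHypothesis h₀ C lam A L a ℓ) :
    ∃ h₁ ∈ Set.Ioo 0 h₀,
      (∀ h ∈ Set.Ioo 0 h₁, Confluence.NonResonant (a h 0) ∧
        ∃! Y : ℂ → Confluence.Mat n,
          Confluence.IsCanonicalSolution h (Confluence.evalMat (A h)) (a h 0) Y) ∧
      (∃ E : ℂ → Confluence.Mat n, Confluence.IsFrobeniusSolution L (ℓ 0) E) ∧
      (∀ E E' : ℂ → Confluence.Mat n, Confluence.IsFrobeniusSolution L (ℓ 0) E →
        Confluence.IsFrobeniusSolution L (ℓ 0) E' → Set.EqOn E E' (Confluence.cutPlane L)) ∧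
      ∀ (Y : ℝ → ℂ → Confluence.Mat n) (E : ℂ → Confluence.Mat n),
        (∀ h ∈ Set.Ioo 0 h₁,
          Confluence.IsCanonicalSolution h (Confluence.evalMat (A h)) (a h 0) (Y h)) →
        Confluence.IsFrobeniusSolution L (ℓ 0) E →
        ∀ x ∈ Confluence.cutPlane L,
          (∀ᶠ h in 𝓝[>] (0 : ℝ), ∀ i j, AnalyticAt ℂ (fun z => Y h z i j) x) ∧
          Tendsto (fun h => Y h x) (𝓝[>] 0) (𝓝 (E x)) :=
  hyp.confluence hh₀ hC hlam
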